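/- **Proposition 8.1.** Let $\alpha\in(0,1)$. On the unit circle $\mathbb T$ let $$X=\Big\{f\in C^{2-\alpha}(\mathbb T):\ f(w)=\sum_{n\ge 0}b_n\overline w^{\,n},\ b_n\in\mathbb R\Big\},\qquad Y=\Big\{g\in C^{1-\alpha}(\mathbb T):\ g(w)=i\sum_{n\ge 1}g_n\,(w^n-\overline w^{\,n}),\ g_n\in\mathbb R\Big\}$$ (Fourier series; $X$ and $Y$ are real vector spaces with the Hölder norms of $C^{2-\alpha}(\mathbb T)$ and $C^{1-\alpha}(\mathbb T)$). For $\Omega\in\mathbb R$ and $f\in X$ put $\phi(w)=w+f(w)$ and $$F(\Omega,f)(w)=\operatorname{Im}\Big\{\Big(\Omega\,\phi(w)-\frac{C_\alpha}{2\pi i}\int_{\mathbb T}\frac{\phi'(\tau)}{|\phi(w)-\phi(\tau)|^{\alpha}}\,d\tau\Big)\,\overline w\,\overline{\phi'(w)}\Big\},\qquad C_\alpha=\frac{\Gamma(\alpha/2)}{2^{1-\alpha}\,\Gamma(\frac{2-\alpha}{2})},$$ where $'$ is the derivative $d/dw$ along $\mathbb T$. For $m\ge 1$ let $$\Omega_m^\alpha=\frac{\Gamma(1-\alpha)}{2^{1-\alpha}\Gamma^2(1-\frac\alpha2)}\left(\frac{\Gamma(1+\frac\alpha2)}{\Gamma(2-\frac\alpha2)}-\frac{\Gamma(m+\frac\alpha2)}{\Gamma(m+1-\frac\alpha2)}\right),\qquad\text{so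 that }\Omega_1^\alpha=0.$$ For all $f$ in some neighbourhood of $0$ in $X$ and all $\Omega\in\mathbb R$ one has $F(\Omega,f)\in Y$, the map $F(\Omega,\cdot)$ is Fréchet differentiable at $0$ as a map into $Y$, and its derivative $\partial_fF(\Omega,0):X\to Y$ is the Fourier multiplier $$\partial_fF(\Omega,0):\ \sum_{n\ge0}b_n\overline w^{\,n}\ \longmapsto\ \frac i2\sum_{n\ge 0}(n+1)\big(\Omega-\Omega_{n+1}^\alpha\big)\,b_n\,\big(w^{n+1}-\overline w^{\,n+1}\big).$$ Moreover: 1. The kernel of $\partial_fF(\Omega,0)$ is nontrivial if and only if $\Omega=0$ or $\Omega=\Omega_m^\alpha$ for some $m\ge2$. For $\Omega=0$ it consists of the real constants; for $\Omega=\Omega_m^\alpha$, $m\ge2$, it is the one-dimensional space spanned by $v_m(w)=\overline w^{\,m-1}$. 2. For $m\ge2$ the range of $\partial_fF(\Omega_m^\alpha,0)$ is closed in $Y$, has codimension one, and equals $$\Big\{g\in C^{1-\alpha}(\mathbb T):\ g(w)=i\sum_{n\ge1,\,n\ne m}g_n\,(w^n-\overline w^{\,n}),\ g_n\in\mathbb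 R\Big\}.$$ 3. (Transversality.) For $m\ge2$ the map $\Omega\mapsto\partial_fF(\Omega,0)\in\mathcal L(X,Y)$ is differentiable at $\Omega_m^\alpha$, and $\partial_\Omega\partial_fF(\Omega_m^\alpha,0)\,v_m$ does not belong to the range of $\partial_fF(\Omega_m^\alpha,0)$. -/

import Mathlib

open scoped NNReal Topology ComplexConjugate

noncomputable section

namespace VState

/-! ### Functions on the unit circle -/

/-- The function `η ↦ f (e^{iη})` on the real line. -/
def lift (f : Circle → ℂ) (η : ℝ) : ℂ := f (Circle.exp η)

/-- The derivative `df/dw (e^{iη}) = -i e^{-iη} (d/dη) f(e^{iη})` along the unit circle. -/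
def dw (f : Circle → ℂ) (w : Circle) : ℂ :=
  -Complex.I * conj (w : ℂ) * deriv (lift f) (Complex.arg (w : ℂ))

/-- The mean contour integral `(1 / 2πi) ∫_𝕋 g(τ) dτ`, with `τ = e^{iθ}`, `dτ = i e^{iθ} dθ`. -/
def contourMean (g : Circle → ℂ) : ℂ :=
  (2 * (Real.pi : ℂ) * Complex.I)⁻¹ *
    ∫ θ in (0 : ℝ)..(2 * Real.pi), g (Circle.exp θ) * (Complex.I * (Circle.exp θ : ℂ))

/-- The `n`-th Fourier coefficient: the coefficient of `w ^ n` in the Fourier series of `f`. -/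
def coeff (f : Circle → ℂ) (n : ℤ) : ℂ :=
  fourierCoeff (fun x : UnitAddCircle => f (AddCircle.toCircle x)) n

/-! ### Hölder classes -/

/-- The class `C^γ(𝕋)` (used for `0 < γ < 1`); distances on `𝕋` are chordal. -/
def IsHolder (γ : ℝ≥0) (f : Circle → ℂ) : Prop := Continuous f ∧ MemHolder γ f

/-- The class `C^{1+γ}(𝕋)`: `f` is of class `C^1` and `df/dw` is in `C^γ(𝕋)`. -/
def IsHolderOne (γ : ℝ≥0) (f : Circle → ℂ) : Prop :=
  ContDiff ℝ 1 (lift f) ∧ IsHolder γ (dw f)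

/-- The `L^∞` norm of a bounded function. -/
def supNorm (f : Circle → ℂ) : ℝ := ⨆ w, ‖f w‖

/-- The norm of `C^γ(𝕋)`. -/
def holderNorm (γ : ℝ≥0) (f : Circle → ℂ) : ℝ := supNorm f + (nnHolderNorm γ f : ℝ)

/-- The norm of `C^{1+γ}(𝕋)`. -/
def holderOneNorm (γ : ℝ≥0) (f : Circle → ℂ) : ℝ := supNorm f + holderNorm γ (dw f)

/-! Elementary facts on these classes. -/

lemma IsHolderOne.continuous {γ : ℝ≥0} {f : Circle → ℂ} (hf : IsHolderOne γ f) :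
    Continuous f := by
  have hq : Topology.IsQuotientMap (fun η : ℝ => (η : AddCircle (2 * Real.pi))) :=
    isQuotientMap_quotient_mk'
  have h : Continuous (f ∘ AddCircle.homeomorphCircle') := hq.continuous_iff.2 hf.1.continuous
  simpa [Function.comp_assoc] using h.comp AddCircle.homeomorphCircle'.symm.continuous

lemma bdd {f : Circle → ℂ} (hf : Continuous f) : BddAbove (Set.range fun w => ‖f w‖) :=
  (isCompact_range hf.norm).bddAbove

lemma supNorm_nonneg (f : Circle → ℂ) : 0 ≤ supNorm f :=
  Real.iSup_nonneg fun _ => norm_nonneg _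

lemma supNorm_add_le {f g : Circle → ℂ} (hf : Continuous f) (hg : Continuous g) :
    supNorm (f + g) ≤ supNorm f + supNorm g :=
  ciSup_le fun w => (norm_add_le _ _).trans
    (add_le_add (le_ciSup (bdd hf) w) (le_ciSup (bdd hg) w))

lemma supNorm_smul (c : ℝ) (f : Circle → ℂ) : supNorm (c • f) = ‖c‖ * supNorm f := by
  simp only [supNorm, Pi.smul_apply, norm_smul]
  exact (Real.mul_iSup_of_nonneg (norm_nonneg c) _).symm

lemma eq_zero_of_supNorm {f : Circle → ℂ} (hf : Continuous f) (h : supNorm f = 0) : f = 0 := by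
  funext w
  exact norm_le_zero_iff.1 ((le_ciSup (bdd hf) w).trans h.le)

lemma holderNorm_nonneg (γ : ℝ≥0) (f : Circle → ℂ) : 0 ≤ holderNorm γ f :=
  add_nonneg (supNorm_nonneg f) (NNReal.coe_nonneg _)

lemma holderNorm_add_le {γ : ℝ≥0} {f g : Circle → ℂ} (hf : IsHolder γ f) (hg : IsHolder γ g) :
    holderNorm γ (f + g) ≤ holderNorm γ f + holderNorm γ g := by
  have h1 := supNorm_add_le hf.1 hg.1
  have h2 : (nnHolderNorm γ (f + g) : ℝ) ≤ nnHolderNorm γ f + nnHolderNorm γ g := by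
    exact_mod_cast hf.2.nnHolderNorm_add_le hg.2
  unfold holderNorm
  linarith

lemma holderNorm_smul {γ : ℝ≥0} (c : ℝ) {f : Circle → ℂ} (hf : IsHolder γ f) :
    holderNorm γ (c • f) = ‖c‖ * holderNorm γ f := by
  unfold holderNorm
  rw [supNorm_smul, hf.2.nnHolderNorm_smul, NNReal.coe_mul, coe_nnnorm, mul_add]

lemma IsHolder.add {γ : ℝ≥0} {f g : Circle → ℂ} (hf : IsHolder γ f) (hg : IsHolder γ g) :
    IsHolder γ (f + g) := ⟨hf.1.add hg.1, hf.2.add hg.2⟩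

lemma IsHolder.smul {γ : ℝ≥0} (c : ℝ) {f : Circle → ℂ} (hf : IsHolder γ f) :
    IsHolder γ (c • f) := ⟨hf.1.const_smul c, hf.2.smul⟩

lemma IsHolder.zero (γ : ℝ≥0) : IsHolder γ (0 : Circle → ℂ) :=
  ⟨continuous_const, memHolder_zero⟩

lemma IsHolderOne.dw_add {γ : ℝ≥0} {f g : Circle → ℂ} (hf : IsHolderOne γ f)
    (hg : IsHolderOne γ g) : dw (f + g) = dw f + dw g := by
  funext w
  have h := deriv_add (hf.1.differentiable one_ne_zero (Complex.arg (w : ℂ)))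
    (hg.1.differentiable one_ne_zero (Complex.arg (w : ℂ)))
  have h' : lift (f + g) = lift f + lift g := rfl
  simp only [dw, h', h, Pi.add_apply, mul_add]

lemma dw_smul (c : ℝ) (f : Circle → ℂ) : dw (c • f) = c • dw f := by
  funext w
  have h' : lift (c • f) = c • lift f := rfl
  simp only [dw, h', Pi.smul_apply, deriv_const_smul_field, mul_smul_comm]

lemma IsHolderOne.add {γ : ℝ≥0} {f g : Circle → ℂ} (hf : IsHolderOne γ f)
    (hg : IsHolderOne γ g) : IsHolderOne γ (f + g) := by
  refine ⟨hf.1.add hg.1, ?_⟩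
  rw [hf.dw_add hg]
  exact hf.2.add hg.2

lemma IsHolderOne.smul {γ : ℝ≥0} (c : ℝ) {f : Circle → ℂ} (hf : IsHolderOne γ f) :
    IsHolderOne γ (c • f) := by
  refine ⟨hf.1.const_smul c, ?_⟩
  rw [dw_smul]
  exact hf.2.smul c

lemma IsHolderOne.zero (γ : ℝ≥0) : IsHolderOne γ (0 : Circle → ℂ) := by
  refine ⟨contDiff_const (c := (0 : ℂ)), ?_⟩
  have h : dw (0 : Circle → ℂ) = 0 := by
    simpa using dw_smul 0 (0 : Circle → ℂ)
  rw [h]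
  exact IsHolder.zero γ

lemma coeff_add {f g : Circle → ℂ} (hf : Continuous f) (hg : Continuous g) (n : ℤ) :
    coeff (f + g) n = coeff f n + coeff g n := by
  have hi : ∀ {u : Circle → ℂ}, Continuous u → MeasureTheory.Integrable
      (fun x : UnitAddCircle => u (AddCircle.toCircle x)) AddCircle.haarAddCircle := by
    intro u hu
    have hc : Continuous (fun x : UnitAddCircle => u (AddCircle.toCircle x)) :=
      hu.comp AddCircle.continuous_toCircle
    exact hc.integrable_of_hasCompactSupport (HasCompactSupport.of_compactSpace _)
  exact congrFun (fourierCoeff.add (hi hf) (hi hg)) n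

lemma coeff_smul (c : ℝ) (f : Circle → ℂ) (n : ℤ) : coeff (c • f) n = c * coeff f n := by
  have h := fourierCoeff.const_mul (fun x : UnitAddCircle => f (AddCircle.toCircle x)) c n
  rw [coeff, coeff, ← h]
  rfl

/-! ### The spaces `X` and `Y` -/

/-- `X = {f ∈ C^{2-α}(𝕋) : f(w) = ∑_{n ≥ 0} b_n w̄^n, b_n ∈ ℝ}`: the Fourier coefficients are real
and those of `w ^ n`, `n ≥ 1`, vanish. -/
def IsX (α : ℝ) (f : Circle → ℂ) : Prop :=
  IsHolderOne (1 - α).toNNReal f ∧ (∀ n : ℤ, (coeff f n).im = 0) ∧ ∀ n : ℤ, 0 < n → coeff f n = 0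

/-- `Y = {g ∈ C^{1-α}(𝕋) : g(w) = i ∑_{n ≥ 1} g_n (w^n - w̄^n), g_n ∈ ℝ}`: the Fourier coefficients
are purely imaginary and odd in `n`. -/
def IsY (α : ℝ) (g : Circle → ℂ) : Prop :=
  IsHolder (1 - α).toNNReal g ∧ (∀ n : ℤ, (coeff g n).re = 0) ∧
    ∀ n : ℤ, coeff g (-n) = -coeff g n

/-- The vector space underlying `X`. -/
def submoduleX (α : ℝ) : Submodule ℝ (Circle → ℂ) where
  carrier := {f | IsX α f}
  add_mem' := by
    rintro f g ⟨hf, hf1, hf2⟩ ⟨hg, hg1, hg2⟩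
    have h := coeff_add hf.continuous hg.continuous
    refine ⟨hf.add hg, fun n => ?_, fun n hn => ?_⟩
    · rw [h, Complex.add_im, hf1, hg1, add_zero]
    · rw [h, hf2 n hn, hg2 n hn, add_zero]
  zero_mem' := by
    have h : ∀ n, coeff (0 : Circle → ℂ) n = 0 := fun n => by
      simpa using coeff_smul 0 (0 : Circle → ℂ) n
    exact ⟨IsHolderOne.zero _, fun n => by rw [h]; rfl, fun n _ => h n⟩
  smul_mem' := by
    rintro c f ⟨hf, hf1, hf2⟩
    refine ⟨hf.smul c, fun n => ?_, fun n hn => ?_⟩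
    · rw [coeff_smul, Complex.im_ofReal_mul, hf1, mul_zero]
    · rw [coeff_smul, hf2 n hn, mul_zero]

/-- The vector space underlying `Y`. -/
def submoduleY (α : ℝ) : Submodule ℝ (Circle → ℂ) where
  carrier := {g | IsY α g}
  add_mem' := by
    rintro f g ⟨hf, hf1, hf2⟩ ⟨hg, hg1, hg2⟩
    have h := coeff_add hf.1 hg.1
    refine ⟨hf.add hg, fun n => ?_, fun n => ?_⟩
    · rw [h, Complex.add_re, hf1, hg1, add_zero]
    · rw [h, h, hf2, hg2, neg_add]
  zero_mem' := by
    have h : ∀ n, coeff (0 : Circle → ℂ) n = 0 := fun n => by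
      simpa using coeff_smul 0 (0 : Circle → ℂ) n
    exact ⟨IsHolder.zero _, fun n => by rw [h]; rfl, fun n => by rw [h, h, neg_zero]⟩
  smul_mem' := by
    rintro c f ⟨hf, hf1, hf2⟩
    refine ⟨hf.smul c, fun n => ?_, fun n => ?_⟩
    · rw [coeff_smul, Complex.re_ofReal_mul, hf1, mul_zero]
    · rw [coeff_smul, coeff_smul, hf2, mul_neg]

/-- The space `X`, which carries the norm of `C^{2-α}(𝕋)` below (and not the topology of pointwise
convergence that a subspace of `Circle → ℂ` would inherit). -/
def SpaceX (α : ℝ) : Type := submoduleX α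

/-- The space `Y`, which carries the norm of `C^{1-α}(𝕋)` below. -/
def SpaceY (α : ℝ) : Type := submoduleY α

instance (α : ℝ) : AddCommGroup (SpaceX α) := inferInstanceAs (AddCommGroup (submoduleX α))

instance (α : ℝ) : Module ℝ (SpaceX α) := inferInstanceAs (Module ℝ (submoduleX α))

instance (α : ℝ) : AddCommGroup (SpaceY α) := inferInstanceAs (AddCommGroup (submoduleY α))

instance (α : ℝ) : Module ℝ (SpaceY α) := inferInstanceAs (Module ℝ (submoduleY α))

/-- Elements of `X` are functions on the circle. -/
def SpaceX.toFun {α : ℝ} (f : SpaceX α) : Circle → ℂ := f.1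

/-- Elements of `Y` are functions on the circle. -/
def SpaceY.toFun {α : ℝ} (g : SpaceY α) : Circle → ℂ := g.1

instance (α : ℝ) : Norm (SpaceX α) := ⟨fun f => holderOneNorm (1 - α).toNNReal f.toFun⟩

instance (α : ℝ) : Norm (SpaceY α) := ⟨fun g => holderNorm (1 - α).toNNReal g.toFun⟩

lemma SpaceX.core (α : ℝ) : NormedSpace.Core ℝ (SpaceX α) where
  norm_nonneg f := add_nonneg (supNorm_nonneg _) (holderNorm_nonneg _ _)
  norm_smul c f := by
    change supNorm (c • f.toFun) + holderNorm _ (dw (c • f.toFun)) =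
      ‖c‖ * (supNorm f.toFun + holderNorm _ (dw f.toFun))
    have hf : IsX α f.toFun := f.2
    rw [dw_smul, supNorm_smul, holderNorm_smul c hf.1.2, mul_add]
  norm_triangle f g := by
    change supNorm (f.toFun + g.toFun) + holderNorm _ (dw (f.toFun + g.toFun)) ≤
      (supNorm f.toFun + holderNorm _ (dw f.toFun)) +
        (supNorm g.toFun + holderNorm _ (dw g.toFun))
    have hf : IsX α f.toFun := f.2
    have hg : IsX α g.toFun := g.2
    rw [hf.1.dw_add hg.1]
    linarith [supNorm_add_le hf.1.continuous hg.1.continuous, holderNorm_add_le hf.1.2 hg.1.2]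
  norm_eq_zero_iff f := by
    constructor
    · intro h
      have h' : supNorm f.toFun + holderNorm (1 - α).toNNReal (dw f.toFun) = 0 := h
      have hf : IsX α f.toFun := f.2
      have h0 : supNorm f.toFun = 0 := by
        linarith [supNorm_nonneg f.toFun, holderNorm_nonneg (1 - α).toNNReal (dw f.toFun)]
      exact Subtype.ext (eq_zero_of_supNorm hf.1.continuous h0)
    · rintro rfl
      change supNorm (0 : Circle → ℂ) + holderNorm _ (dw (0 : Circle → ℂ)) = 0
      have h : dw (0 : Circle → ℂ) = 0 := by simpa using dw_smul 0 (0 : Circle → ℂ)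
      simp [h, supNorm, holderNorm]

lemma SpaceY.core (α : ℝ) : NormedSpace.Core ℝ (SpaceY α) where
  norm_nonneg g := holderNorm_nonneg _ _
  norm_smul c g := holderNorm_smul c g.2.1
  norm_triangle f g := holderNorm_add_le f.2.1 g.2.1
  norm_eq_zero_iff g := by
    constructor
    · intro h
      have h' : supNorm g.toFun + (nnHolderNorm (1 - α).toNNReal g.toFun : ℝ) = 0 := h
      have hg : IsY α g.toFun := g.2
      have h0 : supNorm g.toFun = 0 := by
        linarith [supNorm_nonneg g.toFun,
          NNReal.coe_nonneg (nnHolderNorm (1 - α).toNNReal g.toFun)]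
      exact Subtype.ext (eq_zero_of_supNorm hg.1.1 h0)
    · rintro rfl
      change supNorm (0 : Circle → ℂ) + (nnHolderNorm _ (0 : Circle → ℂ) : ℝ) = 0
      simp [supNorm]

instance (α : ℝ) : NormedAddCommGroup (SpaceX α) := NormedAddCommGroup.ofCore (SpaceX.core α)

instance (α : ℝ) : NormedSpace ℝ (SpaceX α) := NormedSpace.ofCore (SpaceX.core α)

instance (α : ℝ) : NormedAddCommGroup (SpaceY α) := NormedAddCommGroup.ofCore (SpaceY.core α)

instance (α : ℝ) : NormedSpace ℝ (SpaceY α) := NormedSpace.ofCore (SpaceY.core α)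

/-! ### The nonlinear functional and its linearization at the disc -/

/-- `C_α = Γ(α/2) / (2^{1-α} Γ((2-α)/2))`. -/
def Cconst (α : ℝ) : ℝ :=
  Real.Gamma (α / 2) / ((2 : ℝ) ^ (1 - α) * Real.Gamma ((2 - α) / 2))

/-- `G(Ω, φ)(w) = Im {(Ω φ(w) - C_α (1/2πi) ∫_𝕋 φ'(τ) |φ(w) - φ(τ)|^{-α} dτ) w̄ conj(φ'(w))}`. -/
def patchG (α Ω : ℝ) (φ : Circle → ℂ) (w : Circle) : ℝ :=
  (((Ω : ℂ) * φ w -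
      (Cconst α : ℂ) * contourMean (fun τ => dw φ τ / ((‖φ w - φ τ‖ ^ α : ℝ) : ℂ))) *
    (conj (w : ℂ) * conj (dw φ w))).im

/-- `F(Ω, f)(w) = G(Ω, w + f(w))(w)`. -/
def patchF (α Ω : ℝ) (f : Circle → ℂ) (w : Circle) : ℂ :=
  (patchG α Ω (fun z => (z : ℂ) + f z) w : ℂ)

open Classical in
/-- `F(Ω, ·)` as a map from `X` to `Y`; it is meant for `f` near `0`, where `F(Ω, f)` lies in `Y`,
and is given the value `0` where `F(Ω, f)` does not lie in `Y`. -/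
def mapF (α Ω : ℝ) (f : SpaceX α) : SpaceY α :=
  if h : IsY α (patchF α Ω f.toFun) then ⟨patchF α Ω f.toFun, h⟩ else 0

/-- The linearized operator `∂_f F(Ω, 0) : X → Y` (Fréchet derivative). -/
def linearized (α Ω : ℝ) : SpaceX α →L[ℝ] SpaceY α := fderiv ℝ (mapF α Ω) 0

/-- The numbers `Ω_m^α`. -/
def Omega (α : ℝ) (m : ℕ) : ℝ :=
  Real.Gamma (1 - α) / ((2 : ℝ) ^ (1 - α) * Real.Gamma (1 - α / 2) ^ 2) *
    (Real.Gamma (1 + α / 2) / Real.Gamma (2 - α / 2) -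
      Real.Gamma (m + α / 2) / Real.Gamma (m + 1 - α / 2))

end VState

end

/-!
The equation for rotating patches of the generalized surface quasi-geostrophic flow, linearized at
the disc.

**Differentiability.** For `φ(w) = w + f(w)` one has `|φ(w) - φ(τ)| = |w - τ| |1 + q(w, τ)|`, where
`q` is the difference quotient of `f`. The expansion `|1 + q|^{-α} = 1 - α Re q + O(|q|²)` splits
the velocity integral into weakly singular integrals `∫ |w - τ|^{-α} n(w, τ) dτ` whose symbols `n`
are constant, linear and quadratic in `f`. Such an integral is `(1 - α)`-Hölder with a norm bounded by
the size of the symbol (`IsSymbol.hb_singInt`), because the increments of the integrand over the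
distance `d` are dominated by the kernel `r^{-α} min(1, d / r)`, of integral `O(d^{1-α})`. Hence `F`
equals its linear part `linOp` up to `O(‖f‖²)` in `C^{1-α}` (`exists_quadratic_bound`), and real
Fourier coefficients of `f` make `F(Ω, f)` odd under reflection, hence an element of `Y`.

**The multiplier.** Rotation invariance of the kernel expresses the Fourier coefficients of the
linear part through the moments `M_k = ∫ |s - 1|^{-α} s^k ds` (`coeff_im_linE`). Integration of the
derivative of `e^{ikθ} i e^{iθ/2} (2 sin (θ/2))^{1-α}` over a period gives the recursion
`(k + 1 - α/2) M_{k+1} = (k + α/2) M_k`, and a Beta integral gives `M_0`; together they yield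
`Ω_m = C_α (M_1 - M_m)` (`Omega_eq`) and show that the `M_k` decrease strictly. The kernel and the
transversality condition are then read off from the coefficients.

**The range.** If the `m`-th coefficient of `g ∈ Y` vanishes, the equation
`∂_f F(Ω_m, 0) h = g` has a formal solution with coefficients proportional to
`g_{n+1} / ((n + 1) (M_{n+1} - M_m))`, and the point is that it lies in `C^{2-α}`
(`exists_linearized_eq`). Division by `n + 1` is an integration along the circle. The sequence
`(M_n - M_m)⁻¹` is a multiplier of `C^{1-α}` (`isMultiplier_resolvent`): its geometric expansion in
powers of `M_n`, which are the symbols of convolutions with the integrable Riesz kernel, leaves an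
absolutely summable remainder. Finally the projection onto negative frequencies preserves `C^{1-α}`
by Privalov's theorem for the conjugation operator (`hb_hilb`). So the range is the kernel of one
continuous nonzero functional.
-/

noncomputable section

open MeasureTheory

instance : MeasurableSpace Circle := borel Circle
instance : BorelSpace Circle := ⟨rfl⟩

namespace VState

/-! ### Haar measure and Fourier coefficients -/

/-- The Haar probability measure on the circle. -/
def haar : Measure Circle :=
  Measure.map (AddCircle.toCircle : UnitAddCircle → Circle) AddCircle.haarAddCircle

lemma measurableEmbedding_toCircle :
    MeasurableEmbedding (AddCircle.toCircle : UnitAddCircle → Circle) := by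
  have h := (AddCircle.homeomorphCircle (T := 1) one_ne_zero).measurableEmbedding
  convert h using 1
  funext x
  exact (AddCircle.homeomorphCircle_apply one_ne_zero x).symm

instance : IsProbabilityMeasure haar :=
  Measure.isProbabilityMeasure_map measurableEmbedding_toCircle.measurable.aemeasurable

lemma integral_haar {E : Type*} [NormedAddCommGroup E] [NormedSpace ℝ E] (u : Circle → E) :
    ∫ w, u w ∂haar = ∫ x : UnitAddCircle, u (AddCircle.toCircle x) ∂AddCircle.haarAddCircle :=
  measurableEmbedding_toCircle.integral_map _

instance : haar.IsMulLeftInvariant := by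
  constructor
  intro g
  obtain ⟨y, rfl⟩ := (AddCircle.homeomorphCircle (T := 1) one_ne_zero).surjective g
  rw [AddCircle.homeomorphCircle_apply, haar,
    Measure.map_map (measurable_const_mul _) measurableEmbedding_toCircle.measurable]
  conv_rhs => rw [← map_add_left_eq_self AddCircle.haarAddCircle y,
    Measure.map_map measurableEmbedding_toCircle.measurable (measurable_const_add _)]
  congr 1
  funext x
  simp [AddCircle.toCircle_add]

instance : haar.IsInvInvariant := by
  constructor
  rw [Measure.inv, haar,
    Measure.map_map measurable_inv measurableEmbedding_toCircle.measurable]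
  conv_rhs => rw [← Measure.map_neg_eq_self (AddCircle.haarAddCircle (T := 1)),
    Measure.map_map measurableEmbedding_toCircle.measurable measurable_neg]
  congr 1
  funext x
  simp [AddCircle.toCircle_neg]

instance : NullSingletonClass haar := by
  constructor
  intro w
  rw [haar, Measure.map_apply measurableEmbedding_toCircle.measurable (measurableSet_singleton w)]
  have h : (AddCircle.toCircle ⁻¹' {w} : Set UnitAddCircle).Subsingleton := by
    intro x hx y hy
    exact AddCircle.injective_toCircle one_ne_zero (hx.trans hy.symm)
  rcases h.eq_empty_or_singleton with h | ⟨x, h⟩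
  · rw [h, measure_empty]
  · have h1 := AddCircle.volume_closedBall 1 (x := x) 0
    rw [AddCircle.volume_eq_smul_haarAddCircle] at h1
    rw [h]
    simpa using h1

/-- The normalised Haar integral as an integral over an interval of length `2π`. -/
lemma integral_haar_eq_intervalIntegral (u : Circle → ℂ) (a : ℝ) :
    ∫ w, u w ∂haar = (2 * Real.pi : ℂ)⁻¹ * ∫ θ in a..a + 2 * Real.pi, u (Circle.exp θ) := by
  have h := fourierCoeff_eq_intervalIntegral (T := 1)
    (fun x : UnitAddCircle => u (AddCircle.toCircle x)) 0 (a / (2 * Real.pi))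
  have h2 := intervalIntegral.integral_comp_mul_left (a := a / (2 * Real.pi))
    (b := a / (2 * Real.pi) + 1) (fun θ => u (Circle.exp θ)) Real.two_pi_pos.ne'
  simp only [fourierCoeff, neg_zero, fourier_zero, one_smul, div_one,
    AddCircle.toCircle_apply_mk] at h
  rw [integral_haar, h, h2]
  have e1 : 2 * Real.pi * (a / (2 * Real.pi)) = a := by field_simp
  have e2 : 2 * Real.pi * (a / (2 * Real.pi) + 1) = a + 2 * Real.pi := by field_simp
  rw [e1, e2, Complex.real_smul]
  push_cast
  rfl

lemma contourMean_eq (g : Circle → ℂ) : contourMean g = ∫ τ, g τ * (τ : ℂ) ∂haar := by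
  rw [integral_haar_eq_intervalIntegral _ 0, contourMean, zero_add]
  have h : (fun θ : ℝ => g (Circle.exp θ) * (Complex.I * (Circle.exp θ : ℂ))) =
      fun θ : ℝ => Complex.I * (g (Circle.exp θ) * (Circle.exp θ : ℂ)) := by
    funext θ; ring
  rw [h, intervalIntegral.integral_const_mul, mul_inv, mul_assoc,
    inv_mul_cancel_left₀ Complex.I_ne_zero]

lemma coeff_eq_integral (f : Circle → ℂ) (n : ℤ) :
    coeff f n = ∫ w, (w : ℂ) ^ (-n) * f w ∂haar := by
  rw [integral_haar, coeff, fourierCoeff]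
  refine integral_congr_ae (.of_forall fun x => ?_)
  simp only [fourier_apply, smul_eq_mul, AddCircle.toCircle_zsmul, Circle.coe_zpow]

lemma integrable_of_continuous {u : Circle → ℂ} (hu : Continuous u) : Integrable u haar :=
  hu.integrable_of_hasCompactSupport (HasCompactSupport.of_compactSpace _)

lemma continuous_coe : Continuous fun w : Circle => (w : ℂ) := continuous_subtype_val

lemma continuous_zpow_coe (n : ℤ) : Continuous fun w : Circle => (w : ℂ) ^ n := by
  have : (fun w : Circle => (w : ℂ) ^ n) = fun w : Circle => ((w ^ n : Circle) : ℂ) := by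
    funext w; simp
  rw [this]
  exact continuous_coe.comp (continuous_zpow n)

lemma norm_zpow_coe (n : ℤ) (w : Circle) : ‖(w : ℂ) ^ n‖ = 1 := by
  rw [norm_zpow, Circle.norm_coe, one_zpow]

lemma coeff_conj (f : Circle → ℂ) (n : ℤ) :
    coeff (fun w => conj (f w)) n = conj (coeff f (-n)) := by
  rw [coeff_eq_integral, coeff_eq_integral, ← integral_conj]
  congr 1
  funext w
  rw [map_mul, map_zpow₀, ← Circle.coe_inv_eq_conj, Circle.coe_inv, inv_zpow', neg_neg]

lemma coeff_comp_inv (f : Circle → ℂ) (n : ℤ) :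
    coeff (fun w => f w⁻¹) n = coeff f (-n) := by
  rw [coeff_eq_integral, coeff_eq_integral,
    ← integral_inv_eq_self (fun w : Circle => (w : ℂ) ^ (- -n) * f w)]
  congr 1
  funext w
  rw [Circle.coe_inv, inv_zpow, ← zpow_neg, neg_neg]

lemma coeff_comp_mul_right (f : Circle → ℂ) (s : Circle) (n : ℤ) :
    coeff (fun w => f (w * s)) n = (s : ℂ) ^ n * coeff f n := by
  rw [coeff_eq_integral, coeff_eq_integral,
    ← integral_mul_right_eq_self (fun w : Circle => (w : ℂ) ^ (-n) * f w) s,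
    ← integral_const_mul]
  congr 1
  funext w
  rw [Circle.coe_mul, mul_zpow, zpow_neg (s : ℂ)]
  have : (s : ℂ) ^ n ≠ 0 := zpow_ne_zero _ s.coe_ne_zero
  field_simp

lemma coeff_const_mul (c : ℂ) (f : Circle → ℂ) (n : ℤ) :
    coeff (fun w => c * f w) n = c * coeff f n := by
  rw [coeff_eq_integral, coeff_eq_integral, ← integral_const_mul]
  congr 1
  funext w
  ring

lemma coeff_zpow_mul (k : ℤ) (f : Circle → ℂ) (n : ℤ) :
    coeff (fun w => (w : ℂ) ^ k * f w) n = coeff f (n - k) := by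
  rw [coeff_eq_integral, coeff_eq_integral]
  congr 1
  funext w
  rw [← mul_assoc, ← zpow_add₀ w.coe_ne_zero, neg_sub, sub_eq_neg_add]

lemma coeff_add' {f g : Circle → ℂ} (hf : Continuous f) (hg : Continuous g) (n : ℤ) :
    coeff (fun w => f w + g w) n = coeff f n + coeff g n := coeff_add hf hg n

lemma coeff_sub' {f g : Circle → ℂ} (hf : Continuous f) (hg : Continuous g) (n : ℤ) :
    coeff (fun w => f w - g w) n = coeff f n - coeff g n := by
  have h := coeff_add' hf (g := fun w => -1 * g w) (continuous_const.mul hg) n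
  rw [coeff_const_mul] at h
  simpa [sub_eq_add_neg] using h

lemma coeff_zpow (k n : ℤ) : coeff (fun w => (w : ℂ) ^ k) n = if n = k then 1 else 0 := by
  have h : (fun x : UnitAddCircle => ((AddCircle.toCircle x : Circle) : ℂ) ^ k) = fourier k := by
    funext x
    rw [fourier_apply, AddCircle.toCircle_zsmul, Circle.coe_zpow]
  rw [coeff, h, fourierCoeff_fourier, Pi.single_apply]

lemma norm_coeff_le {f : Circle → ℂ} {A : ℝ} (h : ∀ w, ‖f w‖ ≤ A) (n : ℤ) :
    ‖coeff f n‖ ≤ A := by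
  rw [coeff_eq_integral]
  refine (norm_integral_le_of_norm_le_const (C := A) (.of_forall fun w => ?_)).trans (by simp)
  rw [norm_mul, norm_zpow_coe, one_mul]
  exact h w

/-- A continuous function on the circle is determined by its Fourier coefficients. -/
lemma eq_of_coeff_eq {f g : Circle → ℂ} (hf : Continuous f) (hg : Continuous g)
    (h : ∀ n, coeff f n = coeff g n) : f = g := by
  let F : C(UnitAddCircle, ℂ) := ⟨fun x => f (AddCircle.toCircle x) - g (AddCircle.toCircle x),
    (hf.comp AddCircle.continuous_toCircle).sub (hg.comp AddCircle.continuous_toCircle)⟩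
  have h0 : ∀ n, fourierCoeff F n = 0 := fun n => by
    have := coeff_sub' hf hg n
    rw [h n, sub_self] at this
    exact this
  have hs : Summable (fourierCoeff F) := by
    rw [show fourierCoeff F = fun _ => 0 from funext h0]; exact summable_zero
  have h1 := fun x => has_pointwise_sum_fourier_series_of_summable hs x
  simp only [h0, zero_smul] at h1
  funext w
  obtain ⟨x, rfl⟩ := (AddCircle.homeomorphCircle (T := 1) one_ne_zero).surjective w
  rw [AddCircle.homeomorphCircle_apply]
  exact sub_eq_zero.1 ((h1 x).unique hasSum_zero)

/-- Fourier coefficients of a superposition `w ↦ ∫ κ(s) Ψ(w, s) ds` with an integrable weight. -/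
lemma coeff_integral {κ : Circle → ℂ} (hκ : Integrable κ haar) {Ψ : Circle → Circle → ℂ}
    (hm : Measurable (Function.uncurry Ψ)) {B : ℝ} (hB : ∀ w s, ‖Ψ w s‖ ≤ B) (n : ℤ) :
    coeff (fun w => ∫ s, κ s * Ψ w s ∂haar) n = ∫ s, κ s * coeff (fun w => Ψ w s) n ∂haar := by
  simp_rw [coeff_eq_integral, ← integral_const_mul]
  rw [integral_integral_swap]
  · congr 1
    funext s
    congr 1
    funext w
    ring
  · have h1 : Integrable (fun p : Circle × Circle => κ p.2) (haar.prod haar) := hκ.comp_snd haar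
    have h2 := h1.bdd_mul (f := fun p : Circle × Circle => (p.1 : ℂ) ^ (-n) * Ψ p.1 p.2) (c := B)
      (((continuous_zpow_coe (-n)).measurable.comp measurable_fst).mul hm).aestronglyMeasurable
      (.of_forall fun p => by
        rw [norm_mul, norm_zpow_coe, one_mul]; exact hB _ _)
    convert h2 using 1
    funext p
    simp only [Function.uncurry]
    ring

/-! ### Quantitative Hölder bounds -/

/-- `HB γ u A`: the constant `A` bounds both `‖u‖_∞` and the `γ`-Hölder seminorm of `u`, for the
chordal distance. -/
structure HB (γ : ℝ) (u : Circle → ℂ) (A : ℝ) : Prop where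
  bound : ∀ w, ‖u w‖ ≤ A
  diff : ∀ w₁ w₂ : Circle, ‖u w₁ - u w₂‖ ≤ A * ‖(w₁ : ℂ) - w₂‖ ^ γ

lemma norm_sub_coe_le_two (w₁ w₂ : Circle) : ‖(w₁ : ℂ) - w₂‖ ≤ 2 := by
  refine (norm_sub_le _ _).trans ?_
  rw [Circle.norm_coe, Circle.norm_coe]
  norm_num

namespace HB

variable {γ : ℝ} {u v : Circle → ℂ} {A B : ℝ}

lemma nonneg (h : HB γ u A) : 0 ≤ A := (norm_nonneg _).trans (h.bound 1)

lemma mono (h : HB γ u A) (hAB : A ≤ B) : HB γ u B :=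
  ⟨fun w => (h.bound w).trans hAB, fun w₁ w₂ => (h.diff w₁ w₂).trans (by gcongr)⟩

lemma add (hu : HB γ u A) (hv : HB γ v B) : HB γ (fun w => u w + v w) (A + B) := by
  refine ⟨fun w => (norm_add_le _ _).trans (add_le_add (hu.bound w) (hv.bound w)),
    fun w₁ w₂ => ?_⟩
  rw [add_sub_add_comm, add_mul]
  exact (norm_add_le _ _).trans (add_le_add (hu.diff _ _) (hv.diff _ _))

lemma const_mul (c : ℂ) (hu : HB γ u A) : HB γ (fun w => c * u w) (‖c‖ * A) := by
  refine ⟨fun w => ?_, fun w₁ w₂ => ?_⟩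
  · rw [norm_mul]
    exact mul_le_mul_of_nonneg_left (hu.bound w) (norm_nonneg _)
  · rw [← mul_sub, norm_mul, mul_assoc]
    exact mul_le_mul_of_nonneg_left (hu.diff _ _) (norm_nonneg _)

lemma sub (hu : HB γ u A) (hv : HB γ v B) : HB γ (fun w => u w - v w) (A + B) := by
  simpa [sub_eq_add_neg] using hu.add (hv.const_mul (-1))

lemma mul (hu : HB γ u A) (hv : HB γ v B) : HB γ (fun w => u w * v w) (2 * A * B) := by
  have hA := hu.nonneg
  have hB := hv.nonneg
  have hAB := mul_nonneg hA hB
  refine ⟨fun w => ?_, fun w₁ w₂ => ?_⟩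
  · rw [norm_mul]
    have := mul_le_mul (hu.bound w) (hv.bound w) (norm_nonneg _) hA
    linarith
  · have e : u w₁ * v w₁ - u w₂ * v w₂ = (u w₁ - u w₂) * v w₁ + u w₂ * (v w₁ - v w₂) := by ring
    have h0 : 0 ≤ ‖(w₁ : ℂ) - w₂‖ ^ γ := by positivity
    rw [e]
    refine (norm_add_le _ _).trans ?_
    rw [norm_mul, norm_mul]
    have h1 := mul_le_mul (hu.diff w₁ w₂) (hv.bound w₁) (norm_nonneg _) (by positivity)
    have h2 := mul_le_mul (hu.bound w₂) (hv.diff w₁ w₂) (norm_nonneg _) hA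
    linarith

lemma star (hu : HB γ u A) : HB γ (fun w => (starRingEnd ℂ) (u w)) A := by
  refine ⟨fun w => ?_, fun w₁ w₂ => ?_⟩
  · rw [RCLike.norm_conj]; exact hu.bound w
  · rw [← map_sub, RCLike.norm_conj]; exact hu.diff _ _

lemma im (hu : HB γ u A) : HB γ (fun w => ((u w).im : ℂ)) A := by
  refine ⟨fun w => ?_, fun w₁ w₂ => ?_⟩
  · rw [Complex.norm_real]; exact (Complex.abs_im_le_norm _).trans (hu.bound w)
  · rw [← Complex.ofReal_sub, ← Complex.sub_im, Complex.norm_real]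
    exact (Complex.abs_im_le_norm _).trans (hu.diff _ _)

lemma const (γ : ℝ) (c : ℂ) : HB γ (fun _ => c) ‖c‖ :=
  ⟨fun _ => le_rfl, fun _ _ => by rw [sub_self, norm_zero]; positivity⟩

/-- Lipschitz functions are Hölder continuous, because the circle has diameter `2`. -/
lemma of_lipschitz (hγ0 : 0 < γ) (hγ : γ < 1) (hb : ∀ w, ‖u w‖ ≤ A)
    (hd : ∀ w₁ w₂ : Circle, ‖u w₁ - u w₂‖ ≤ A * ‖(w₁ : ℂ) - w₂‖) : HB γ u (2 * A) := by
  have hA : 0 ≤ A := (norm_nonneg _).trans (hb 1)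
  refine ⟨fun w => (hb w).trans (by linarith), fun w₁ w₂ => (hd w₁ w₂).trans ?_⟩
  have h2 := norm_sub_coe_le_two w₁ w₂
  rcases (norm_nonneg ((w₁ : ℂ) - w₂)).eq_or_lt with h | h
  · rw [← h, Real.zero_rpow hγ0.ne']; simp
  · have e : ‖(w₁ : ℂ) - w₂‖ = ‖(w₁ : ℂ) - w₂‖ ^ (1 - γ) * ‖(w₁ : ℂ) - w₂‖ ^ γ := by
      rw [← Real.rpow_add h]; simp
    have h3 : ‖(w₁ : ℂ) - w₂‖ ^ (1 - γ) ≤ 2 :=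
      calc _ ≤ (2 : ℝ) ^ (1 - γ) := by gcongr
        _ ≤ (2 : ℝ) ^ (1 : ℝ) := by gcongr <;> linarith
        _ = 2 := by simp
    have h4 : ‖(w₁ : ℂ) - w₂‖ ≤ 2 * ‖(w₁ : ℂ) - w₂‖ ^ γ := by
      conv_lhs => rw [e]
      gcongr
    nlinarith

lemma coe (hγ0 : 0 < γ) (hγ : γ < 1) : HB γ (fun w : Circle => (w : ℂ)) 2 := by
  have := of_lipschitz (A := 1) (u := fun w : Circle => (w : ℂ)) hγ0 hγ
    (fun w => by rw [Circle.norm_coe]) (fun w₁ w₂ => by rw [one_mul])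
  simpa using this

lemma holderWith (hγ : 0 ≤ γ) (hu : HB γ u A) : HolderWith A.toNNReal γ.toNNReal u := by
  intro w₁ w₂
  have h := hu.diff w₁ w₂
  rw [edist_dist, edist_dist, dist_eq_norm, Real.coe_toNNReal _ hγ]
  have e : dist w₁ w₂ = ‖(w₁ : ℂ) - w₂‖ := by
    rw [← dist_eq_norm]; rfl
  rw [e, ENNReal.ofReal_rpow_of_nonneg (norm_nonneg _) hγ]
  refine (ENNReal.ofReal_le_ofReal h).trans ?_
  rw [ENNReal.ofReal_mul hu.nonneg]
  rfl

lemma isHolder (hγ : 0 < γ) (hu : HB γ u A) : IsHolder γ.toNNReal u :=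
  ⟨(hu.holderWith hγ.le).continuous (by simpa using hγ), ⟨_, hu.holderWith hγ.le⟩⟩

lemma continuous (hγ : 0 < γ) (hu : HB γ u A) : Continuous u := (hu.isHolder hγ).1

lemma holderNorm_le (hγ : 0 ≤ γ) (hu : HB γ u A) : holderNorm γ.toNNReal u ≤ 2 * A := by
  have h1 : supNorm u ≤ A := ciSup_le hu.bound
  have h2 : (nnHolderNorm γ.toNNReal u : ℝ) ≤ A := by
    have := (hu.holderWith hγ).nnholderNorm_le
    calc (nnHolderNorm γ.toNNReal u : ℝ) ≤ (A.toNNReal : ℝ) := by exact_mod_cast this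
      _ = A := Real.coe_toNNReal _ hu.nonneg
  unfold holderNorm
  linarith

end HB

lemma norm_le_supNorm {f : Circle → ℂ} (hf : Continuous f) (w : Circle) : ‖f w‖ ≤ supNorm f :=
  le_ciSup (bdd hf) w

lemma IsHolder.hb {γ : ℝ} (hγ : 0 ≤ γ) {u : Circle → ℂ} (hu : IsHolder γ.toNNReal u) :
    HB γ u (holderNorm γ.toNNReal u) := by
  have h0 : 0 ≤ (nnHolderNorm γ.toNNReal u : ℝ) := NNReal.coe_nonneg _
  have h1 := supNorm_nonneg u
  refine ⟨fun w => (norm_le_supNorm hu.1 w).trans (by unfold holderNorm; linarith),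
    fun w₁ w₂ => ?_⟩
  have h := hu.2.holderWith.dist_le w₁ w₂
  rw [Real.coe_toNNReal _ hγ, dist_eq_norm] at h
  have e : dist w₁ w₂ = ‖(w₁ : ℂ) - w₂‖ := by
    rw [← dist_eq_norm]; rfl
  rw [e] at h
  refine h.trans ?_
  gcongr
  unfold holderNorm
  linarith

/-! ### Differentiation along the circle -/

lemma exists_arg_exp (η : ℝ) :
    ∃ m : ℤ, Complex.arg (Circle.exp η : ℂ) = η + m * (2 * Real.pi) :=
  Circle.exp_eq_exp.1 (Circle.exp_arg (Circle.exp η))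

lemma lift_add_int_mul (f : Circle → ℂ) (m : ℤ) (η : ℝ) :
    lift f (η + m * (2 * Real.pi)) = lift f η := by
  unfold lift
  congr 1
  exact Circle.exp_eq_exp.2 ⟨m, rfl⟩

lemma deriv_lift_arg (f : Circle → ℂ) (η : ℝ) :
    deriv (lift f) (Complex.arg (Circle.exp η : ℂ)) = deriv (lift f) η := by
  obtain ⟨m, hm⟩ := exists_arg_exp η
  rw [hm, ← deriv_comp_add_const]
  congr 1
  funext x
  exact lift_add_int_mul f m x

/-- `dw` is defined through the principal argument; by periodicity it can be computed in any
parameter `η`. -/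
lemma deriv_lift (f : Circle → ℂ) (η : ℝ) :
    deriv (lift f) η = Complex.I * (Circle.exp η : ℂ) * dw f (Circle.exp η) := by
  have h : (Circle.exp η : ℂ) * conj (Circle.exp η : ℂ) = 1 := by
    rw [← Circle.coe_inv_eq_conj, Circle.coe_inv, mul_inv_cancel₀ (Circle.coe_ne_zero _)]
  rw [dw, deriv_lift_arg]
  linear_combination (deriv (lift f) η) * (-1 : ℂ) * h +
    (Circle.exp η : ℂ) * conj (Circle.exp η : ℂ) * (deriv (lift f) η) * Complex.I_mul_I

lemma IsHolderOne.hasDerivAt {γ : ℝ≥0} {f : Circle → ℂ} (hf : IsHolderOne γ f) (η : ℝ) :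
    HasDerivAt (lift f) (Complex.I * (Circle.exp η : ℂ) * dw f (Circle.exp η)) η := by
  rw [← deriv_lift]
  exact (hf.1.differentiable one_ne_zero η).hasDerivAt

lemma dw_eq_of_hasDerivAt {f p : Circle → ℂ}
    (h : ∀ η, HasDerivAt (lift f) (Complex.I * (Circle.exp η : ℂ) * p (Circle.exp η)) η) :
    dw f = p := by
  funext w
  obtain ⟨η, rfl⟩ := Circle.exp_surjective w
  have h1 := (deriv_lift f η).symm.trans (h η).deriv
  exact mul_left_cancel₀ (mul_ne_zero Complex.I_ne_zero (Circle.coe_ne_zero _)) h1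

lemma isHolderOne_of_hasDerivAt {γ : ℝ≥0} {f p : Circle → ℂ} (hp : IsHolder γ p)
    (h : ∀ η, HasDerivAt (lift f) (Complex.I * (Circle.exp η : ℂ) * p (Circle.exp η)) η) :
    IsHolderOne γ f := by
  refine ⟨contDiff_one_iff_deriv.2 ⟨fun η => (h η).differentiableAt, ?_⟩, ?_⟩
  · rw [funext fun η => (h η).deriv]
    have := hp.1
    have h2 := continuous_coe
    fun_prop
  · rwa [dw_eq_of_hasDerivAt h]

lemma hasDerivAt_exp (η : ℝ) :
    HasDerivAt (fun η : ℝ => (Circle.exp η : ℂ)) (Complex.I * (Circle.exp η : ℂ)) η := by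
  have h := (((hasDerivAt_id η).ofReal_comp).mul_const Complex.I).cexp
  refine h.congr_deriv ?_
  simp [Circle.coe_exp, mul_comm]

lemma dw_coe_add {γ : ℝ≥0} {f : Circle → ℂ} (hf : IsHolderOne γ f) :
    dw (fun z => (z : ℂ) + f z) = fun w => 1 + dw f w := by
  refine dw_eq_of_hasDerivAt fun η => ?_
  have h := (hasDerivAt_exp η).add (hf.hasDerivAt η)
  refine h.congr_deriv ?_
  ring

lemma hasDerivAt_exp_zpow (n : ℤ) (η : ℝ) :
    HasDerivAt (fun η : ℝ => (Circle.exp η : ℂ) ^ n)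
      (Complex.I * n * (Circle.exp η : ℂ) ^ n) η := by
  have h := (hasDerivAt_zpow n (Circle.exp η : ℂ) (.inl (Circle.coe_ne_zero _))).comp η
    (hasDerivAt_exp η)
  refine h.congr_deriv ?_
  rw [zpow_sub_one₀ (Circle.coe_ne_zero _)]
  have := Circle.coe_ne_zero (Circle.exp η)
  field_simp

/-- Chord versus arc. -/
lemma norm_exp_sub_one (t : ℝ) : ‖(Circle.exp t : ℂ) - 1‖ = 2 * |Real.sin (t / 2)| := by
  have h := Complex.norm_exp_I_mul_ofReal_sub_one t
  rw [Circle.coe_exp, mul_comm, h, norm_mul]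
  simp

lemma abs_le_norm_exp_sub_one {t : ℝ} (ht : |t| ≤ Real.pi) :
    2 / Real.pi * |t| ≤ ‖(Circle.exp t : ℂ) - 1‖ := by
  have h := Real.mul_abs_le_abs_sin (x := t / 2) (by rw [abs_div, abs_two]; linarith)
  rw [norm_exp_sub_one]
  rw [abs_div, abs_two] at h
  linarith

/-- Mean value inequality; the factor `π / 2` compares arc length with the chordal distance. -/
lemma norm_sub_le_of_dw_le {γ : ℝ≥0} {f : Circle → ℂ} (hf : IsHolderOne γ f) {N : ℝ}
    (hN : ∀ w, ‖dw f w‖ ≤ N) (w₁ w₂ : Circle) :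
    ‖f w₁ - f w₂‖ ≤ Real.pi / 2 * N * ‖(w₁ : ℂ) - w₂‖ := by
  obtain ⟨η, rfl⟩ := Circle.exp_surjective w₂
  set t := Complex.arg ((w₁ / Circle.exp η : Circle) : ℂ) with ht
  have htpi : |t| ≤ Real.pi := Complex.abs_arg_le_pi _
  have h1 : w₁ = Circle.exp (η + t) := by
    rw [Circle.exp_add, ht, Circle.exp_arg]
    exact (mul_div_cancel _ _).symm
  have h2 : ‖lift f (η + t) - lift f η‖ ≤ N * ‖(η + t) - η‖ :=
    Convex.norm_image_sub_le_of_norm_hasDerivWithin_le (s := Set.univ)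
      (fun x _ => (hf.hasDerivAt x).hasDerivWithinAt)
      (fun x _ => by
        rw [norm_mul, norm_mul, Complex.norm_I, Circle.norm_coe, one_mul, one_mul]
        exact hN _) convex_univ (Set.mem_univ _) (Set.mem_univ _)
  have h3 : ‖(w₁ : ℂ) - (Circle.exp η : ℂ)‖ = ‖(Circle.exp t : ℂ) - 1‖ := by
    rw [h1, Circle.exp_add, Circle.coe_mul, ← mul_sub_one, norm_mul, Circle.norm_coe, one_mul]
  have h4 := abs_le_norm_exp_sub_one htpi
  have hN0 : 0 ≤ N := (norm_nonneg _).trans (hN 1)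
  have h5 : |t| ≤ Real.pi / 2 * ‖(Circle.exp t : ℂ) - 1‖ := by
    have := mul_le_mul_of_nonneg_left h4 (show 0 ≤ Real.pi / 2 by positivity)
    calc |t| = Real.pi / 2 * (2 / Real.pi * |t|) := by field_simp
      _ ≤ _ := this
  rw [h3, h1]
  simp only [lift, add_sub_cancel_left, Real.norm_eq_abs] at h2
  calc _ ≤ N * |t| := h2
    _ ≤ N * (Real.pi / 2 * ‖(Circle.exp t : ℂ) - 1‖) := by gcongr
    _ = _ := by ring

lemma coeff_dw {γ : ℝ≥0} {f : Circle → ℂ} (hf : IsHolderOne γ f) (k : ℤ) :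
    coeff (dw f) k = (k + 1) * coeff f (k + 1) := by
  have hd : ∀ η : ℝ, HasDerivAt (fun η => (Circle.exp η : ℂ) ^ (-(k + 1)) * lift f η)
      (Complex.I * ((Circle.exp η : ℂ) ^ (-k) * dw f (Circle.exp η) -
        (k + 1) * ((Circle.exp η : ℂ) ^ (-(k + 1)) * f (Circle.exp η)))) η := fun η => by
    refine ((hasDerivAt_exp_zpow (-(k + 1)) η).mul (hf.hasDerivAt η)).congr_deriv ?_
    have e : (Circle.exp η : ℂ) ^ (-k) = (Circle.exp η : ℂ) ^ (-(k + 1)) * (Circle.exp η : ℂ) := by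
      rw [← zpow_add_one₀ (Circle.coe_ne_zero _)]; congr 1; ring
    rw [e]
    simp only [lift]
    push_cast
    ring
  have hc1 : Continuous fun w : Circle => (w : ℂ) ^ (-k) * dw f w :=
    (continuous_zpow_coe _).mul hf.2.1
  have hc2 : Continuous fun w : Circle => (w : ℂ) ^ (-(k + 1)) * f w :=
    (continuous_zpow_coe _).mul hf.continuous
  have hc : Continuous fun w : Circle => Complex.I * ((w : ℂ) ^ (-k) * dw f w -
        (k + 1) * ((w : ℂ) ^ (-(k + 1)) * f w)) := by fun_prop
  have h := intervalIntegral.integral_eq_sub_of_hasDerivAt (a := 0) (b := 0 + 2 * Real.pi)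
    (fun η _ => hd η) ((hc.comp Circle.exp.continuous).intervalIntegrable _ _)
  have h2 := integral_haar_eq_intervalIntegral (fun w : Circle => Complex.I *
    ((w : ℂ) ^ (-k) * dw f w - (k + 1) * ((w : ℂ) ^ (-(k + 1)) * f w))) 0
  rw [h] at h2
  simp only [lift, zero_add, Circle.exp_two_pi, Circle.exp_zero, sub_self, mul_zero] at h2
  rw [integral_const_mul, integral_sub (integrable_of_continuous hc1)
    ((integrable_of_continuous hc2).const_mul _), integral_const_mul, ← coeff_eq_integral,
    ← coeff_eq_integral] at h2
  exact sub_eq_zero.1 ((mul_eq_zero.1 h2).resolve_left Complex.I_ne_zero)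

/-- A function whose `(-1)`-st Fourier coefficient vanishes has a primitive along the circle. -/
lemma exists_primitive {γ : ℝ≥0} {p : Circle → ℂ} (hp : IsHolder γ p) (h0 : coeff p (-1) = 0)
    (c : ℂ) : ∃ H : Circle → ℂ, IsHolderOne γ H ∧ dw H = p ∧ coeff H 0 = c := by
  set q : ℝ → ℂ := fun θ => Complex.I * (Circle.exp θ : ℂ) * p (Circle.exp θ) with hq
  have hqc : Continuous q := by
    have := hp.1
    have h2 := continuous_coe
    fun_prop
  have hper : Function.Periodic (fun η => ∫ θ in (0 : ℝ)..η, q θ) (2 * Real.pi) := by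
    intro η
    have h1 := intervalIntegral.integral_add_adjacent_intervals
      (hqc.intervalIntegrable (μ := volume) 0 η) (hqc.intervalIntegrable η (η + 2 * Real.pi))
    have h2 := integral_haar_eq_intervalIntegral (fun w => Complex.I * (w : ℂ) * p w) η
    have h3 : ∫ w : Circle, Complex.I * (w : ℂ) * p w ∂haar = 0 := by
      simp_rw [mul_assoc]
      rw [integral_const_mul]
      rw [coeff_eq_integral] at h0
      simp only [neg_neg, zpow_one] at h0
      rw [h0, mul_zero]
    rw [h3] at h2
    have h4 : ∫ θ in η..η + 2 * Real.pi, q θ = 0 :=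
      (mul_eq_zero.1 h2.symm).resolve_left (by simp [Real.pi_ne_zero])
    simp only
    rw [← h1, h4, add_zero]
  set H₀ : Circle → ℂ := fun w => ∫ θ in (0 : ℝ)..Complex.arg (w : ℂ), q θ
  have hH₀ : lift H₀ = fun η => ∫ θ in (0 : ℝ)..η, q θ := by
    funext η
    obtain ⟨m, hm⟩ := exists_arg_exp η
    change ∫ θ in (0 : ℝ)..Complex.arg (Circle.exp η : ℂ), q θ = _
    rw [hm]
    exact hper.int_mul m η
  have hd₀ : ∀ η, HasDerivAt (lift H₀) (q η) η := fun η => by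
    rw [hH₀]
    exact intervalIntegral.integral_hasDerivAt_right (hqc.intervalIntegrable _ _)
      (hqc.stronglyMeasurableAtFilter _ _) hqc.continuousAt
  have hd : ∀ η, HasDerivAt (lift fun w => H₀ w + (c - coeff H₀ 0)) (q η) η := fun η =>
    (hd₀ η).add_const _
  refine ⟨fun w => H₀ w + (c - coeff H₀ 0), isHolderOne_of_hasDerivAt hp hd,
    dw_eq_of_hasDerivAt hd, ?_⟩
  have h1 := coeff_const_mul (c - coeff H₀ 0) (fun w => (w : ℂ) ^ (0 : ℤ)) 0
  rw [coeff_zpow, if_pos rfl, mul_one] at h1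
  simp only [zpow_zero, mul_one] at h1
  rw [coeff_add' (isHolderOne_of_hasDerivAt hp hd₀).continuous continuous_const, h1]
  ring

/-- Real Fourier coefficients mean reflection symmetry. -/
lemma apply_inv_of_coeff_real {f : Circle → ℂ} (hf : Continuous f)
    (h : ∀ n, (coeff f n).im = 0) (w : Circle) : f w⁻¹ = conj (f w) := by
  have e : (fun w => f w⁻¹) = fun w => conj (f w) := by
    refine eq_of_coeff_eq (hf.comp continuous_inv) (Complex.continuous_conj.comp hf) fun n => ?_
    rw [coeff_comp_inv, coeff_conj, Complex.conj_eq_iff_im.2 (h _)]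
  exact congrFun e w

/-- The reflection symmetry `E(w̄) = conj (E(w))` makes `Im E` odd, which is the algebraic part of
membership in `Y`. -/
lemma isY_im {α : ℝ} (hα : α < 1) {E : Circle → ℂ} {A : ℝ} (hE : HB (1 - α) E A)
    (hs : ∀ w, E w⁻¹ = conj (E w)) : IsY α (fun w => ((E w).im : ℂ)) := by
  have h1 : ∀ n, coeff (fun w => ((E w).im : ℂ)) (-n) = -coeff (fun w => ((E w).im : ℂ)) n := by
    intro n
    rw [← coeff_comp_inv]
    have := coeff_const_mul (-1) (fun w => ((E w).im : ℂ)) n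
    rw [neg_one_mul] at this
    rw [← this]
    congr 1
    funext w
    rw [hs, Complex.conj_im]
    push_cast
    ring
  refine ⟨hE.im.isHolder (by linarith), fun n => ?_, h1⟩
  have h2 := coeff_conj (fun w => ((E w).im : ℂ)) n
  simp only [Complex.conj_ofReal] at h2
  rw [h1, map_neg] at h2
  have := congrArg Complex.re h2
  rw [Complex.neg_re, Complex.conj_re] at this
  linarith

/-! ### Weakly singular integrals -/

/-- The Haar probability measure is the normalised arc length. -/
lemma haar_eq_map_exp (a : ℝ) : haar = ENNReal.ofReal (2 * Real.pi)⁻¹ •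
    Measure.map Circle.exp (volume.restrict (Set.Ioc a (a + 2 * Real.pi))) := by
  have hpi := Real.two_pi_pos
  have h1 := (AddCircle.measurePreserving_mk 1 (a / (2 * Real.pi))).map_eq
  rw [AddCircle.volume_eq_smul_haarAddCircle, ENNReal.ofReal_one, one_smul] at h1
  have h2 : Measure.map (fun x => 2 * Real.pi * x)
      (volume.restrict (Set.Ioc (a / (2 * Real.pi)) (a / (2 * Real.pi) + 1))) =
      ENNReal.ofReal (2 * Real.pi)⁻¹ • volume.restrict (Set.Ioc a (a + 2 * Real.pi)) := by
    have h3 : Set.Ioc (a / (2 * Real.pi)) (a / (2 * Real.pi) + 1) =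
        (fun x => 2 * Real.pi * x) ⁻¹' Set.Ioc a (a + 2 * Real.pi) := by
      ext x
      simp only [Set.mem_Ioc, Set.mem_preimage]
      rw [div_lt_iff₀ hpi, ← sub_le_iff_le_add, ← mul_le_mul_iff_right₀ hpi (b := x - 1)]
      have e : 2 * Real.pi * (a / (2 * Real.pi)) = a := by field_simp
      rw [e, mul_sub, mul_comm x]
      constructor <;> rintro ⟨h, h'⟩ <;> exact ⟨h, by linarith⟩
    rw [h3, ← Measure.restrict_map (measurable_const_mul _) measurableSet_Ioc,
      Real.map_volume_mul_left hpi.ne', Measure.restrict_smul, abs_of_pos (inv_pos.2 hpi)]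
  rw [haar, ← h1, Measure.map_map measurableEmbedding_toCircle.measurable
    (AddCircle.measurable_mk' (a := (1 : ℝ))), ← Measure.map_smul, ← h2,
    Measure.map_map Circle.exp.continuous.measurable (measurable_const_mul _)]
  congr 1
  funext x
  simp [AddCircle.toCircle_apply_mk]

lemma integrable_haar_of_integrableOn {E : Type*} [NormedAddCommGroup E] {u : Circle → E}
    (hu : AEStronglyMeasurable u haar) (a : ℝ)
    (h : IntegrableOn (fun θ => u (Circle.exp θ)) (Set.Ioc a (a + 2 * Real.pi))) :
    Integrable u haar := by
  have hc : ENNReal.ofReal (2 * Real.pi)⁻¹ ≠ 0 := by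
    simp [Real.pi_pos]
  rw [haar_eq_map_exp a] at hu ⊢
  refine Integrable.smul_measure ?_ ENNReal.ofReal_ne_top
  refine (integrable_map_measure ?_ Circle.exp.continuous.measurable.aemeasurable).2 h
  exact hu.mono_ac (Measure.absolutelyContinuous_smul hc)

lemma integral_haar_real (u : Circle → ℝ) (hu : AEStronglyMeasurable u haar) (a : ℝ) :
    ∫ w, u w ∂haar =
      (2 * Real.pi)⁻¹ * ∫ θ in Set.Ioc a (a + 2 * Real.pi), u (Circle.exp θ) := by
  have hc : ENNReal.ofReal (2 * Real.pi)⁻¹ ≠ 0 := by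
    simp [Real.pi_pos]
  rw [haar_eq_map_exp a] at hu ⊢
  rw [integral_smul_measure, integral_map Circle.exp.continuous.measurable.aemeasurable
    (hu.mono_ac (Measure.absolutelyContinuous_smul hc)),
    ENNReal.toReal_ofReal (by positivity), smul_eq_mul]

/-- The kernel `r ↦ r^{-α} min(1, d / r)`, which dominates the increments over the distance `d`
of a kernel with the singularity `r^{-α}`. -/
def kern (α d r : ℝ) : ℝ := r ^ (-α) * min 1 (d / r)

section kern

variable {α : ℝ}

lemma measurable_kern (d : ℝ) : Measurable (kern α d) := by
  unfold kern
  exact (measurable_id.pow_const _).mul (measurable_const.min (measurable_const.div measurable_id))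

lemma kern_nonneg {d r : ℝ} (hd : 0 ≤ d) (hr : 0 ≤ r) : 0 ≤ kern α d r := by
  unfold kern
  positivity

lemma kern_le {d r : ℝ} (hr : 0 ≤ r) : kern α d r ≤ r ^ (-α) := by
  unfold kern
  exact mul_le_of_le_one_right (by positivity) (min_le_left _ _)

lemma kern_anti (hα : 0 < α) {d r s : ℝ} (hd : 0 ≤ d) (hr : 0 < r) (hrs : r ≤ s) :
    kern α d s ≤ kern α d r := by
  unfold kern
  have h1 := Real.rpow_le_rpow_of_nonpos hr hrs (show -α ≤ 0 by linarith)
  have h0 : 0 ≤ s := hr.le.trans hrs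
  gcongr

lemma integrableOn_kern_one (hα0 : 0 < α) (hα1 : α < 1) :
    IntegrableOn (kern α 1) (Set.Ioi 0) := by
  rw [← Set.Ioc_union_Ioi_eq_Ioi zero_le_one]
  refine IntegrableOn.union ?_ ?_
  · have h := (intervalIntegrable_iff_integrableOn_Ioc_of_le zero_le_one).1
      (intervalIntegral.intervalIntegrable_rpow' (a := 0) (b := 1) (show -1 < -α by linarith))
    refine Integrable.mono' h (measurable_kern 1).aestronglyMeasurable ?_
    refine (ae_restrict_iff' measurableSet_Ioc).2 (.of_forall fun r hr => ?_)
    rw [Real.norm_of_nonneg (kern_nonneg zero_le_one hr.1.le)]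
    exact kern_le hr.1.le
  · have h := integrableOn_Ioi_rpow_of_lt (show -α - 1 < -1 by linarith) zero_lt_one
    refine Integrable.mono' h (measurable_kern 1).aestronglyMeasurable ?_
    refine (ae_restrict_iff' measurableSet_Ioi).2 (.of_forall fun r hr => ?_)
    have hr0 : (0 : ℝ) < r := zero_lt_one.trans hr
    rw [Real.norm_of_nonneg (kern_nonneg zero_le_one hr0.le), Real.rpow_sub_one hr0.ne',
      div_eq_mul_one_div]
    unfold kern
    gcongr
    exact min_le_right _ _

/-- The constant in the bound `∫ kern α d |w - τ| dτ ≤ C d^{1-α}`. -/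
def kernConst (α : ℝ) : ℝ := (∫ r in Set.Ioi 0, kern α 1 r) / 2

lemma kernConst_nonneg (α : ℝ) : 0 ≤ kernConst α :=
  div_nonneg (setIntegral_nonneg measurableSet_Ioi fun _ hr =>
    kern_nonneg zero_le_one (le_of_lt hr)) zero_le_two

lemma kern_mul {d t : ℝ} (hd : 0 < d) (ht : 0 ≤ t) : kern α d (d * t) = d ^ (-α) * kern α 1 t := by
  unfold kern
  rw [Real.mul_rpow hd.le ht, mul_assoc, div_mul_cancel_left₀ hd.ne', one_div]

/-- The scaling `r = d t` gives the power `d^{1-α}`, which becomes the Hölder exponent. -/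
lemma integrableOn_kern (hα0 : 0 < α) (hα1 : α < 1) {d : ℝ} (hd : 0 < d) :
    IntegrableOn (kern α d) (Set.Ioi 0) ∧
      ∫ r in Set.Ioi 0, kern α d r = d ^ (1 - α) * ∫ r in Set.Ioi 0, kern α 1 r := by
  have h1 : Set.EqOn (fun t => kern α d (d * t)) (fun t => d ^ (-α) * kern α 1 t) (Set.Ioi 0) :=
    fun t ht => kern_mul hd (le_of_lt ht)
  have h2 : IntegrableOn (fun t => kern α d (d * t)) (Set.Ioi 0) :=
    IntegrableOn.congr_fun ((integrableOn_kern_one hα0 hα1).const_mul _) h1.symm measurableSet_Ioi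
  have h3 := integrableOn_Ioi_comp_mul_left_iff (kern α d) 0 hd
  rw [mul_zero] at h3
  refine ⟨h3.1 h2, ?_⟩
  have h4 := integral_comp_mul_left_Ioi (kern α d) 0 hd
  rw [mul_zero, setIntegral_congr_fun measurableSet_Ioi h1, integral_const_mul, smul_eq_mul,
    eq_comm, inv_mul_eq_iff_eq_mul₀ hd.ne', ← mul_assoc] at h4
  rw [h4, sub_eq_add_neg, Real.rpow_add hd, Real.rpow_one]

lemma measurable_norm_coe_sub_one : Measurable fun s : Circle => ‖(s : ℂ) - 1‖ := by
  have := continuous_coe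
  exact Continuous.measurable (by fun_prop)

/-- Dominated comparison with an integrable decreasing profile on the half-line. -/
lemma integral_haar_profile_le {k : ℝ → ℝ} (hk : Measurable k) (hk0 : ∀ r, 0 ≤ r → 0 ≤ k r)
    (hanti : ∀ r s, 0 < r → r ≤ s → k s ≤ k r) (hint : IntegrableOn k (Set.Ioi 0)) :
    Integrable (fun s : Circle => k ‖(s : ℂ) - 1‖) haar ∧
      ∫ s : Circle, k ‖(s : ℂ) - 1‖ ∂haar ≤ (∫ r in Set.Ioi 0, k r) / 2 := by
  have hpi := Real.pi_pos
  have hc : 0 < 2 / Real.pi := by positivity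
  have hm : Measurable fun s : Circle => k ‖(s : ℂ) - 1‖ := hk.comp measurable_norm_coe_sub_one
  have h1 := (integrableOn_Ioi_comp_mul_left_iff k 0 hc).2 (by rwa [mul_zero])
  have h2 : Integrable fun x : ℝ => k (2 / Real.pi * |x|) := by
    have h1' : IntegrableOn (fun x : ℝ => k (2 / Real.pi * |x|)) (Set.Ioi 0) :=
      IntegrableOn.congr_fun h1 (fun x hx => by simp only [abs_of_pos (Set.mem_Ioi.1 hx)])
        measurableSet_Ioi
    have h1'' : IntegrableOn (fun x : ℝ => k (2 / Real.pi * |x|)) (Set.Iic 0) := by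
      rw [integrableOn_Iic_iff_integrableOn_Iio]
      have := (Measure.measurePreserving_neg (volume : Measure ℝ)).integrableOn_comp_preimage
        (Homeomorph.neg ℝ).measurableEmbedding (s := Set.Ioi 0)
        (f := fun x : ℝ => k (2 / Real.pi * |x|))
      simpa [Function.comp_def] using this.2 h1'
    rw [← integrableOn_univ, ← Set.Iic_union_Ioi (a := (0 : ℝ))]
    exact h1''.union h1'
  have h3 : ∫ x : ℝ, k (2 / Real.pi * |x|) = Real.pi * ∫ r in Set.Ioi 0, k r := by
    rw [integral_comp_abs (f := fun x => k (2 / Real.pi * x)), integral_comp_mul_left_Ioi _ _ hc,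
      mul_zero, smul_eq_mul]
    field_simp
  have h4 : ∀ θ ∈ Set.Ioc (-Real.pi) (-Real.pi + 2 * Real.pi), θ ≠ 0 →
      k ‖(Circle.exp θ : ℂ) - 1‖ ≤ k (2 / Real.pi * |θ|) := fun θ hθ h0 => by
    refine hanti _ _ (by positivity) (abs_le_norm_exp_sub_one ?_)
    exact abs_le.2 ⟨hθ.1.le, by linarith [hθ.2]⟩
  have h5 : ∀ᵐ θ ∂(volume.restrict (Set.Ioc (-Real.pi) (-Real.pi + 2 * Real.pi))),
      k ‖(Circle.exp θ : ℂ) - 1‖ ≤ k (2 / Real.pi * |θ|) := by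
    refine (ae_restrict_iff' measurableSet_Ioc).2 ?_
    filter_upwards [Measure.ae_ne volume (0 : ℝ)] with θ h0 hθ using h4 θ hθ h0
  have h6 : IntegrableOn (fun θ => k ‖(Circle.exp θ : ℂ) - 1‖)
      (Set.Ioc (-Real.pi) (-Real.pi + 2 * Real.pi)) := by
    refine Integrable.mono' h2.integrableOn
      (hm.comp Circle.exp.continuous.measurable).aestronglyMeasurable ?_
    filter_upwards [h5] with θ hθ
    rwa [Real.norm_of_nonneg (hk0 _ (norm_nonneg _))]
  refine ⟨integrable_haar_of_integrableOn hm.aestronglyMeasurable _ h6, ?_⟩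
  rw [integral_haar_real _ hm.aestronglyMeasurable (-Real.pi)]
  have h7 := integral_mono_ae h6 h2.integrableOn h5
  have h8 := setIntegral_le_integral (s := Set.Ioc (-Real.pi) (-Real.pi + 2 * Real.pi)) h2
    (.of_forall fun x => hk0 _ (by positivity))
  rw [h3] at h8
  calc _ ≤ (2 * Real.pi)⁻¹ * (Real.pi * ∫ r in Set.Ioi 0, k r) := by
        gcongr; exact h7.trans h8
    _ = _ := by field_simp

lemma integrable_kern (hα0 : 0 < α) (hα1 : α < 1) {d : ℝ} (hd : 0 < d) :
    Integrable (fun s : Circle => kern α d ‖(s : ℂ) - 1‖) haar :=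
  (integral_haar_profile_le (measurable_kern d) (fun _ h => kern_nonneg hd.le h)
    (fun _ _ h h' => kern_anti hα0 hd.le h h') (integrableOn_kern hα0 hα1 hd).1).1

lemma integral_kern_le (hα0 : 0 < α) (hα1 : α < 1) {d : ℝ} (hd : 0 < d) :
    ∫ s : Circle, kern α d ‖(s : ℂ) - 1‖ ∂haar ≤ kernConst α * d ^ (1 - α) := by
  have h := (integral_haar_profile_le (measurable_kern d) (fun _ h => kern_nonneg hd.le h)
    (fun _ _ h h' => kern_anti hα0 hd.le h h') (integrableOn_kern hα0 hα1 hd).1).2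
  rw [(integrableOn_kern hα0 hα1 hd).2] at h
  refine h.trans (le_of_eq ?_)
  unfold kernConst
  ring

lemma integrable_rpow (hα0 : 0 < α) (hα1 : α < 1) :
    Integrable (fun s : Circle => ‖(s : ℂ) - 1‖ ^ (-α)) haar := by
  have h := integrable_kern hα0 hα1 (d := 2) two_pos
  refine h.congr (.of_forall fun s => ?_)
  have h2 := norm_sub_coe_le_two s 1
  rw [Circle.coe_one] at h2
  simp only [kern]
  rcases (norm_nonneg ((s : ℂ) - 1)).eq_or_lt with h | h
  · rw [← h, Real.zero_rpow (by linarith), zero_mul]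
  · rw [min_eq_left ((one_le_div h).2 h2), mul_one]

end kern

lemma norm_coe_sub_coe (w τ : Circle) : ‖(w : ℂ) - τ‖ = ‖((w⁻¹ * τ : Circle) : ℂ) - 1‖ := by
  have e : (w : ℂ) - τ = -(w * (((w⁻¹ * τ : Circle) : ℂ) - 1)) := by
    rw [Circle.coe_mul, Circle.coe_inv, mul_sub, mul_inv_cancel_left₀ w.coe_ne_zero]; ring
  rw [e, norm_neg, norm_mul, Circle.norm_coe, one_mul]

lemma integrable_comp_dist {E : Type*} [NormedAddCommGroup E] {k : ℝ → E}
    (h : Integrable (fun s : Circle => k ‖(s : ℂ) - 1‖) haar) (w : Circle) :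
    Integrable (fun τ : Circle => k ‖(w : ℂ) - τ‖) haar := by
  simp_rw [norm_coe_sub_coe]
  exact h.comp_mul_left w⁻¹

lemma integral_comp_dist (k : ℝ → ℝ) (w : Circle) :
    ∫ τ : Circle, k ‖(w : ℂ) - τ‖ ∂haar = ∫ s : Circle, k ‖(s : ℂ) - 1‖ ∂haar := by
  simp_rw [norm_coe_sub_coe]
  exact integral_mul_left_eq_self (fun s : Circle => k ‖(s : ℂ) - 1‖) w⁻¹

/-- The total mass `∫ |s - 1|^{-α} ds`. -/
def riesz (α : ℝ) : ℝ := ∫ s : Circle, ‖(s : ℂ) - 1‖ ^ (-α) ∂haar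

lemma riesz_nonneg (α : ℝ) : 0 ≤ riesz α := integral_nonneg fun _ => by positivity

/-- The constant of the Hölder bound for weakly singular integrals. -/
def singConst (α : ℝ) : ℝ := riesz α + 2 * kernConst α

lemma singConst_nonneg (α : ℝ) : 0 ≤ singConst α := by
  have := riesz_nonneg α
  have := kernConst_nonneg α
  unfold singConst
  positivity

/-- A symbol of size `A`: a bounded function `n(w, τ)` whose increments in `w` are controlled by
`|w₁ - w₂| / |w₁ - τ|`, like those of difference quotients. -/
structure IsSymbol (n : Circle → Circle → ℂ) (A : ℝ) : Prop where
  meas : Measurable (Function.uncurry n)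
  bound : ∀ w τ, ‖n w τ‖ ≤ A
  diff : ∀ w₁ w₂ τ : Circle,
    ‖n w₁ τ - n w₂ τ‖ * ‖(w₁ : ℂ) - τ‖ ≤ 2 * A * ‖(w₁ : ℂ) - w₂‖

namespace IsSymbol

variable {n m : Circle → Circle → ℂ} {A B : ℝ}

lemma nonneg (h : IsSymbol n A) : 0 ≤ A := (norm_nonneg _).trans (h.bound 1 1)

lemma mono (h : IsSymbol n A) (hAB : A ≤ B) : IsSymbol n B :=
  ⟨h.meas, fun w τ => (h.bound w τ).trans hAB, fun w₁ w₂ τ => (h.diff w₁ w₂ τ).trans (by gcongr)⟩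

lemma add (hn : IsSymbol n A) (hm : IsSymbol m B) :
    IsSymbol (fun w τ => n w τ + m w τ) (A + B) := by
  refine ⟨hn.meas.add hm.meas,
    fun w τ => (norm_add_le _ _).trans (add_le_add (hn.bound w τ) (hm.bound w τ)),
    fun w₁ w₂ τ => ?_⟩
  rw [add_sub_add_comm]
  have h1 := hn.diff w₁ w₂ τ
  have h2 := hm.diff w₁ w₂ τ
  have h3 := mul_le_mul_of_nonneg_right (norm_add_le (n w₁ τ - n w₂ τ) (m w₁ τ - m w₂ τ))
    (norm_nonneg ((w₁ : ℂ) - τ))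
  linarith

lemma mul (hn : IsSymbol n A) (hm : IsSymbol m B) :
    IsSymbol (fun w τ => n w τ * m w τ) (2 * A * B) := by
  have hA := hn.nonneg
  have hB := hm.nonneg
  have hAB := mul_nonneg hA hB
  refine ⟨hn.meas.mul hm.meas, fun w τ => ?_, fun w₁ w₂ τ => ?_⟩
  · rw [norm_mul]
    have := mul_le_mul (hn.bound w τ) (hm.bound w τ) (norm_nonneg _) hA
    linarith
  · have e : n w₁ τ * m w₁ τ - n w₂ τ * m w₂ τ =
      (n w₁ τ - n w₂ τ) * m w₁ τ + n w₂ τ * (m w₁ τ - m w₂ τ) := by ring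
    have h3 := mul_le_mul_of_nonneg_right (norm_add_le ((n w₁ τ - n w₂ τ) * m w₁ τ)
      (n w₂ τ * (m w₁ τ - m w₂ τ))) (norm_nonneg ((w₁ : ℂ) - τ))
    rw [e]
    refine h3.trans ?_
    rw [norm_mul, norm_mul, add_mul, mul_right_comm, mul_assoc ‖n w₂ τ‖]
    have h1 := mul_le_mul (hn.diff w₁ w₂ τ) (hm.bound w₁ τ) (norm_nonneg _) (by positivity)
    have h2 := mul_le_mul (hn.bound w₂ τ) (hm.diff w₁ w₂ τ) (by positivity) hA
    linarith

lemma of_right {g : Circle → ℂ} (hg : Measurable g) (hA : ∀ τ, ‖g τ‖ ≤ A) :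
    IsSymbol (fun _ τ => g τ) A := by
  have : 0 ≤ A := (norm_nonneg _).trans (hA 1)
  refine ⟨hg.comp measurable_snd, fun _ τ => hA τ, fun w₁ w₂ τ => ?_⟩
  rw [sub_self, norm_zero, zero_mul]
  positivity

lemma const (c : ℂ) : IsSymbol (fun _ _ => c) ‖c‖ := of_right measurable_const fun _ => le_rfl

lemma const_mul (c : ℂ) (hn : IsSymbol n A) : IsSymbol (fun w τ => c * n w τ) (‖c‖ * A) := by
  refine ⟨hn.meas.const_mul c, fun w τ => ?_, fun w₁ w₂ τ => ?_⟩
  · rw [norm_mul]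
    exact mul_le_mul_of_nonneg_left (hn.bound w τ) (norm_nonneg _)
  · rw [← mul_sub, norm_mul]
    have := mul_le_mul_of_nonneg_left (hn.diff w₁ w₂ τ) (norm_nonneg c)
    linarith

lemma re (hn : IsSymbol n A) : IsSymbol (fun w τ => ((n w τ).re : ℂ)) A := by
  refine ⟨Complex.measurable_ofReal.comp (Complex.measurable_re.comp hn.meas), fun w τ => ?_,
    fun w₁ w₂ τ => ?_⟩
  · rw [Complex.norm_real]; exact (Complex.abs_re_le_norm _).trans (hn.bound w τ)
  · rw [← Complex.ofReal_sub, ← Complex.sub_re, Complex.norm_real]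
    refine le_trans ?_ (hn.diff w₁ w₂ τ)
    gcongr
    exact Complex.abs_re_le_norm _

end IsSymbol

/-- The weakly singular integral operator `w ↦ ∫ |w - τ|^{-α} n(w, τ) dτ`. -/
def singInt (α : ℝ) (n : Circle → Circle → ℂ) (w : Circle) : ℂ :=
  ∫ τ : Circle, ((‖(w : ℂ) - τ‖ ^ (-α) : ℝ) : ℂ) * n w τ ∂haar

variable {α : ℝ}

lemma rpow_neg_sub_le (hα1 : α < 1) {a b d : ℝ} (ha : 0 < a) (hab : a ≤ b)
    (hd : b ≤ a + d) : a ^ (-α) - b ^ (-α) ≤ kern α d a := by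
  have hb : 0 < b := ha.trans_le hab
  have h0 : 0 ≤ b ^ (-α) := by positivity
  have h1 : a / b ≤ 1 := (div_le_one hb).2 hab
  have h2 : a / b ≤ (a / b) ^ α := by
    conv_lhs => rw [← Real.rpow_one (a / b)]
    exact Real.rpow_le_rpow_of_exponent_ge (by positivity) h1 hα1.le
  have h3 : b ^ (-α) = a ^ (-α) * (a / b) ^ α := by
    rw [Real.div_rpow ha.le hb.le, Real.rpow_neg ha.le, Real.rpow_neg hb.le]
    have := (Real.rpow_pos_of_pos ha α).ne'
    field_simp
  have h4 : 1 - a / b ≤ d / a := by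
    have : 1 - a / b = (b - a) / b := by field_simp
    rw [this]
    exact div_le_div₀ (by linarith) (by linarith) ha hab
  unfold kern
  rw [h3, ← mul_one_sub]
  gcongr
  refine le_min ?_ ?_
  · have : 0 ≤ (a / b) ^ α := by positivity
    linarith
  · linarith

/-- Increments in `w` of the integrand of `singInt` are dominated by `kern`, with no condition on
the position of `τ`. At `τ = w` the junk value `0 ^ (-α) = 0` enters. -/
lemma IsSymbol.singular_diff (hα0 : 0 < α) (hα1 : α < 1) {n : Circle → Circle → ℂ} {A : ℝ}
    (hn : IsSymbol n A) (w₁ w₂ τ : Circle) :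
    ‖((‖(w₁ : ℂ) - τ‖ ^ (-α) : ℝ) : ℂ) * n w₁ τ - ((‖(w₂ : ℂ) - τ‖ ^ (-α) : ℝ) : ℂ) * n w₂ τ‖ ≤
      2 * A * (kern α ‖(w₁ : ℂ) - w₂‖ ‖(w₁ : ℂ) - τ‖ +
        kern α ‖(w₁ : ℂ) - w₂‖ ‖(w₂ : ℂ) - τ‖) := by
  wlog hab : ‖(w₁ : ℂ) - τ‖ ≤ ‖(w₂ : ℂ) - τ‖ generalizing w₁ w₂
  · have := this w₂ w₁ (le_of_not_ge hab)
    rw [norm_sub_rev, norm_sub_rev (w₁ : ℂ) w₂, add_comm (kern α _ _)]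
    exact this
  have hA := hn.nonneg
  set a := ‖(w₁ : ℂ) - τ‖ with ha
  set b := ‖(w₂ : ℂ) - τ‖ with hb
  set d := ‖(w₁ : ℂ) - w₂‖ with hd
  have ha0 : 0 ≤ a := norm_nonneg _
  have hd0 : 0 ≤ d := norm_nonneg _
  have hbd : b ≤ a + d := by
    have := norm_add_le ((w₁ : ℂ) - τ) ((w₂ : ℂ) - w₁)
    rw [norm_sub_rev (w₂ : ℂ)] at this
    have e : (w₁ : ℂ) - τ + (w₂ - w₁) = w₂ - τ := by ring
    rwa [e] at this
  have e : ((a ^ (-α) : ℝ) : ℂ) * n w₁ τ - ((b ^ (-α) : ℝ) : ℂ) * n w₂ τ =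
      ((a ^ (-α) - b ^ (-α) : ℝ) : ℂ) * n w₁ τ + ((b ^ (-α) : ℝ) : ℂ) * (n w₁ τ - n w₂ τ) := by
    push_cast; ring
  have h2 : b ^ (-α) * ‖n w₁ τ - n w₂ τ‖ ≤ 2 * A * kern α d b := by
    rcases (norm_nonneg ((w₂ : ℂ) - τ)).eq_or_lt with h | h
    · rw [hb, ← h]; unfold kern; rw [Real.zero_rpow (by linarith)]; simp
    · have h5 := hn.diff w₂ w₁ τ
      rw [norm_sub_rev, norm_sub_rev (w₂ : ℂ) w₁, ← hd, ← hb] at h5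
      have h6 : ‖n w₁ τ - n w₂ τ‖ ≤ 2 * A * min 1 (d / b) := by
        rw [mul_min_of_nonneg _ _ (by positivity)]
        refine le_min ?_ ?_
        · have := norm_sub_le (n w₁ τ) (n w₂ τ)
          linarith [hn.bound w₁ τ, hn.bound w₂ τ]
        · rw [← mul_div_assoc, le_div_iff₀ h]; exact h5
      calc _ ≤ b ^ (-α) * (2 * A * min 1 (d / b)) := by gcongr
        _ = _ := by unfold kern; ring
  rcases ha0.eq_or_lt with h | h
  · rw [← h, Real.zero_rpow (by linarith)]
    have hbd' : b = d := by
      have h7 : (w₁ : ℂ) = τ := sub_eq_zero.1 (norm_eq_zero.1 h.symm)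
      rw [hb, hd, h7, norm_sub_rev]
    have h8 : 0 ≤ kern α d 0 := kern_nonneg hd0 le_rfl
    have h9 : b ^ (-α) ≤ kern α d b := by
      rcases hd0.eq_or_lt with h' | h'
      · rw [hbd', ← h']; unfold kern; rw [Real.zero_rpow (by linarith)]; simp
      · rw [hbd']; unfold kern; rw [div_self h'.ne', min_self, mul_one]
    rw [Complex.ofReal_zero, zero_mul, zero_sub, norm_neg, norm_mul, Complex.norm_real,
      Real.norm_of_nonneg (by positivity)]
    have h10 := mul_le_mul h9 (hn.bound w₂ τ) (norm_nonneg _)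
      (kern_nonneg hd0 (ha0.trans hab))
    nlinarith [mul_nonneg hA h8, mul_nonneg hA (kern_nonneg (α := α) hd0 (ha0.trans hab))]
  · have h3 := rpow_neg_sub_le hα1 h hab hbd
    have h4 : 0 ≤ a ^ (-α) - b ^ (-α) :=
      sub_nonneg.2 (Real.rpow_le_rpow_of_nonpos h hab (by linarith))
    rw [e]
    refine (norm_add_le _ _).trans ?_
    rw [norm_mul, norm_mul, Complex.norm_real, Complex.norm_real, Real.norm_of_nonneg h4,
      Real.norm_of_nonneg (by positivity)]
    have h5 := mul_le_mul h3 (hn.bound w₁ τ) (norm_nonneg _) (kern_nonneg hd0 ha0)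
    have h6 := mul_nonneg (kern_nonneg (α := α) hd0 ha0) hA
    linarith

lemma integrable_rpow_dist (hα0 : 0 < α) (hα1 : α < 1) (w : Circle) :
    Integrable (fun τ : Circle => ((‖(w : ℂ) - τ‖ ^ (-α) : ℝ) : ℂ)) haar :=
  (integrable_comp_dist (k := fun r => r ^ (-α)) (integrable_rpow hα0 hα1) w).ofReal

lemma IsSymbol.integrable (hα0 : 0 < α) (hα1 : α < 1) {n : Circle → Circle → ℂ} {A : ℝ}
    (hn : IsSymbol n A) (w : Circle) :
    Integrable (fun τ : Circle => ((‖(w : ℂ) - τ‖ ^ (-α) : ℝ) : ℂ) * n w τ) haar :=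
  (integrable_rpow_dist hα0 hα1 w).mul_bdd (c := A)
    (hn.meas.comp measurable_prodMk_left).aestronglyMeasurable (.of_forall fun τ => hn.bound w τ)

lemma singInt_add (hα0 : 0 < α) (hα1 : α < 1) {n m : Circle → Circle → ℂ} {A B : ℝ}
    (hn : IsSymbol n A) (hm : IsSymbol m B) (w : Circle) :
    singInt α (fun w τ => n w τ + m w τ) w = singInt α n w + singInt α m w := by
  unfold singInt
  simp_rw [mul_add]
  exact integral_add (hn.integrable hα0 hα1 w) (hm.integrable hα0 hα1 w)

lemma singInt_const_mul (c : ℂ) (n : Circle → Circle → ℂ) (w : Circle) :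
    singInt α (fun w τ => c * n w τ) w = c * singInt α n w := by
  unfold singInt
  rw [← integral_const_mul]
  congr 1
  funext τ
  ring

/-- Increments dominated by `kern` integrate to a Hölder increment. -/
lemma norm_integral_le_of_le_kern (hα0 : 0 < α) (hα1 : α < 1) {u : Circle → ℂ} {A : ℝ}
    (hA : 0 ≤ A) {w₁ w₂ : Circle} (hw : w₁ ≠ w₂)
    (h : ∀ τ : Circle, ‖u τ‖ ≤ A * (kern α ‖(w₁ : ℂ) - w₂‖ ‖(w₁ : ℂ) - τ‖ +
        kern α ‖(w₁ : ℂ) - w₂‖ ‖(w₂ : ℂ) - τ‖)) :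
    ‖∫ τ, u τ ∂haar‖ ≤ 2 * A * kernConst α * ‖(w₁ : ℂ) - w₂‖ ^ (1 - α) := by
  have hd : 0 < ‖(w₁ : ℂ) - w₂‖ :=
    norm_pos_iff.2 (sub_ne_zero.2 fun h => hw (Circle.ext h))
  have hi := fun w => integrable_comp_dist (integrable_kern hα0 hα1 hd) w
  have h1 := norm_integral_le_of_norm_le (((hi w₁).add (hi w₂)).const_mul A) (.of_forall h)
  refine h1.trans ?_
  have h2 := integral_kern_le hα0 hα1 hd
  rw [integral_const_mul]
  simp only [Pi.add_apply]
  rw [integral_add (hi w₁) (hi w₂), integral_comp_dist, integral_comp_dist]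
  nlinarith

/-- Weakly singular integrals of symbols are `(1 - α)`-Hölder continuous. -/
lemma IsSymbol.hb_singInt (hα0 : 0 < α) (hα1 : α < 1) {n : Circle → Circle → ℂ} {A : ℝ}
    (hn : IsSymbol n A) : HB (1 - α) (singInt α n) (2 * singConst α * A) := by
  have hA := hn.nonneg
  have hr := riesz_nonneg α
  have hk := kernConst_nonneg α
  refine ⟨fun w => ?_, fun w₁ w₂ => ?_⟩
  · have h1 := norm_integral_le_of_norm_le (f := fun τ : Circle =>
      ((‖(w : ℂ) - τ‖ ^ (-α) : ℝ) : ℂ) * n w τ)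
      ((integrable_comp_dist (k := fun r => r ^ (-α)) (integrable_rpow hα0 hα1) w).mul_const A)
      (.of_forall fun τ => by
        rw [norm_mul, Complex.norm_real, Real.norm_of_nonneg (by positivity)]
        gcongr
        exact hn.bound w τ)
    rw [integral_mul_const, integral_comp_dist (fun r => r ^ (-α))] at h1
    refine h1.trans ?_
    change riesz α * A ≤ _
    unfold singConst
    nlinarith [mul_nonneg hr hA, mul_nonneg hk hA]
  · rcases eq_or_ne w₁ w₂ with rfl | hw
    · rw [sub_self, norm_zero]
      have := singConst_nonneg α
      positivity
    · have h1 := norm_integral_le_of_le_kern hα0 hα1 (by positivity) hw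
        (hn.singular_diff hα0 hα1 w₁ w₂)
      rw [integral_sub (hn.integrable hα0 hα1 w₁) (hn.integrable hα0 hα1 w₂)] at h1
      refine h1.trans (mul_le_mul_of_nonneg_right ?_ (by positivity))
      unfold singConst
      nlinarith [mul_nonneg hr hA, mul_nonneg hk hA]

/-! ### Second-order expansion of the kernel -/

/-- The second-order Taylor remainder of `q ↦ |1 + q|^{-α}` at `q = 0`. -/
def taylorRem (α : ℝ) (q : ℂ) : ℝ := ‖1 + q‖ ^ (-α) - 1 + α * q.re

lemma taylorRem_zero (α : ℝ) : taylorRem α 0 = 0 := by simp [taylorRem]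

lemma taylorRem_eq (α : ℝ) :
    taylorRem α = fun q => (‖1 + q‖ ^ 2) ^ (-α / 2) - 1 + α * q.re := by
  funext q
  rw [taylorRem, ← Real.rpow_natCast_mul (norm_nonneg _)]
  congr 3
  push_cast
  ring

lemma contDiffAt_taylorRem (α : ℝ) : ContDiffAt ℝ 2 (taylorRem α) 0 := by
  rw [taylorRem_eq]
  have h1 : ContDiffAt ℝ 2 (fun q : ℂ => ‖1 + q‖ ^ 2) 0 :=
    (contDiff_const.add contDiff_id).norm_sq ℝ |>.contDiffAt
  have h2 : ContDiffAt ℝ 2 (fun q : ℂ => q.re) 0 := Complex.reCLM.contDiff.contDiffAt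
  exact ((h1.rpow_const_of_ne (by simp)).sub contDiffAt_const).add (contDiffAt_const.mul h2)

lemma fderiv_taylorRem_zero (α : ℝ) : fderiv ℝ (taylorRem α) 0 = 0 := by
  have h0 : HasFDerivAt (fun q : ℂ => 1 + q) (ContinuousLinearMap.id ℝ ℂ) 0 :=
    (hasFDerivAt_id (𝕜 := ℝ) (0 : ℂ)).const_add (1 : ℂ)
  have h1 := h0.norm_sq
  have h2 := (h1.rpow_const (p := -α / 2) (.inl (by simp))).sub_const 1
  have h3 : HasFDerivAt (fun q : ℂ => α * q.re) (α • Complex.reCLM) 0 :=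
    (Complex.reCLM.hasFDerivAt (x := (0 : ℂ))).const_mul α
  have h4 := h2.add h3
  have h5 : taylorRem α =
    (fun q => (‖1 + q‖ ^ 2) ^ (-α / 2) - 1) + fun q : ℂ => α * q.re := taylorRem_eq α
  rw [← h5] at h4
  rw [h4.fderiv]
  ext z
  simp
  ring

/-- The Taylor remainder is quadratically small together with its increments. -/
lemma exists_taylorRem_bound (α : ℝ) : ∃ r > 0, ∃ C ≥ 0, ∀ L ≤ r, ∀ p q : ℂ, ‖p‖ ≤ L → ‖q‖ ≤ L →
    ‖taylorRem α q - taylorRem α p‖ ≤ C * L * ‖q - p‖ := by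
  have h := contDiffAt_taylorRem α
  have h1 : ContDiffAt ℝ 1 (fderiv ℝ (taylorRem α)) 0 := h.fderiv_right (by norm_num)
  obtain ⟨K, t, ht, hK⟩ := h1.exists_lipschitzOnWith
  have h2 : ∀ᶠ x in 𝓝 (0 : ℂ), DifferentiableAt ℝ (taylorRem α) x :=
    (h.eventually (by simp)).mono fun x hx => hx.differentiableAt (by norm_num)
  obtain ⟨r, hr, hsub⟩ := Metric.nhds_basis_closedBall.mem_iff.1 (Filter.inter_mem ht h2)
  refine ⟨r, hr, K, K.2, fun L hL p q hp hq => ?_⟩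
  have hball : ∀ x ∈ Metric.closedBall (0 : ℂ) L, x ∈ Metric.closedBall (0 : ℂ) r :=
    fun x hx => Metric.closedBall_subset_closedBall hL hx
  have h3 := Convex.norm_image_sub_le_of_norm_fderiv_le (𝕜 := ℝ) (f := taylorRem α) (C := K * L)
    (s := Metric.closedBall (0 : ℂ) L) (x := p) (y := q) (fun x hx => (hsub (hball x hx)).2)
    (fun x hx => ?_) (convex_closedBall _ _) (by simpa using hp) (by simpa using hq)
  · exact h3
  · have h4 := hK.dist_le_mul x (hsub (hball x hx)).1 0 (mem_of_mem_nhds ht)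
    rw [fderiv_taylorRem_zero, dist_zero_right, dist_zero_right] at h4
    refine h4.trans ?_
    gcongr
    simpa using hx

/-- The difference quotient `(f(w) - f(τ)) / (w - τ)`. -/
def quot (f : Circle → ℂ) (w τ : Circle) : ℂ := (f w - f τ) / ((w : ℂ) - τ)

lemma measurable_quot {f : Circle → ℂ} (hf : Continuous f) :
    Measurable (Function.uncurry (quot f)) := by
  have h1 := hf.measurable
  have h2 := continuous_coe.measurable
  exact ((h1.comp measurable_fst).sub (h1.comp measurable_snd)).div
    ((h2.comp measurable_fst).sub (h2.comp measurable_snd))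

/-- Difference quotients of a Lipschitz function are symbols, since
`(q(w₁, τ) - q(w₂, τ)) (w₁ - τ) = f(w₁) - f(w₂) - q(w₂, τ) (w₁ - w₂)`. -/
lemma isSymbol_quot {f : Circle → ℂ} (hf : Continuous f) {L : ℝ} (hL0 : 0 ≤ L)
    (hL : ∀ w₁ w₂ : Circle, ‖f w₁ - f w₂‖ ≤ L * ‖(w₁ : ℂ) - w₂‖) : IsSymbol (quot f) L := by
  have hb : ∀ w τ, ‖quot f w τ‖ ≤ L := fun w τ => by
    rw [quot, norm_div]
    exact div_le_of_le_mul₀ (norm_nonneg _) hL0 (hL w τ)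
  refine ⟨measurable_quot hf, hb, fun w₁ w₂ τ => ?_⟩
  have hm : ∀ w τ, quot f w τ * ((w : ℂ) - τ) = f w - f τ := fun w τ => by
    rcases eq_or_ne w τ with rfl | h
    · simp
    · exact div_mul_cancel₀ _ (sub_ne_zero.2 fun h' => h (Circle.ext h'))
  have e : (quot f w₁ τ - quot f w₂ τ) * ((w₁ : ℂ) - τ) =
      (f w₁ - f w₂) - quot f w₂ τ * ((w₁ : ℂ) - w₂) := by
    linear_combination hm w₁ τ - hm w₂ τ
  rw [← norm_mul, e]
  refine (norm_sub_le _ _).trans ?_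
  rw [norm_mul]
  have h1 := hL w₁ w₂
  have h2 := mul_le_mul_of_nonneg_right (hb w₂ τ) (norm_nonneg ((w₁ : ℂ) - w₂))
  linarith

lemma measurable_taylorRem (α : ℝ) : Measurable (taylorRem α) := by
  unfold taylorRem
  have h : Measurable fun q : ℂ => ‖1 + q‖ := by fun_prop
  exact ((h.pow_const _).sub_const _).add (Complex.measurable_re.const_mul _)

lemma IsSymbol.taylorRem {n : Circle → Circle → ℂ} {r C L : ℝ}
    (hC : ∀ L ≤ r, ∀ p q : ℂ, ‖p‖ ≤ L → ‖q‖ ≤ L →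
      ‖VState.taylorRem α q - VState.taylorRem α p‖ ≤ C * L * ‖q - p‖) (hC0 : 0 ≤ C)
    (hL : L ≤ r) (hn : IsSymbol n L) :
    IsSymbol (fun w τ => (VState.taylorRem α (n w τ) : ℂ)) (C * L ^ 2) := by
  have hL0 := hn.nonneg
  refine ⟨Complex.measurable_ofReal.comp ((measurable_taylorRem α).comp hn.meas), fun w τ => ?_,
    fun w₁ w₂ τ => ?_⟩
  · have h := hC L hL 0 (n w τ) (by simpa using hL0) (hn.bound w τ)
    rw [taylorRem_zero, sub_zero, sub_zero] at h
    rw [Complex.norm_real, pow_two, ← mul_assoc]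
    exact h.trans (mul_le_mul_of_nonneg_left (hn.bound w τ) (by positivity))
  · rw [← Complex.ofReal_sub, Complex.norm_real]
    have h := hC L hL _ _ (hn.bound w₂ τ) (hn.bound w₁ τ)
    have h1 := mul_le_mul_of_nonneg_right h (norm_nonneg ((w₁ : ℂ) - τ))
    have h2 := mul_le_mul_of_nonneg_left (hn.diff w₁ w₂ τ) (show 0 ≤ C * L by positivity)
    linarith

/-! ### Moments of the Riesz kernel -/

/-- The (complex) Fourier coefficients `∫ |s - 1|^{-α} s^k ds` of the Riesz kernel. -/
def momentC (α : ℝ) (k : ℤ) : ℂ :=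
  ∫ s : Circle, ((‖(s : ℂ) - 1‖ ^ (-α) : ℝ) : ℂ) * (s : ℂ) ^ k ∂haar

/-- The Fourier coefficients of the Riesz kernel, which are real. -/
def moment (α : ℝ) (k : ℤ) : ℝ := (momentC α k).re

lemma norm_inv_sub_one (s : Circle) : ‖((s⁻¹ : Circle) : ℂ) - 1‖ = ‖(s : ℂ) - 1‖ := by
  rw [Circle.coe_inv_eq_conj, ← map_one (starRingEnd ℂ), ← map_sub, RCLike.norm_conj, map_one]

lemma momentC_neg (α : ℝ) (k : ℤ) : momentC α (-k) = momentC α k := by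
  have h := integral_inv_eq_self
    (fun s : Circle => ((‖(s : ℂ) - 1‖ ^ (-α) : ℝ) : ℂ) * (s : ℂ) ^ k) haar
  rw [momentC, momentC, ← h]
  congr 1
  funext s
  rw [norm_inv_sub_one]
  rw [Circle.coe_inv, inv_zpow, zpow_neg]

lemma momentC_eq (α : ℝ) (k : ℤ) : momentC α k = moment α k := by
  refine (Complex.conj_eq_iff_re.1 ?_).symm
  conv_rhs => rw [← momentC_neg]
  unfold momentC
  rw [← integral_conj]
  congr 1
  funext s
  rw [map_mul, Complex.conj_ofReal, map_zpow₀, ← Circle.coe_inv_eq_conj, Circle.coe_inv, inv_zpow']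

lemma moment_neg (α : ℝ) (k : ℤ) : moment α (-k) = moment α k := by
  rw [moment, momentC_neg, moment]

lemma singInt_eq (α : ℝ) (n : Circle → Circle → ℂ) (w : Circle) :
    singInt α n w = ∫ s : Circle, ((‖(s : ℂ) - 1‖ ^ (-α) : ℝ) : ℂ) * n w (w * s) ∂haar := by
  unfold singInt
  rw [← integral_mul_left_eq_self _ w]
  congr 1
  funext s
  rw [norm_coe_sub_coe, inv_mul_cancel_left]

lemma singInt_snd (α : ℝ) (w : Circle) :
    singInt α (fun _ τ => (τ : ℂ)) w = moment α 1 * w := by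
  rw [singInt_eq, ← momentC_eq, momentC, ← integral_mul_const]
  congr 1
  funext s
  rw [Circle.coe_mul, zpow_one]
  ring

lemma singInt_inv {n : Circle → Circle → ℂ} (hn : ∀ w τ, n w⁻¹ τ⁻¹ = conj (n w τ)) (w : Circle) :
    singInt α n w⁻¹ = conj (singInt α n w) := by
  unfold singInt
  rw [← integral_inv_eq_self, ← integral_conj]
  congr 1
  funext τ
  rw [hn, map_mul, Complex.conj_ofReal]
  congr 3
  rw [Circle.coe_inv_eq_conj, Circle.coe_inv_eq_conj, ← map_sub, RCLike.norm_conj]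

/-! ### Splitting the functional into its linear part and a quadratic remainder -/

/-- The part of the symbol of the velocity integral that is linear in `f`. -/
def symbolLin (α : ℝ) (f : Circle → ℂ) (w τ : Circle) : ℂ :=
  (τ : ℂ) * (dw f τ + (-α : ℂ) * ((quot f w τ).re : ℂ))

/-- The part of the symbol of the velocity integral that is quadratically small in `f`. -/
def symbolRem (α : ℝ) (f : Circle → ℂ) (w τ : Circle) : ℂ :=
  (τ : ℂ) * ((taylorRem α (quot f w τ) : ℂ) * (1 + dw f τ) +
    (-α : ℂ) * (dw f τ * ((quot f w τ).re : ℂ)))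

/-- The expression whose imaginary part is the linearization of `F(Ω, ·)` at the disc. -/
def linE (α Ω : ℝ) (f : Circle → ℂ) (w : Circle) : ℂ :=
  (Ω : ℂ) * (f w * conj (w : ℂ) + conj (dw f w)) -
    (Cconst α : ℂ) * (singInt α (symbolLin α f) w * conj (w : ℂ) + (moment α 1 : ℂ) * conj (dw f w))

/-- The expression whose imaginary part is the quadratic remainder of `F(Ω, ·)` at the disc. -/
def remE (α Ω : ℝ) (f : Circle → ℂ) (w : Circle) : ℂ :=
  (Ω : ℂ) * (f w * conj (w : ℂ) * conj (dw f w)) -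
    (Cconst α : ℂ) * (singInt α (symbolRem α f) w * conj (w : ℂ) * (1 + conj (dw f w)) +
      singInt α (symbolLin α f) w * conj (w : ℂ) * conj (dw f w))

/-- The bounds on a perturbation `f` that enter the estimates: `N` controls the Hölder norms of `f`
and `f'` and the Lipschitz constant of `f`. -/
structure Controlled (α : ℝ) (f : Circle → ℂ) (N : ℝ) : Prop where
  hol : IsHolderOne (1 - α).toNNReal f
  hb : HB (1 - α) f (4 * N)
  hb_dw : HB (1 - α) (dw f) N
  lip : ∀ w₁ w₂ : Circle, ‖f w₁ - f w₂‖ ≤ 2 * N * ‖(w₁ : ℂ) - w₂‖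

lemma controlled (hα0 : 0 < α) (hα1 : α < 1) {f : Circle → ℂ}
    (hf : IsHolderOne (1 - α).toNNReal f) :
    Controlled α f (holderOneNorm (1 - α).toNNReal f) := by
  set N := holderOneNorm (1 - α).toNNReal f with hN
  have h0 := supNorm_nonneg f
  have h1 := holderNorm_nonneg (1 - α).toNNReal (dw f)
  have hN0 : 0 ≤ N := add_nonneg h0 h1
  have h2 : HB (1 - α) (dw f) N := (hf.2.hb (by linarith)).mono (by
    rw [hN]; unfold holderOneNorm; linarith)
  have hlip : ∀ w₁ w₂ : Circle, ‖f w₁ - f w₂‖ ≤ 2 * N * ‖(w₁ : ℂ) - w₂‖ := fun w₁ w₂ => by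
    refine (norm_sub_le_of_dw_le hf h2.bound w₁ w₂).trans ?_
    gcongr
    linarith [Real.pi_le_four]
  refine ⟨hf, ?_, h2, hlip⟩
  have := HB.of_lipschitz (γ := 1 - α) (by linarith) (by linarith) (A := 2 * N)
    (fun w => (norm_le_supNorm hf.continuous w).trans (by
      rw [hN]; unfold holderOneNorm; linarith)) hlip
  exact this.mono (by linarith)

namespace Controlled

variable {f : Circle → ℂ} {N : ℝ}

lemma nonneg (hf : Controlled α f N) : 0 ≤ N := hf.hb_dw.nonneg

lemma isSymbol_quot (hf : Controlled α f N) : IsSymbol (quot f) (2 * N) :=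
  VState.isSymbol_quot hf.hol.continuous (by linarith [hf.nonneg]) hf.lip

lemma isSymbol_dw (hf : Controlled α f N) : IsSymbol (fun _ τ => dw f τ) N :=
  .of_right hf.hol.2.1.measurable hf.hb_dw.bound

lemma isSymbol_coe : IsSymbol (fun _ τ => (τ : ℂ)) 1 :=
  .of_right continuous_coe.measurable fun τ => (Circle.norm_coe τ).le

lemma norm_neg_le (hα0 : 0 < α) (hα1 : α < 1) : ‖(-α : ℂ)‖ ≤ 1 := by
  rw [norm_neg, Complex.norm_real, Real.norm_of_nonneg hα0.le]
  exact hα1.le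

lemma isSymbol_lin (hα0 : 0 < α) (hα1 : α < 1) (hf : Controlled α f N) :
    IsSymbol (symbolLin α f) (6 * N) := by
  have hN := hf.nonneg
  refine (isSymbol_coe.mul (hf.isSymbol_dw.add (hf.isSymbol_quot.re.const_mul (-α)))).mono ?_
  nlinarith [norm_neg_le hα0 hα1]

lemma isSymbol_rem (hα0 : 0 < α) (hα1 : α < 1) {r C : ℝ}
    (hC : ∀ L ≤ r, ∀ p q : ℂ, ‖p‖ ≤ L → ‖q‖ ≤ L →
      ‖taylorRem α q - taylorRem α p‖ ≤ C * L * ‖q - p‖) (hC0 : 0 ≤ C)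
    (hf : Controlled α f N) (hN1 : N ≤ 1) (hNr : 2 * N ≤ r) :
    IsSymbol (symbolRem α f) ((32 * C + 8) * N ^ 2) := by
  have hN := hf.nonneg
  have h1 : IsSymbol (fun _ τ => 1 + dw f τ) 2 :=
    ((IsSymbol.const 1).add hf.isSymbol_dw).mono (by rw [norm_one]; linarith)
  have h2 := (hf.isSymbol_quot.taylorRem hC hC0 hNr).mul h1
  have h3 := (hf.isSymbol_dw.mul hf.isSymbol_quot.re).const_mul (-α)
  refine (isSymbol_coe.mul (h2.add h3)).mono ?_
  nlinarith [mul_le_mul_of_nonneg_right (norm_neg_le hα0 hα1) (sq_nonneg N)]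

end Controlled

lemma conj_mul_coe (w : Circle) : conj (w : ℂ) * w = 1 := by
  rw [← Circle.coe_inv_eq_conj, Circle.coe_inv, inv_mul_cancel₀ w.coe_ne_zero]

/-- The velocity integral of `φ(w) = w + f(w)` as a weakly singular integral on the circle. -/
lemma contourMean_patch {f : Circle → ℂ} (hα0 : 0 < α) (hf : IsHolderOne (1 - α).toNNReal f)
    (w : Circle) :
    contourMean (fun τ => dw (fun z => (z : ℂ) + f z) τ /
      ((‖((w : ℂ) + f w) - ((τ : ℂ) + f τ)‖ ^ α : ℝ) : ℂ)) =
    singInt α (fun w τ => (τ : ℂ) + symbolLin α f w τ + symbolRem α f w τ) w := by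
  rw [contourMean_eq, singInt]
  congr 1
  funext τ
  rw [dw_coe_add hf]
  rcases eq_or_ne w τ with rfl | h
  · simp [Real.zero_rpow hα0.ne', Real.zero_rpow (neg_ne_zero.2 hα0.ne')]
  · have hne : (w : ℂ) - τ ≠ 0 := sub_ne_zero.2 fun h' => h (Circle.ext h')
    have e : ((w : ℂ) + f w) - ((τ : ℂ) + f τ) = ((w : ℂ) - τ) * (1 + quot f w τ) := by
      rw [quot]; field_simp; ring
    have e2 : ‖1 + quot f w τ‖ ^ (-α) =
      taylorRem α (quot f w τ) + 1 - α * (quot f w τ).re := by rw [taylorRem]; ring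
    rw [e, div_eq_mul_inv, ← Complex.ofReal_inv, ← Real.rpow_neg (norm_nonneg _), norm_mul,
      Real.mul_rpow (norm_nonneg _) (norm_nonneg _), e2, symbolLin, symbolRem]
    push_cast
    ring

/-- Expansion of `F(Ω, f)` at the disc. The zeroth-order term `Ω - C_α M_1`, with `M_1` the first
moment, is real and drops out of the imaginary part. -/
lemma patchF_eq (hα0 : 0 < α) (hα1 : α < 1) {f : Circle → ℂ} {N B : ℝ} (hf : Controlled α f N)
    (hrem : IsSymbol (symbolRem α f) B) (Ω : ℝ) (w : Circle) :
    patchF α Ω f w = ((linE α Ω f w).im : ℂ) + ((remE α Ω f w).im : ℂ) := by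
  have h1 := Controlled.isSymbol_coe.add (hf.isSymbol_lin hα0 hα1)
  rw [patchF, patchG, contourMean_patch hα0 hf.hol, dw_coe_add hf.hol,
    singInt_add hα0 hα1 h1 hrem, singInt_add hα0 hα1 Controlled.isSymbol_coe
    (hf.isSymbol_lin hα0 hα1), singInt_snd, ← Complex.ofReal_add]
  congr 1
  rw [← Complex.add_im]
  have e : ((Ω : ℂ) * ((w : ℂ) + f w) - (Cconst α : ℂ) * (moment α 1 * w +
      singInt α (symbolLin α f) w + singInt α (symbolRem α f) w)) *
      (conj (w : ℂ) * conj (1 + dw f w)) =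
      linE α Ω f w + remE α Ω f w + ((Ω - Cconst α * moment α 1 : ℝ) : ℂ) := by
    rw [map_add, map_one, linE, remE]
    push_cast
    linear_combination ((Ω : ℂ) - Cconst α * moment α 1) * (1 + conj (dw f w)) * conj_mul_coe w
  rw [e, Complex.add_im, Complex.ofReal_im, add_zero]

lemma HB.conj_coe (hα0 : 0 < α) (hα1 : α < 1) :
    HB (1 - α) (fun w : Circle => (starRingEnd ℂ) (w : ℂ)) 2 :=
  (HB.coe (by linarith) (by linarith)).star

/-- A Hölder bound, uniform in `N`, for the linearization. -/
def linConst (α Ω : ℝ) : ℝ :=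
  |Ω| * 17 + |Cconst α| * (48 * singConst α + |moment α 1|)

lemma hb_linE (hα0 : 0 < α) (hα1 : α < 1) {f : Circle → ℂ} {N : ℝ} (hf : Controlled α f N)
    (Ω : ℝ) : HB (1 - α) (linE α Ω f) (linConst α Ω * N) := by
  have hw := HB.conj_coe hα0 hα1
  have h1 := (hf.hb.mul hw).add hf.hb_dw.star
  have h2 := (((hf.isSymbol_lin hα0 hα1).hb_singInt hα0 hα1).mul hw).add
    (hf.hb_dw.star.const_mul (moment α 1))
  refine ((h1.const_mul Ω).sub (h2.const_mul (Cconst α))).mono (le_of_eq ?_)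
  simp only [Complex.norm_real, Real.norm_eq_abs, linConst]
  ring

/-- A Hölder bound, uniform in `N ≤ 1`, for the quadratic remainder. -/
def remConst (α Ω C : ℝ) : ℝ :=
  |Ω| * 32 + |Cconst α| * (2 * (2 * (2 * singConst α * (32 * C + 8)) * 2) * 2 +
    2 * (2 * (2 * singConst α * 6) * 2))

lemma hb_remE (hα0 : 0 < α) (hα1 : α < 1) {f : Circle → ℂ} {N C : ℝ} (hf : Controlled α f N)
    (hN : N ≤ 1) (hrem : IsSymbol (symbolRem α f) ((32 * C + 8) * N ^ 2)) (Ω : ℝ) :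
    HB (1 - α) (remE α Ω f) (remConst α Ω C * N ^ 2) := by
  have hw := HB.conj_coe hα0 hα1
  have h1 := (hf.hb.mul hw).mul hf.hb_dw.star
  have h0 : HB (1 - α) (fun w => 1 + (starRingEnd ℂ) (dw f w)) 2 :=
    ((HB.const (1 - α) 1).add hf.hb_dw.star).mono (by rw [norm_one]; linarith)
  have h2 := ((hrem.hb_singInt hα0 hα1).mul hw).mul h0
  have h3 := (((hf.isSymbol_lin hα0 hα1).hb_singInt hα0 hα1).mul hw).mul hf.hb_dw.star
  refine ((h1.const_mul Ω).sub ((h2.add h3).const_mul (Cconst α))).mono (le_of_eq ?_)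
  simp only [Complex.norm_real, Real.norm_eq_abs, remConst]
  ring

/-! ### Reflection symmetry -/

section symmetry

variable {f : Circle → ℂ}

lemma coe_inv_conj (w : Circle) : ((w⁻¹ : Circle) : ℂ) = conj (w : ℂ) := Circle.coe_inv_eq_conj w

lemma IsX.apply_inv (hf : IsX α f) (w : Circle) : f w⁻¹ = conj (f w) :=
  apply_inv_of_coeff_real hf.1.continuous hf.2.1 w

lemma IsX.dw_inv (hf : IsX α f) (w : Circle) : dw f w⁻¹ = conj (dw f w) := by
  refine apply_inv_of_coeff_real hf.1.2.1 (fun n => ?_) w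
  rw [coeff_dw hf.1]
  have := hf.2.1 (n + 1)
  simp [Complex.mul_im, this]

lemma IsX.quot_inv (hf : IsX α f) (w τ : Circle) : quot f w⁻¹ τ⁻¹ = conj (quot f w τ) := by
  unfold quot
  rw [hf.apply_inv, hf.apply_inv, coe_inv_conj, coe_inv_conj]
  simp

lemma taylorRem_conj (q : ℂ) : taylorRem α (conj q) = taylorRem α q := by
  unfold taylorRem
  rw [Complex.conj_re, ← RCLike.norm_conj (1 + q)]
  simp

lemma IsX.symbolLin_inv (hf : IsX α f) (w τ : Circle) :
    symbolLin α f w⁻¹ τ⁻¹ = conj (symbolLin α f w τ) := by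
  unfold symbolLin
  rw [hf.quot_inv, hf.dw_inv, coe_inv_conj]
  simp

lemma IsX.symbolRem_inv (hf : IsX α f) (w τ : Circle) :
    symbolRem α f w⁻¹ τ⁻¹ = conj (symbolRem α f w τ) := by
  unfold symbolRem
  rw [hf.quot_inv, hf.dw_inv, coe_inv_conj, taylorRem_conj]
  simp

lemma IsX.linE_inv (hf : IsX α f) (Ω : ℝ) (w : Circle) :
    linE α Ω f w⁻¹ = conj (linE α Ω f w) := by
  unfold linE
  rw [hf.apply_inv, hf.dw_inv, coe_inv_conj, singInt_inv hf.symbolLin_inv]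
  simp

lemma IsX.remE_inv (hf : IsX α f) (Ω : ℝ) (w : Circle) :
    remE α Ω f w⁻¹ = conj (remE α Ω f w) := by
  unfold remE
  rw [hf.apply_inv, hf.dw_inv, coe_inv_conj, singInt_inv hf.symbolLin_inv,
    singInt_inv hf.symbolRem_inv]
  simp

end symmetry

/-! ### Fréchet differentiability at the disc -/

lemma SpaceX.isX (f : SpaceX α) : IsX α f.toFun := f.2

lemma SpaceY.isY (g : SpaceY α) : IsY α g.toFun := g.2

lemma SpaceX.ext {f g : SpaceX α} (h : ∀ w, f.toFun w = g.toFun w) : f = g :=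
  Subtype.ext (funext h)

lemma SpaceY.ext {f g : SpaceY α} (h : ∀ w, f.toFun w = g.toFun w) : f = g :=
  Subtype.ext (funext h)

lemma SpaceX.controlled (hα0 : 0 < α) (hα1 : α < 1) (f : SpaceX α) :
    Controlled α f.toFun ‖f‖ := VState.controlled hα0 hα1 f.isX.1

lemma quot_add (f g : Circle → ℂ) (w τ : Circle) :
    quot (f + g) w τ = quot f w τ + quot g w τ := by
  simp only [quot, Pi.add_apply]
  ring

lemma quot_smul (c : ℝ) (f : Circle → ℂ) (w τ : Circle) :
    quot (c • f) w τ = c * quot f w τ := by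
  simp only [quot, Pi.smul_apply, Complex.real_smul]
  ring

lemma symbolLin_smul (c : ℝ) (f : Circle → ℂ) :
    symbolLin α (c • f) = fun w τ => (c : ℂ) * symbolLin α f w τ := by
  funext w τ
  rw [symbolLin, symbolLin, quot_smul, dw_smul, Pi.smul_apply, Complex.real_smul,
    Complex.re_ofReal_mul]
  push_cast
  ring

lemma linE_smul (Ω c : ℝ) (f : Circle → ℂ) (w : Circle) :
    linE α Ω (c • f) w = c * linE α Ω f w := by
  rw [linE, symbolLin_smul, singInt_const_mul, dw_smul, linE]
  simp only [Pi.smul_apply, Complex.real_smul, map_mul, Complex.conj_ofReal]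
  ring

lemma linE_add (hα0 : 0 < α) (hα1 : α < 1) {f g : Circle → ℂ} {M N : ℝ} (hf : Controlled α f M)
    (hg : Controlled α g N) (Ω : ℝ) (w : Circle) :
    linE α Ω (f + g) w = linE α Ω f w + linE α Ω g w := by
  have e : symbolLin α (f + g) = fun w τ => symbolLin α f w τ + symbolLin α g w τ := by
    funext w τ
    rw [symbolLin, symbolLin, symbolLin, quot_add, hf.hol.dw_add hg.hol, Pi.add_apply,
      Complex.add_re]
    push_cast
    ring
  rw [linE, e, singInt_add hα0 hα1 (hf.isSymbol_lin hα0 hα1) (hg.isSymbol_lin hα0 hα1),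
    hf.hol.dw_add hg.hol, linE, linE]
  simp only [Pi.add_apply, map_add]
  ring

/-- The Fréchet derivative of `F(Ω, ·)` at the disc, in closed form. -/
def linOp (hα0 : 0 < α) (hα1 : α < 1) (Ω : ℝ) : SpaceX α →L[ℝ] SpaceY α :=
  LinearMap.mkContinuous
    { toFun := fun f => ⟨fun w => ((linE α Ω f.toFun w).im : ℂ),
        isY_im hα1 (hb_linE hα0 hα1 (f.controlled hα0 hα1) Ω) (f.isX.linE_inv Ω)⟩
      map_add' := fun f g => SpaceY.ext fun w => by
        change ((linE α Ω (f.toFun + g.toFun) w).im : ℂ) =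
          ((linE α Ω f.toFun w).im : ℂ) + ((linE α Ω g.toFun w).im : ℂ)
        rw [linE_add hα0 hα1 (f.controlled hα0 hα1) (g.controlled hα0 hα1)]
        simp
      map_smul' := fun c f => SpaceY.ext fun w => by
        change ((linE α Ω (c • f.toFun) w).im : ℂ) = c • ((linE α Ω f.toFun w).im : ℂ)
        rw [linE_smul]
        simp }
    (2 * linConst α Ω)
    (fun f => by
      have h := (hb_linE hα0 hα1 (f.controlled hα0 hα1) Ω).im.holderNorm_le (by linarith)
      rw [mul_assoc]
      exact h)

lemma linOp_apply (hα0 : 0 < α) (hα1 : α < 1) (Ω : ℝ) (f : SpaceX α) (w : Circle) :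
    (linOp hα0 hα1 Ω f).toFun w = ((linE α Ω f.toFun w).im : ℂ) := rfl

/-- Near the disc `F(Ω, f)` lies in `Y` and differs from its linear part by `O(‖f‖²)`. -/
lemma exists_quadratic_bound (hα0 : 0 < α) (hα1 : α < 1) : ∃ ρ > 0, ∃ C : ℝ,
    ∀ f : SpaceX α, ‖f‖ ≤ ρ → ∀ Ω : ℝ, IsY α (patchF α Ω f.toFun) ∧
      ‖mapF α Ω f - linOp hα0 hα1 Ω f‖ ≤ 2 * remConst α Ω C * ‖f‖ ^ 2 := by
  obtain ⟨r, hr, C, hC0, hC⟩ := exists_taylorRem_bound α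
  refine ⟨min 1 (r / 2), by positivity, C, fun f hf Ω => ?_⟩
  have hc := f.controlled hα0 hα1
  have h1 : ‖f‖ ≤ 1 := hf.trans (min_le_left _ _)
  have h2 : 2 * ‖f‖ ≤ r := by linarith [hf.trans (min_le_right _ _)]
  have hrem := hc.isSymbol_rem hα0 hα1 hC hC0 h1 h2
  have hlin := hb_linE hα0 hα1 hc Ω
  have hR := hb_remE hα0 hα1 hc h1 hrem Ω
  have hY : IsY α (patchF α Ω f.toFun) := by
    have h3 := isY_im hα1 (hlin.add hR) (fun w => by
      rw [f.isX.linE_inv, f.isX.remE_inv, map_add])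
    convert h3 using 1
    funext w
    rw [patchF_eq hα0 hα1 hc hrem, Complex.add_im, Complex.ofReal_add]
  refine ⟨hY, ?_⟩
  have e : (mapF α Ω f - linOp hα0 hα1 Ω f).toFun = fun w => ((remE α Ω f.toFun w).im : ℂ) := by
    funext w
    change (mapF α Ω f).toFun w - (linOp hα0 hα1 Ω f).toFun w = _
    have hm : mapF α Ω f = ⟨patchF α Ω f.toFun, hY⟩ := dif_pos hY
    rw [hm, linOp_apply]
    change patchF α Ω f.toFun w - _ = _
    rw [patchF_eq hα0 hα1 hc hrem]
    ring
  change holderNorm (1 - α).toNNReal (mapF α Ω f - linOp hα0 hα1 Ω f).toFun ≤ _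
  rw [e, mul_assoc]
  exact hR.im.holderNorm_le (by linarith)

lemma eventually_isY (hα0 : 0 < α) (hα1 : α < 1) :
    ∀ᶠ f : SpaceX α in 𝓝 0, ∀ Ω : ℝ, IsY α (patchF α Ω f.toFun) := by
  obtain ⟨ρ, hρ, C, h⟩ := exists_quadratic_bound hα0 hα1
  filter_upwards [Metric.closedBall_mem_nhds (0 : SpaceX α) hρ] with f hf Ω
  exact (h f (by simpa using hf) Ω).1

lemma hasFDerivAt_mapF (hα0 : 0 < α) (hα1 : α < 1) (Ω : ℝ) :
    HasFDerivAt (mapF α Ω) (linOp hα0 hα1 Ω) 0 := by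
  obtain ⟨ρ, hρ, C, h⟩ := exists_quadratic_bound hα0 hα1
  have h0 : mapF α Ω 0 = 0 := by
    have := (h 0 (by simpa using hρ.le) Ω).2
    simpa using this
  rw [hasFDerivAt_iff_isLittleO_nhds_zero]
  simp only [zero_add, h0, sub_zero]
  have h1 : (fun f : SpaceX α => mapF α Ω f - linOp hα0 hα1 Ω f) =O[𝓝 0]
      fun f : SpaceX α => ‖f‖ ^ 2 := by
    refine Asymptotics.IsBigO.of_bound (2 * remConst α Ω C) ?_
    filter_upwards [Metric.closedBall_mem_nhds (0 : SpaceX α) hρ] with f hf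
    rw [norm_pow, norm_norm]
    exact (h f (by simpa using hf) Ω).2
  refine h1.trans_isLittleO ?_
  exact Asymptotics.isLittleO_norm_pow_id one_lt_two

lemma linearized_eq (hα0 : 0 < α) (hα1 : α < 1) (Ω : ℝ) :
    linearized α Ω = linOp hα0 hα1 Ω := (hasFDerivAt_mapF hα0 hα1 Ω).fderiv

/-! ### The moments of the Riesz kernel in closed form -/

lemma integrableOn_of_integrable_haar {E : Type*} [NormedAddCommGroup E] {u : Circle → E}
    (hu : Integrable u haar) (a : ℝ) :
    IntegrableOn (fun θ => u (Circle.exp θ)) (Set.Ioc a (a + 2 * Real.pi)) := by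
  have hc : ENNReal.ofReal (2 * Real.pi)⁻¹ ≠ 0 := by
    simp [Real.pi_pos]
  rw [haar_eq_map_exp a, integrable_smul_measure hc ENNReal.ofReal_ne_top] at hu
  exact (integrable_map_measure hu.1 Circle.exp.continuous.measurable.aemeasurable).1 hu

lemma norm_exp_sub_one_of_mem {θ : ℝ} (hθ : θ ∈ Set.Icc 0 (2 * Real.pi)) :
    ‖(Circle.exp θ : ℂ) - 1‖ = 2 * Real.sin (θ / 2) := by
  rw [norm_exp_sub_one, abs_of_nonneg]
  exact Real.sin_nonneg_of_nonneg_of_le_pi (by linarith [hθ.1]) (by linarith [hθ.2])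

lemma coe_exp_half_mul (θ : ℝ) : (Circle.exp θ : ℂ) = (Circle.exp (θ / 2) : ℂ) ^ 2 := by
  rw [← Circle.coe_pow, pow_two, ← Circle.exp_add, add_halves]

lemma coe_exp_eq (θ : ℝ) :
    (Circle.exp θ : ℂ) = (Real.cos θ : ℂ) + (Real.sin θ : ℂ) * Complex.I := by
  rw [Circle.coe_exp, Complex.exp_mul_I, Complex.ofReal_cos, Complex.ofReal_sin]

lemma exp_half_mul_sin (θ : ℝ) : (Circle.exp (θ / 2) : ℂ) * (2 * Complex.I * Real.sin (θ / 2)) =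
    (Circle.exp θ : ℂ) - 1 := by
  have h : ((Real.cos (θ / 2) : ℂ)) ^ 2 + (Real.sin (θ / 2) : ℂ) ^ 2 = 1 := by
    exact_mod_cast Real.cos_sq_add_sin_sq (θ / 2)
  rw [coe_exp_half_mul θ, coe_exp_eq (θ / 2)]
  linear_combination -h + (Real.sin (θ / 2) : ℂ) ^ 2 * Complex.I_sq

lemma exp_half_mul_cos (θ : ℝ) : (Circle.exp (θ / 2) : ℂ) * (2 * Real.cos (θ / 2)) =
    (Circle.exp θ : ℂ) + 1 := by
  have h : ((Real.cos (θ / 2) : ℂ)) ^ 2 + (Real.sin (θ / 2) : ℂ) ^ 2 = 1 := by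
    exact_mod_cast Real.cos_sq_add_sin_sq (θ / 2)
  rw [coe_exp_half_mul θ, coe_exp_eq (θ / 2)]
  linear_combination h - (Real.sin (θ / 2) : ℂ) ^ 2 * Complex.I_sq

lemma integrable_moment (hα0 : 0 < α) (hα1 : α < 1) (k : ℤ) : Integrable
    (fun s : Circle => ((‖(s : ℂ) - 1‖ ^ (-α) : ℝ) : ℂ) * (s : ℂ) ^ k) haar :=
  (integrable_rpow hα0 hα1).ofReal.mul_bdd (c := 1) (continuous_zpow_coe k).aestronglyMeasurable
    (.of_forall fun w => (norm_zpow_coe k w).le)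

/-- The two-term recursion of the moments: the integral over the circle of the derivative of
`s^k (s - 1) |s - 1|^{-α}` vanishes. -/
lemma moment_succ (hα0 : 0 < α) (hα1 : α < 1) (k : ℤ) :
    (k + 1 - α / 2) * moment α (k + 1) = (k + α / 2) * moment α k := by
  set g : Circle → ℂ := fun s => Complex.I * ((k + 1 - α / 2 : ℝ) *
    (((‖(s : ℂ) - 1‖ ^ (-α) : ℝ) : ℂ) * (s : ℂ) ^ (k + 1)) -
    (k + α / 2 : ℝ) * (((‖(s : ℂ) - 1‖ ^ (-α) : ℝ) : ℂ) * (s : ℂ) ^ k)) with hg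
  have hgi : Integrable g haar := (((integrable_moment hα0 hα1 (k + 1)).const_mul _).sub
    ((integrable_moment hα0 hα1 k).const_mul _)).const_mul _
  have hgint : ∫ s, g s ∂haar = Complex.I *
      ((k + 1 - α / 2 : ℝ) * momentC α (k + 1) - (k + α / 2 : ℝ) * momentC α k) := by
    rw [hg, integral_const_mul, integral_sub ((integrable_moment hα0 hα1 (k + 1)).const_mul _)
      ((integrable_moment hα0 hα1 k).const_mul _), integral_const_mul, integral_const_mul,
      momentC, momentC]
  set G : ℝ → ℂ := fun θ => (Circle.exp θ : ℂ) ^ k * (Complex.I * (Circle.exp (θ / 2) : ℂ)) *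
    (((2 * Real.sin (θ / 2)) ^ (1 - α) : ℝ) : ℂ) with hG
  have hGc : Continuous G := by
    have h1 := (continuous_zpow_coe k).comp Circle.exp.continuous
    have h2 : Continuous fun θ : ℝ => (Circle.exp (θ / 2) : ℂ) :=
      continuous_coe.comp (Circle.exp.continuous.comp (continuous_id.div_const 2))
    have h3 : Continuous fun θ : ℝ => (2 * Real.sin (θ / 2)) ^ (1 - α) :=
      Continuous.rpow_const (by fun_prop) fun _ => .inr (by linarith)
    exact (h1.mul (continuous_const.mul h2)).mul (Complex.continuous_ofReal.comp h3)
  have hd : ∀ θ ∈ Set.Ioo 0 (2 * Real.pi), HasDerivAt G (g (Circle.exp θ)) θ := fun θ hθ => by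
    have hs : 0 < 2 * Real.sin (θ / 2) :=
      mul_pos two_pos (Real.sin_pos_of_pos_of_lt_pi (by linarith [hθ.1]) (by linarith [hθ.2]))
    have h2 : HasDerivAt (fun θ : ℝ => (Circle.exp (θ / 2) : ℂ))
        (Complex.I * (Circle.exp (θ / 2) : ℂ) * (1 / 2)) θ := by
      have h := (hasDerivAt_exp (θ / 2)).scomp θ ((hasDerivAt_id θ).div_const 2)
      refine h.congr_deriv ?_
      rw [Complex.real_smul]
      push_cast
      ring
    have h3 : HasDerivAt (fun θ : ℝ => 2 * Real.sin (θ / 2)) (Real.cos (θ / 2)) θ := by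
      have h := (((hasDerivAt_id θ).div_const 2).sin).const_mul 2
      refine h.congr_deriv ?_
      simp
      ring
    have h4 := (h3.rpow_const (p := 1 - α) (.inl hs.ne')).ofReal_comp
    have h5 := ((hasDerivAt_exp_zpow k θ).mul (h2.const_mul Complex.I)).mul h4
    refine h5.congr_deriv ?_
    have e1 : (2 * Real.sin (θ / 2)) ^ (1 - α) =
        2 * Real.sin (θ / 2) * (2 * Real.sin (θ / 2)) ^ (-α) := by
      rw [sub_eq_add_neg, Real.rpow_add hs, Real.rpow_one]
    have e2 : 1 - α - 1 = -α := by ring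
    rw [hg]
    simp only
    rw [e2, norm_exp_sub_one_of_mem ⟨hθ.1.le, hθ.2.le⟩, e1, zpow_add_one₀ (Circle.coe_ne_zero _)]
    set R : ℝ := (2 * Real.sin (θ / 2)) ^ (-α)
    have a1 := exp_half_mul_sin θ
    have a2 := exp_half_mul_cos θ
    simp only [Pi.mul_apply]
    generalize (Circle.exp θ : ℂ) = z at *
    generalize (Circle.exp (θ / 2) : ℂ) = e at *
    generalize Real.sin (θ / 2) = S at *
    generalize Real.cos (θ / 2) = c at *
    push_cast
    linear_combination (Complex.I * (R : ℂ) * z ^ k) * (k + 1 / 2) * a1 +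
      (Complex.I * (R : ℂ) * z ^ k) * (1 - α) / 2 * a2
  have hint : IntervalIntegrable (fun θ => g (Circle.exp θ)) volume 0 (2 * Real.pi) := by
    have h := integrableOn_of_integrable_haar hgi 0
    rw [zero_add] at h
    exact (intervalIntegrable_iff_integrableOn_Ioc_of_le Real.two_pi_pos.le).2 h
  have h := intervalIntegral.integral_eq_sub_of_hasDerivAt_of_le Real.two_pi_pos.le
    hGc.continuousOn hd hint
  have h2 := integral_haar_eq_intervalIntegral g 0
  rw [zero_add, h, hgint] at h2
  have h3 : G (2 * Real.pi) - G 0 = 0 := by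
    have h0 : (0 : ℝ) ^ (1 - α) = 0 := Real.zero_rpow (by linarith)
    rw [hG]
    simp [h0]
  rw [h3, mul_zero, momentC_eq, momentC_eq] at h2
  have h4 := (mul_eq_zero.1 h2).resolve_left Complex.I_ne_zero
  exact sub_eq_zero.1 (by exact_mod_cast h4)

/-- The substitution `x = (1 - cos (θ/2)) / 2`, under which `x (1 - x) = (sin (θ/2) / 2)²`, turns
a Beta integral into the total mass of the Riesz kernel. -/
lemma integral_beta_sin (α : ℝ) :
    ∫ x in Set.Ioo (0 : ℝ) 1, x ^ (-(1 + α) / 2) * (1 - x) ^ (-(1 + α) / 2) =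
      4 ^ α / 2 * ∫ θ in Set.Ioo (0 : ℝ) (2 * Real.pi), (2 * Real.sin (θ / 2)) ^ (-α) := by
  have himage : (fun θ : ℝ => (1 - Real.cos (θ / 2)) / 2) '' Set.Ioo 0 (2 * Real.pi) =
      Set.Ioo 0 1 := by
    ext x
    constructor
    · rintro ⟨θ, hθ, rfl⟩
      have h1 := Real.strictAntiOn_cos (Set.left_mem_Icc.2 Real.pi_pos.le)
        (⟨by linarith [hθ.1], by linarith [hθ.2]⟩ : θ / 2 ∈ Set.Icc 0 Real.pi)
        (by linarith [hθ.1])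
      have h2 := Real.strictAntiOn_cos
        (⟨by linarith [hθ.1], by linarith [hθ.2]⟩ : θ / 2 ∈ Set.Icc 0 Real.pi)
        (Set.right_mem_Icc.2 Real.pi_pos.le) (by linarith [hθ.2])
      rw [Real.cos_zero] at h1
      rw [Real.cos_pi] at h2
      constructor <;> simp only <;> linarith
    · rintro ⟨h0, h1⟩
      refine ⟨2 * Real.arccos (1 - 2 * x), ⟨?_, ?_⟩, ?_⟩
      · have := Real.arccos_pos.2 (show 1 - 2 * x < 1 by linarith)
        linarith
      · have h2 : Real.arccos (1 - 2 * x) < Real.pi :=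
          lt_of_le_of_ne (Real.arccos_le_pi _) fun h => by
            have := Real.arccos_eq_pi.1 h
            linarith
        linarith
      · simp only
        rw [mul_div_cancel_left₀ _ two_ne_zero, Real.cos_arccos (by linarith) (by linarith)]
        ring
  have hinj : Set.InjOn (fun θ : ℝ => (1 - Real.cos (θ / 2)) / 2) (Set.Ioo 0 (2 * Real.pi)) := by
    intro x hx y hy hxy
    have h1 : Real.cos (x / 2) = Real.cos (y / 2) := by simp only at hxy; linarith
    have := Real.injOn_cos ⟨by linarith [hx.1], by linarith [hx.2]⟩
      ⟨by linarith [hy.1], by linarith [hy.2]⟩ h1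
    linarith
  have hd : ∀ θ ∈ Set.Ioo 0 (2 * Real.pi), HasDerivWithinAt
      (fun θ : ℝ => (1 - Real.cos (θ / 2)) / 2) (Real.sin (θ / 2) / 4)
      (Set.Ioo 0 (2 * Real.pi)) θ := fun θ _ => by
      have h := ((((hasDerivAt_id θ).div_const 2).cos).const_sub 1).div_const 2
      refine (h.congr_deriv ?_).hasDerivWithinAt
      simp
      ring
  have h := integral_image_eq_integral_abs_deriv_smul measurableSet_Ioo hd hinj
    (fun x => x ^ (-(1 + α) / 2) * (1 - x) ^ (-(1 + α) / 2))
  rw [himage] at h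
  rw [h, ← integral_const_mul]
  refine setIntegral_congr_fun measurableSet_Ioo fun θ hθ => ?_
  have hs : 0 < Real.sin (θ / 2) :=
    Real.sin_pos_of_pos_of_lt_pi (by linarith [hθ.1]) (by linarith [hθ.2])
  have hc1 := Real.cos_le_one (θ / 2)
  have hc2 := Real.neg_one_le_cos (θ / 2)
  have e1 : (1 - Real.cos (θ / 2)) / 2 * (1 - (1 - Real.cos (θ / 2)) / 2) =
      (Real.sin (θ / 2) / 2) ^ 2 := by
    have := Real.sin_sq_add_cos_sq (θ / 2)
    linear_combination -this / 4
  have e2 : 2 * Real.sin (θ / 2) = 4 * (Real.sin (θ / 2) / 2) := by ring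
  have e3 : Real.sin (θ / 2) / 4 = Real.sin (θ / 2) / 2 / 2 := by ring
  rw [← Real.mul_rpow (by linarith) (by linarith), e1, smul_eq_mul, abs_of_pos (by positivity),
    ← Real.rpow_natCast_mul (by positivity), e2, Real.mul_rpow (by norm_num) (by positivity), e3]
  have hu : 0 < Real.sin (θ / 2) / 2 := by positivity
  set u := Real.sin (θ / 2) / 2
  have e4 : ((2 : ℕ) : ℝ) * (-(1 + α) / 2) = -α - 1 := by push_cast; ring
  rw [e4, Real.rpow_sub_one hu.ne', Real.rpow_neg (x := 4) (by norm_num)]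
  field_simp

/-- The Beta integral, simplified by Legendre's duplication formula. -/
lemma moment_zero (hα0 : 0 < α) (hα1 : α < 1) :
    moment α 0 = Real.Gamma (1 - α) / Real.Gamma (1 - α / 2) ^ 2 := by
  have h1 : moment α 0 = (2 * Real.pi)⁻¹ *
      ∫ θ in Set.Ioo (0 : ℝ) (2 * Real.pi), (2 * Real.sin (θ / 2)) ^ (-α) := by
    have e : momentC α 0 = (riesz α : ℂ) := by
      rw [momentC, riesz, ← integral_complex_ofReal]
      simp
    rw [moment, e, Complex.ofReal_re, riesz,
      integral_haar_real _ (measurable_norm_coe_sub_one.pow_const _).aestronglyMeasurable 0,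
      zero_add, integral_Ioc_eq_integral_Ioo]
    congr 1
    refine setIntegral_congr_fun measurableSet_Ioo fun θ hθ => ?_
    rw [norm_exp_sub_one_of_mem ⟨hθ.1.le, hθ.2.le⟩]
  have hb : 0 < (1 - α) / 2 := by linarith
  have h2 := ProbabilityTheory.beta_eq_betaIntegralReal _ _ hb hb
  have h3 : ProbabilityTheory.beta ((1 - α) / 2) ((1 - α) / 2) =
      4 ^ α / 2 * ∫ θ in Set.Ioo (0 : ℝ) (2 * Real.pi), (2 * Real.sin (θ / 2)) ^ (-α) := by
    rw [← integral_beta_sin, h2, Complex.betaIntegral,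
      intervalIntegral.integral_of_le zero_le_one, integral_Ioc_eq_integral_Ioo,
      ← Complex.ofReal_re (∫ x in Set.Ioo (0 : ℝ) 1, _), ← integral_complex_ofReal]
    congr 1
    refine setIntegral_congr_fun measurableSet_Ioo fun x hx => ?_
    have e : (((1 - α) / 2 : ℝ) : ℂ) - 1 = ((-(1 + α) / 2 : ℝ) : ℂ) := by push_cast; ring
    rw [e, Complex.ofReal_mul, Complex.ofReal_cpow hx.1.le,
      Complex.ofReal_cpow (by linarith [hx.2]), Complex.ofReal_sub, Complex.ofReal_one]
  have h4 := Real.Gamma_mul_Gamma_add_half ((1 - α) / 2)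
  have e1 : (1 - α) / 2 + 1 / 2 = 1 - α / 2 := by ring
  have e2 : 2 * ((1 - α) / 2) = 1 - α := by ring
  have e3 : 1 - (1 - α) = α := by ring
  have hG1 : 0 < Real.Gamma (1 - α) := Real.Gamma_pos_of_pos (by linarith)
  have hG2 : 0 < Real.Gamma (1 - α / 2) := Real.Gamma_pos_of_pos (by linarith)
  rw [e1, e2, e3] at h4
  rw [ProbabilityTheory.beta, add_halves] at h3
  have h5 : (4 : ℝ) ^ α = (2 ^ α) ^ 2 := by
    rw [← Real.rpow_natCast, ← Real.rpow_mul (by norm_num), mul_comm, Real.rpow_mul (by norm_num)]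
    norm_num
  have h6 : (0 : ℝ) < 2 ^ α := by positivity
  rw [h1]
  set S := ∫ θ in Set.Ioo (0 : ℝ) (2 * Real.pi), (2 * Real.sin (θ / 2)) ^ (-α)
  set g := Real.Gamma ((1 - α) / 2)
  set G1 := Real.Gamma (1 - α)
  set G2 := Real.Gamma (1 - α / 2)
  set t := (2 : ℝ) ^ α
  have hpi : Real.sqrt Real.pi ^ 2 = Real.pi := Real.sq_sqrt Real.pi_pos.le
  rw [h5] at h3
  have h7 : g * g = t ^ 2 / 2 * S * G1 := by
    rw [← h3]; field_simp
  have h8 : (g * G2) ^ 2 = (G1 * t * Real.sqrt Real.pi) ^ 2 := by rw [h4]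
  have h9 : t ^ 2 * G1 * (S * G2 ^ 2) = t ^ 2 * G1 * (2 * Real.pi * G1) := by
    linear_combination 2 * h8 - 2 * G2 ^ 2 * h7 + 2 * G1 ^ 2 * t ^ 2 * hpi
  have h10 := mul_left_cancel₀ (by positivity) h9
  field_simp
  linear_combination h10

lemma Cconst_pos (hα0 : 0 < α) (hα1 : α < 1) : 0 < Cconst α := by
  unfold Cconst
  have h1 : 0 < Real.Gamma (α / 2) := Real.Gamma_pos_of_pos (by linarith)
  have h2 : 0 < Real.Gamma ((2 - α) / 2) := Real.Gamma_pos_of_pos (by linarith)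
  positivity

lemma Cconst_mul_moment (hα0 : 0 < α) (hα1 : α < 1) (k : ℕ) :
    Cconst α * moment α k =
      Real.Gamma (1 - α) / ((2 : ℝ) ^ (1 - α) * Real.Gamma (1 - α / 2) ^ 2) *
        (Real.Gamma (k + α / 2) / Real.Gamma (k + 1 - α / 2)) := by
  induction k with
  | zero =>
    have e : (2 - α) / 2 = 1 - α / 2 := by ring
    rw [Nat.cast_zero, moment_zero hα0 hα1, Cconst, e]
    have hG2 : 0 < Real.Gamma (1 - α / 2) := Real.Gamma_pos_of_pos (by linarith)
    simp only [Nat.cast_zero, zero_add]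
    field_simp
  | succ k ih =>
    have h := moment_succ hα0 hα1 k
    push_cast at h ⊢
    have hk : (0 : ℝ) ≤ k := k.cast_nonneg
    have hp : (0 : ℝ) < k + 1 - α / 2 := by linarith
    have hq : (0 : ℝ) < k + α / 2 := by linarith
    have e1 : (k : ℝ) + 1 + α / 2 = (k + α / 2) + 1 := by ring
    have e2 : (k : ℝ) + 1 + 1 - α / 2 = (k + 1 - α / 2) + 1 := by ring
    have h2 : moment α (k + 1) = (k + α / 2) * moment α k / (k + 1 - α / 2) := by
      rw [eq_div_iff hp.ne', mul_comm]; exact h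
    rw [e1, e2, Real.Gamma_add_one hq.ne', Real.Gamma_add_one hp.ne', h2, mul_div_assoc',
      mul_left_comm, ih]
    have := Real.Gamma_pos_of_pos hp
    field_simp

/-- The numbers `Ω_m` are the gaps in the spectrum of convolution with the Riesz kernel. -/
lemma Omega_eq (hα0 : 0 < α) (hα1 : α < 1) (m : ℕ) :
    Omega α m = Cconst α * (moment α 1 - moment α m) := by
  have h1 := Cconst_mul_moment hα0 hα1 1
  have h2 := Cconst_mul_moment hα0 hα1 m
  have e : ((1 : ℕ) : ℝ) + 1 - α / 2 = 2 - α / 2 := by push_cast; ring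
  rw [e] at h1
  push_cast at h1
  rw [mul_sub, h1, h2, Omega]
  ring

lemma moment_succ_eq (hα0 : 0 < α) (hα1 : α < 1) (k : ℕ) :
    moment α ((k + 1 : ℕ) : ℤ) = (k + α / 2) / (k + 1 - α / 2) * moment α k := by
  have h := moment_succ hα0 hα1 k
  have hk : (0 : ℝ) ≤ k := k.cast_nonneg
  have hp : (0 : ℝ) < k + 1 - α / 2 := by linarith
  push_cast at h ⊢
  rw [div_mul_eq_mul_div, eq_div_iff hp.ne', mul_comm]
  exact h

lemma moment_pos (hα0 : 0 < α) (hα1 : α < 1) (k : ℕ) : 0 < moment α k := by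
  induction k with
  | zero =>
    rw [Nat.cast_zero, moment_zero hα0 hα1]
    have hG1 : 0 < Real.Gamma (1 - α) := Real.Gamma_pos_of_pos (by linarith)
    have hG2 : 0 < Real.Gamma (1 - α / 2) := Real.Gamma_pos_of_pos (by linarith)
    positivity
  | succ k ih =>
    have hk : (0 : ℝ) ≤ k := k.cast_nonneg
    rw [moment_succ_eq hα0 hα1]
    exact mul_pos (div_pos (by linarith) (by linarith)) ih

lemma strictAnti_moment (hα0 : 0 < α) (hα1 : α < 1) : StrictAnti fun k : ℕ => moment α k := by
  refine strictAnti_nat_of_succ_lt fun k => ?_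
  have hk : (0 : ℝ) ≤ k := k.cast_nonneg
  rw [moment_succ_eq hα0 hα1]
  refine mul_lt_of_lt_one_left (moment_pos hα0 hα1 k) ?_
  rw [div_lt_one (by linarith)]
  linarith

/-- The moments decay like `k^{α - 1}`. -/
lemma moment_le (hα0 : 0 < α) (hα1 : α < 1) (k : ℕ) :
    moment α k ≤ moment α 0 * ((k : ℝ) + 1) ^ (-(1 - α)) := by
  induction k with
  | zero => simp
  | succ k ih =>
    have hk : (0 : ℝ) ≤ k := k.cast_nonneg
    have hp : (0 : ℝ) < k + 1 - α / 2 := by linarith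
    have h0 := (moment_pos hα0 hα1 0).le
    rw [Nat.cast_zero] at h0
    set δ := 1 - α with hδ
    have hy : (0 : ℝ) < k + 1 := by linarith
    -- the ratio of consecutive moments is compared with that of `(k + 1)^{-δ}` by Bernoulli's
    -- inequality
    have h1 : (k + α / 2) / (k + 1 - α / 2) ≤ 1 - δ / (k + 1) := by
      rw [div_le_iff₀ hp, ← sub_nonneg]
      have e : (1 - δ / ((k : ℝ) + 1)) * (k + 1 - α / 2) - (k + α / 2) =
          δ * (α / 2) / (k + 1) := by
        rw [hδ]; field_simp; ring
      rw [e]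
      have : 0 < δ := by linarith
      positivity
    have h2 : (1 - δ / ((k : ℝ) + 1)) * ((k : ℝ) + 1) ^ (-δ) ≤ ((k : ℝ) + 1 + 1) ^ (-δ) := by
      have hb := rpow_one_add_le_one_add_mul_self (s := 1 / ((k : ℝ) + 1))
        (p := δ) (by have : 0 ≤ 1 / ((k : ℝ) + 1) := by positivity
                     linarith) (by linarith) (by linarith)
      have e1 : ((k : ℝ) + 1 + 1) = (k + 1) * (1 + 1 / (k + 1)) := by field_simp
      have hpos : 0 < 1 + 1 / ((k : ℝ) + 1) := by positivity
      rw [e1, Real.mul_rpow hy.le hpos.le, mul_comm]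
      gcongr
      rw [Real.rpow_neg hpos.le, ← one_div, le_div_iff₀ (by positivity)]
      have e2 : δ * (1 / ((k : ℝ) + 1)) = δ / (k + 1) := by ring
      rw [e2] at hb
      have h3 : 0 ≤ 1 - δ / ((k : ℝ) + 1) := by
        rw [sub_nonneg, div_le_one hy]; linarith
      nlinarith [mul_le_mul_of_nonneg_left hb h3, sq_nonneg (δ / ((k : ℝ) + 1))]
    rw [moment_succ_eq hα0 hα1]
    have h4 : 0 ≤ 1 - δ / ((k : ℝ) + 1) := by
      rw [sub_nonneg, div_le_one hy]; linarith
    calc _ ≤ (1 - δ / ((k : ℝ) + 1)) * (moment α 0 * ((k : ℝ) + 1) ^ (-δ)) :=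
          mul_le_mul h1 ih (moment_pos hα0 hα1 k).le h4
      _ = moment α 0 * ((1 - δ / ((k : ℝ) + 1)) * ((k : ℝ) + 1) ^ (-δ)) := by ring
      _ ≤ moment α 0 * ((k : ℝ) + 1 + 1) ^ (-δ) := by gcongr
      _ = _ := by push_cast; rfl

/-! ### The linearization as a Fourier multiplier -/

lemma continuous_conj_comp {u : Circle → ℂ} (hu : Continuous u) :
    Continuous fun w => conj (u w) := Complex.continuous_conj.comp hu

lemma continuous_im_comp {u : Circle → ℂ} (hu : Continuous u) :
    Continuous fun w => ((u w).im : ℂ) :=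
  Complex.continuous_ofReal.comp (Complex.continuous_im.comp hu)

lemma coeff_im {u : Circle → ℂ} (hu : Continuous u) (k : ℤ) :
    coeff (fun w => ((u w).im : ℂ)) k = (coeff u k - conj (coeff u (-k))) / (2 * Complex.I) := by
  have e : (fun w => ((u w).im : ℂ)) =
      fun w => (2 * Complex.I)⁻¹ * (u w - conj (u w)) := by
    funext w
    rw [Complex.sub_conj]
    have := Complex.I_ne_zero
    push_cast
    field_simp
  rw [e, coeff_const_mul, coeff_sub' hu (continuous_conj_comp hu), coeff_conj]
  ring

lemma coeff_re {u : Circle → ℂ} (hu : Continuous u) (k : ℤ) :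
    coeff (fun w => ((u w).re : ℂ)) k = (coeff u k + conj (coeff u (-k))) / 2 := by
  have e : (fun w => ((u w).re : ℂ)) = fun w => (2 : ℂ)⁻¹ * (u w + conj (u w)) := by
    funext w
    rw [Complex.add_conj]
    push_cast
    ring
  rw [e, coeff_const_mul, coeff_add' hu (continuous_conj_comp hu), coeff_conj]
  ring

lemma conj_coe_eq_zpow (w : Circle) : conj (w : ℂ) = (w : ℂ) ^ (-1 : ℤ) := by
  rw [← Circle.coe_inv_eq_conj, Circle.coe_inv, zpow_neg_one]

lemma coeff_mul_conj (f : Circle → ℂ) (k : ℤ) :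
    coeff (fun w => f w * conj (w : ℂ)) k = coeff f (k + 1) := by
  have := coeff_zpow_mul (-1) f k
  rw [sub_neg_eq_add] at this
  rw [← this]
  congr 1
  funext w
  rw [conj_coe_eq_zpow, mul_comm]

lemma quot_mul_eq (f : Circle → ℂ) (s w : Circle) :
    quot f w (w * s) = (1 - (s : ℂ))⁻¹ * ((f w - f (w * s)) * conj (w : ℂ)) := by
  have e : (w : ℂ) - (w * s : Circle) = (1 - (s : ℂ)) * w := by
    rw [Circle.coe_mul]; ring
  have e2 : (w : ℂ)⁻¹ = conj (w : ℂ) := by rw [conj_coe_eq_zpow, zpow_neg_one]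
  rw [quot, e, div_eq_mul_inv, mul_inv, e2]
  ring

section

variable {f : Circle → ℂ} {N : ℝ}

lemma continuous_conj_coe : Continuous fun w : Circle => conj (w : ℂ) :=
  Complex.continuous_conj.comp continuous_coe

lemma continuous_comp_mul (hf : Continuous f) (s : Circle) : Continuous fun w => f (w * s) :=
  hf.comp (continuous_mul_const s)

lemma continuous_quot_mul (hf : Continuous f) (s : Circle) :
    Continuous fun w => quot f w (w * s) := by
  simp_rw [quot_mul_eq]
  exact continuous_const.mul ((hf.sub (continuous_comp_mul hf s)).mul continuous_conj_coe)

lemma coeff_quot_mul (hf : Continuous f) (s : Circle) (k : ℤ) :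
    coeff (fun w => quot f w (w * s)) k =
      (1 - (s : ℂ))⁻¹ * (1 - (s : ℂ) ^ (k + 1)) * coeff f (k + 1) := by
  simp_rw [quot_mul_eq]
  rw [coeff_const_mul, coeff_mul_conj, coeff_sub' hf (continuous_comp_mul hf s),
    coeff_comp_mul_right]
  ring

/-- The rotated linear symbol: `w̄` times the symbol at `(w, w s)`. -/
def rotSymbol (α : ℝ) (f : Circle → ℂ) (w s : Circle) : ℂ :=
  (s : ℂ) * (dw f (w * s) + (-α : ℂ) * ((quot f w (w * s)).re : ℂ))

lemma singInt_symbolLin_mul_conj (α : ℝ) (f : Circle → ℂ) (w : Circle) :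
    singInt α (symbolLin α f) w * conj (w : ℂ) =
      ∫ s : Circle, ((‖(s : ℂ) - 1‖ ^ (-α) : ℝ) : ℂ) * rotSymbol α f w s ∂haar := by
  rw [singInt_eq, ← integral_mul_const]
  congr 1
  funext s
  rw [symbolLin, rotSymbol, Circle.coe_mul]
  linear_combination ((‖(s : ℂ) - 1‖ ^ (-α) : ℝ) : ℂ) * s *
    (dw f (w * s) + (-α : ℂ) * ((quot f w (w * s)).re : ℂ)) * conj_mul_coe w

lemma continuous_rotSymbol (hf : Controlled α f N) (s : Circle) :
    Continuous fun w => rotSymbol α f w s :=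
  continuous_const.mul ((continuous_comp_mul hf.hol.2.1 s).add (continuous_const.mul
    (Complex.continuous_ofReal.comp (Complex.continuous_re.comp
      (continuous_quot_mul hf.hol.continuous s)))))

lemma coeff_rotSymbol (hf : Controlled α f N) (s : Circle) (k : ℤ) :
    coeff (fun w => rotSymbol α f w s) k = (s : ℂ) * ((s : ℂ) ^ k * ((k + 1) * coeff f (k + 1)) -
      α / 2 * ((1 - (s : ℂ))⁻¹ * (1 - (s : ℂ) ^ (k + 1)) * coeff f (k + 1) +
        conj ((1 - (s : ℂ))⁻¹ * (1 - (s : ℂ) ^ (-k + 1)) * coeff f (-k + 1)))) := by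
  have h1 := continuous_comp_mul hf.hol.2.1 s
  have h2 := continuous_quot_mul hf.hol.continuous s
  have h3 : Continuous fun w => (-α : ℂ) * ((quot f w (w * s)).re : ℂ) :=
    continuous_const.mul (Complex.continuous_ofReal.comp (Complex.continuous_re.comp h2))
  unfold rotSymbol
  rw [coeff_const_mul, coeff_add' h1 h3, coeff_const_mul, coeff_re h2, coeff_comp_mul_right,
    coeff_dw hf.hol, coeff_quot_mul hf.hol.continuous, coeff_quot_mul hf.hol.continuous]
  ring

/-- The integrand of the multiplier: the two frequencies `±(n + 1)` of the rotated symbol combine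
into a trigonometric polynomial in `s`. -/
lemma coeff_im_rotSymbol (hX : IsX α f) (hf : Controlled α f N) {s : Circle} (hs : s ≠ 1) (n : ℕ) :
    coeff (fun w => ((rotSymbol α f w s).im : ℂ)) (n + 1) =
      coeff f (-n) / (2 * Complex.I) * (n * (s : ℂ) ^ (n : ℤ) -
        α / 2 * ((s : ℂ) ^ (0 : ℤ) + (s : ℂ) ^ (1 : ℤ) - (s : ℂ) ^ (n : ℤ) -
          (s : ℂ) ^ ((n : ℤ) + 1))) := by
  have hb : conj (coeff f (-n)) = coeff f (-n) := Complex.conj_eq_iff_im.2 (hX.2.1 _)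
  have h0 : coeff f ((n : ℤ) + 1 + 1) = 0 := hX.2.2 _ (by omega)
  have e1 : -((n : ℤ) + 1) + 1 = -n := by ring
  rw [coeff_im (continuous_rotSymbol hf s), coeff_rotSymbol hf, coeff_rotSymbol hf, neg_neg, h0, e1]
  have hs0 : (s : ℂ) ≠ 0 := s.coe_ne_zero
  have hs1 : (s : ℂ) - 1 ≠ 0 := sub_ne_zero.2 fun h => hs (Circle.coe_eq_one.1 h)
  have hc : conj (s : ℂ) = (s : ℂ)⁻¹ := by rw [conj_coe_eq_zpow, zpow_neg_one]
  have hp : conj ((s : ℂ) ^ (-((n : ℤ) + 1))) = (s : ℂ) ^ n * s := by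
    rw [map_zpow₀, hc, inv_zpow', neg_neg, zpow_add_one₀ hs0, zpow_natCast]
  have hq : conj ((s : ℂ) ^ (-(n : ℤ))) = (s : ℂ) ^ n := by
    rw [map_zpow₀, hc, inv_zpow', neg_neg, zpow_natCast]
  simp only [map_mul, map_sub, map_inv₀, map_one, map_add, map_div₀, hc, hp, hq, hb, mul_zero,
    add_zero, Complex.conj_ofReal, map_ofNat, Int.cast_neg, Int.cast_add,
    Int.cast_natCast, Int.cast_one, map_neg, map_natCast, zero_sub, zpow_zero, zpow_one,
    zpow_natCast, zpow_add_one₀ hs0, map_zero, zero_add]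
  have h2 : (1 - (s : ℂ)⁻¹)⁻¹ = s / (s - 1) := by
    rw [inv_eq_iff_eq_inv, inv_div, sub_div, div_self hs0, one_div]
  rw [h2]
  have hI := Complex.I_ne_zero
  field_simp
  ring

lemma coeff_im_singInt (hα0 : 0 < α) (hα1 : α < 1) (hX : IsX α f) (hf : Controlled α f N) (n : ℕ) :
    coeff (fun w => ((singInt α (symbolLin α f) w * conj (w : ℂ)).im : ℂ)) (n + 1) =
      coeff f (-n) / (2 * Complex.I) * ((n * moment α n -
        α / 2 * (moment α 0 + moment α 1 - moment α n - moment α (n + 1)) : ℝ) : ℂ) := by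
  have hbd : ∀ w s, ‖rotSymbol α f w s‖ ≤ 6 * N := fun w s => by
    have h := (hf.isSymbol_lin hα0 hα1).bound w (w * s)
    have e : symbolLin α f w (w * s) = w * rotSymbol α f w s := by
      rw [symbolLin, rotSymbol, Circle.coe_mul]; ring
    rwa [e, norm_mul, Circle.norm_coe, one_mul] at h
  have hm : Measurable (Function.uncurry (rotSymbol α f)) := by
    have h1 : Measurable fun p : Circle × Circle => (p.1, p.1 * p.2) :=
      measurable_fst.prodMk (measurable_fst.mul measurable_snd)
    have h2 := continuous_coe.measurable
    exact (h2.comp measurable_snd).mul (((hf.hol.2.1.measurable).comp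
      (measurable_fst.mul measurable_snd)).add ((Complex.measurable_ofReal.comp
        (Complex.measurable_re.comp ((measurable_quot hf.hol.continuous).comp h1))).const_mul _))
  have hκ := integrable_rpow hα0 hα1
  have hint : ∀ w, Integrable (fun s : Circle =>
      ((‖(s : ℂ) - 1‖ ^ (-α) : ℝ) : ℂ) * rotSymbol α f w s) haar := fun w =>
    hκ.ofReal.mul_bdd (c := 6 * N) (hm.comp measurable_prodMk_left).aestronglyMeasurable
      (.of_forall fun s => hbd w s)
  have e1 : (fun w => ((singInt α (symbolLin α f) w * conj (w : ℂ)).im : ℂ)) = fun w =>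
      ∫ s : Circle, ((‖(s : ℂ) - 1‖ ^ (-α) : ℝ) : ℂ) * ((rotSymbol α f w s).im : ℂ) ∂haar := by
    funext w
    rw [singInt_symbolLin_mul_conj]
    have h := (integral_im (hint w))
    simp only [RCLike.im_to_complex, Complex.im_ofReal_mul] at h
    rw [← h, ← integral_complex_ofReal]
    simp only [Complex.ofReal_mul]
  have hm' : Measurable (Function.uncurry fun w s => ((rotSymbol α f w s).im : ℂ)) :=
    Complex.measurable_ofReal.comp (Complex.measurable_im.comp hm)
  rw [e1]
  refine (coeff_integral (κ := fun s : Circle => ((‖(s : ℂ) - 1‖ ^ (-α) : ℝ) : ℂ)) hκ.ofReal hm'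
    (B := 6 * N) (fun w s => by
      rw [Complex.norm_real]; exact (Complex.abs_im_le_norm _).trans (hbd w s)) _).trans ?_
  have e2 : ∀ s : Circle, ((‖(s : ℂ) - 1‖ ^ (-α) : ℝ) : ℂ) *
      coeff (fun w => ((rotSymbol α f w s).im : ℂ)) (n + 1) =
      coeff f (-n) / (2 * Complex.I) *
        (n * (((‖(s : ℂ) - 1‖ ^ (-α) : ℝ) : ℂ) * (s : ℂ) ^ (n : ℤ)) -
        α / 2 * (((‖(s : ℂ) - 1‖ ^ (-α) : ℝ) : ℂ) * (s : ℂ) ^ (0 : ℤ) +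
          ((‖(s : ℂ) - 1‖ ^ (-α) : ℝ) : ℂ) * (s : ℂ) ^ (1 : ℤ) -
          ((‖(s : ℂ) - 1‖ ^ (-α) : ℝ) : ℂ) * (s : ℂ) ^ (n : ℤ) -
          ((‖(s : ℂ) - 1‖ ^ (-α) : ℝ) : ℂ) * (s : ℂ) ^ ((n : ℤ) + 1))) := fun s => by
    rcases eq_or_ne s 1 with rfl | hs
    · simp [Real.zero_rpow (neg_ne_zero.2 hα0.ne')]
    · rw [coeff_im_rotSymbol hX hf hs]
      ring
  simp_rw [e2]
  set K : ℤ → Circle → ℂ := fun k s => ((‖(s : ℂ) - 1‖ ^ (-α) : ℝ) : ℂ) * (s : ℂ) ^ k with hK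
  have hi : ∀ k, Integrable (K k) haar := integrable_moment hα0 hα1
  have i1 : Integrable (fun s => K 0 s + K 1 s) haar := (hi 0).add (hi 1)
  have i2 : Integrable (fun s => K 0 s + K 1 s - K n s) haar := i1.sub (hi n)
  have i3 : Integrable (fun s => K 0 s + K 1 s - K n s - K (n + 1) s) haar := i2.sub (hi (n + 1))
  have hv : ∀ k, ∫ s, K k s ∂haar = moment α k := fun k => momentC_eq α k
  change ∫ s, coeff f (-n) / (2 * Complex.I) * (n * K n s -
    α / 2 * (K 0 s + K 1 s - K n s - K (n + 1) s)) ∂haar = _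
  rw [integral_const_mul, integral_sub ((hi n).const_mul _) (i3.const_mul _), integral_const_mul,
    integral_const_mul, integral_sub i2 (hi (n + 1)), integral_sub i1 (hi n),
    integral_add (hi 0) (hi 1), hv, hv, hv, hv]
  push_cast
  ring

/-- The recursion of the moments collapses the multiplier to a single difference. -/
lemma moment_combination (hα0 : 0 < α) (hα1 : α < 1) (n : ℕ) :
    n * moment α n - α / 2 * (moment α 0 + moment α 1 - moment α n - moment α (n + 1)) -
      n * moment α 1 = (n + 1) * (moment α (n + 1) - moment α 1) := by
  have h0 := moment_succ hα0 hα1 0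
  have hn := moment_succ hα0 hα1 n
  push_cast at h0 hn
  rw [zero_add] at h0
  linear_combination h0 - hn

/-- The linearization acts on the Fourier coefficients as the multiplier `(n+1)(Ω - Ω_{n+1}) / 2`,
with a shift of the frequency by one. -/
lemma coeff_im_linE (hα0 : 0 < α) (hα1 : α < 1) (hX : IsX α f) (hf : Controlled α f N) (Ω : ℝ)
    (n : ℕ) : coeff (fun w => ((linE α Ω f w).im : ℂ)) (n + 1) =
      Complex.I * (((n + 1) * (Ω - Omega α (n + 1)) / 2 : ℝ) : ℂ) * coeff f (-n) := by
  have hb : conj (coeff f (-n)) = coeff f (-n) := Complex.conj_eq_iff_im.2 (hX.2.1 _)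
  -- only one of the frequencies `±(n + 1)` contributes
  have h0 : coeff f ((n : ℤ) + 1 + 1) = 0 := hX.2.2 _ (by omega)
  have hv : Continuous fun w => conj (dw f w) := continuous_conj_comp hf.hol.2.1
  have hu1 : Continuous fun w => f w * conj (w : ℂ) := hf.hol.continuous.mul continuous_conj_coe
  have hu : Continuous fun w => f w * conj (w : ℂ) + conj (dw f w) := hu1.add hv
  have hH : Continuous fun w => singInt α (symbolLin α f) w * conj (w : ℂ) :=
    (((hf.isSymbol_lin hα0 hα1).hb_singInt hα0 hα1).continuous (by linarith)).mul
      continuous_conj_coe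
  have hv' := continuous_im_comp hv
  have hu' := continuous_im_comp hu
  have hH' := continuous_im_comp hH
  have e : (fun w => ((linE α Ω f w).im : ℂ)) = fun w =>
      (Ω : ℂ) * ((f w * conj (w : ℂ) + conj (dw f w)).im : ℂ) -
      (Cconst α : ℂ) * (((singInt α (symbolLin α f) w * conj (w : ℂ)).im : ℂ) +
        (moment α 1 : ℂ) * ((conj (dw f w)).im : ℂ)) := by
    funext w
    rw [linE, Complex.sub_im, Complex.im_ofReal_mul, Complex.im_ofReal_mul,
      Complex.add_im (singInt α (symbolLin α f) w * conj (w : ℂ)), Complex.im_ofReal_mul]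
    push_cast
    ring
  have k1 : -((n : ℤ) + 1) + 1 = -n := by ring
  have c1 : coeff (fun w => ((conj (dw f w)).im : ℂ)) (n + 1) =
      coeff f (-n) / (2 * Complex.I) * (-n) := by
    rw [coeff_im hv, coeff_conj, coeff_conj, coeff_dw hf.hol, coeff_dw hf.hol, neg_neg, h0, k1]
    simp only [map_mul, hb, map_add, map_intCast, map_one, mul_zero, map_zero]
    push_cast
    ring
  have c2 : coeff (fun w => ((f w * conj (w : ℂ) + conj (dw f w)).im : ℂ)) (n + 1) =
      coeff f (-n) / (2 * Complex.I) * (-(n + 1)) := by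
    rw [coeff_im hu, coeff_add' hu1 hv, coeff_add' hu1 hv, coeff_mul_conj, coeff_mul_conj,
      coeff_conj, coeff_conj, coeff_dw hf.hol, coeff_dw hf.hol, neg_neg, h0, k1]
    simp only [map_mul, hb, map_add, map_intCast, map_one, mul_zero, map_zero]
    push_cast
    ring
  have hr := moment_combination hα0 hα1 n
  have hO := Omega_eq hα0 hα1 (n + 1)
  push_cast at hO
  have d1 : Continuous fun w => (Ω : ℂ) * ((f w * conj (w : ℂ) + conj (dw f w)).im : ℂ) :=
    continuous_const.mul hu'
  have d2 : Continuous fun w => (moment α 1 : ℂ) * ((conj (dw f w)).im : ℂ) :=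
    continuous_const.mul hv'
  have d3 : Continuous fun w => (Cconst α : ℂ) * (((singInt α (symbolLin α f) w *
      conj (w : ℂ)).im : ℂ) + (moment α 1 : ℂ) * ((conj (dw f w)).im : ℂ)) :=
    continuous_const.mul (hH'.add d2)
  rw [e, coeff_sub' d1 d3, coeff_const_mul, coeff_const_mul,
    coeff_add' hH' d2, coeff_const_mul, c1, c2,
    coeff_im_singInt hα0 hα1 hX hf, hO]
  have hr' : ((n * moment α n - α / 2 * (moment α 0 + moment α 1 - moment α n -
      moment α (n + 1)) : ℝ) : ℂ) =
      (((n + 1) * (moment α (n + 1) - moment α 1) + n * moment α 1 : ℝ) : ℂ) := by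
    congr 1; linarith
  rw [hr', div_eq_mul_inv, mul_inv, Complex.inv_I]
  push_cast
  ring

end

/-! ### Fourier multipliers on Hölder spaces -/

/-- `m` is a Fourier multiplier of the Hölder class `C^γ` of the circle. -/
def IsMultiplier (γ : ℝ) (m : ℤ → ℂ) : Prop :=
  ∀ g A, HB γ g A → ∃ h B, HB γ h B ∧ ∀ n, coeff h n = m n * coeff g n

namespace IsMultiplier

variable {γ : ℝ} {m₁ m₂ : ℤ → ℂ}

lemma const (c : ℂ) : IsMultiplier γ fun _ => c := fun g _ hg =>
  ⟨_, _, hg.const_mul c, fun n => coeff_const_mul c g n⟩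

lemma mul (h₁ : IsMultiplier γ m₁) (h₂ : IsMultiplier γ m₂) :
    IsMultiplier γ fun n => m₁ n * m₂ n := fun g A hg => by
  obtain ⟨h, B, hB, hc⟩ := h₂ g A hg
  obtain ⟨k, C, hC, hd⟩ := h₁ h B hB
  exact ⟨k, C, hC, fun n => by rw [hd, hc, mul_assoc]⟩

lemma add (hγ : 0 < γ) (h₁ : IsMultiplier γ m₁) (h₂ : IsMultiplier γ m₂) :
    IsMultiplier γ fun n => m₁ n + m₂ n := fun g A hg => by
  obtain ⟨h, B, hB, hc⟩ := h₁ g A hg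
  obtain ⟨k, C, hC, hd⟩ := h₂ g A hg
  exact ⟨_, _, hB.add hC, fun n => by
    rw [coeff_add' (hB.continuous hγ) (hC.continuous hγ), hc, hd, add_mul]⟩

lemma pow (h : IsMultiplier γ m₁) (j : ℕ) : IsMultiplier γ fun n => m₁ n ^ j := by
  induction j with
  | zero => simpa using const 1
  | succ j ih => simpa only [pow_succ] using ih.mul h

lemma sum (hγ : 0 < γ) {m : ℕ → ℤ → ℂ} (h : ∀ j, IsMultiplier γ (m j)) (J : ℕ) :
    IsMultiplier γ fun n => ∑ j ∈ Finset.range J, m j n := by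
  induction J with
  | zero => simpa using const 0
  | succ J ih => simpa only [Finset.sum_range_succ] using ih.add hγ (h J)

/-- Convolution with an integrable kernel commutes with rotations, hence is a multiplier. -/
lemma of_integrable (hγ : 0 < γ) {κ : Circle → ℂ} (hκ : Integrable κ haar) :
    IsMultiplier γ fun n => ∫ s : Circle, κ s * (s : ℂ) ^ n ∂haar := by
  intro g A hg
  have hgc := hg.continuous hγ
  have hA := hg.nonneg
  have hi : ∀ w, Integrable (fun s => κ s * g (w * s)) haar := fun w =>
    hκ.mul_bdd (c := A) (hgc.comp (continuous_const_mul w)).aestronglyMeasurable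
      (.of_forall fun s => hg.bound _)
  refine ⟨fun w => ∫ s, κ s * g (w * s) ∂haar, (∫ s, ‖κ s‖ ∂haar) * A, ⟨fun w => ?_,
    fun w₁ w₂ => ?_⟩, fun n => ?_⟩
  · rw [← integral_mul_const]
    refine norm_integral_le_of_norm_le (hκ.norm.mul_const A) (.of_forall fun s => ?_)
    rw [norm_mul]
    gcongr
    exact hg.bound _
  · rw [← integral_sub (hi w₁) (hi w₂), mul_assoc, ← integral_mul_const]
    refine norm_integral_le_of_norm_le (hκ.norm.mul_const _) (.of_forall fun s => ?_)
    rw [← mul_sub, norm_mul]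
    gcongr
    refine (hg.diff _ _).trans (le_of_eq ?_)
    rw [Circle.coe_mul, Circle.coe_mul, ← sub_mul, norm_mul, Circle.norm_coe, mul_one]
  · have hm : Measurable (Function.uncurry fun w s : Circle => g (w * s)) :=
      hgc.measurable.comp (measurable_fst.mul measurable_snd)
    rw [coeff_integral hκ hm (fun w s => hg.bound (w * s)), ← integral_mul_const]
    congr 1
    funext s
    rw [coeff_comp_mul_right, mul_assoc]

end IsMultiplier

lemma integral_zpow (k : ℤ) : ∫ s : Circle, (s : ℂ) ^ k ∂haar = if k = 0 then 1 else 0 := by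
  have h := coeff_zpow k 0
  rw [coeff_eq_integral] at h
  simp only [neg_zero, zpow_zero, one_mul] at h
  rw [h]
  simp only [eq_comm]

/-- Absolutely summable sequences are multipliers: they are the Fourier coefficients of a
continuous kernel. -/
lemma IsMultiplier.of_summable {γ : ℝ} (hγ : 0 < γ) {r : ℤ → ℂ} (hr : Summable fun n => ‖r n‖) :
    IsMultiplier γ r := by
  have hn : ∀ (s : Circle) (k : ℤ), ‖r k * (s : ℂ) ^ (-k)‖ = ‖r k‖ := fun s k => by
    rw [norm_mul, norm_zpow_coe, mul_one]
  have hκ : Continuous fun s : Circle => ∑' k, r k * (s : ℂ) ^ (-k) :=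
    continuous_tsum (fun k => continuous_const.mul (continuous_zpow_coe _)) hr
      fun k s => (hn s k).le
  have h := IsMultiplier.of_integrable hγ (integrable_of_continuous hκ)
  convert h using 1
  funext n
  have e : ∀ s : Circle, (∑' k, r k * (s : ℂ) ^ (-k)) * (s : ℂ) ^ n =
      ∑' k, r k * (s : ℂ) ^ (n - k) := fun s => by
    rw [← tsum_mul_right]
    congr 1
    funext k
    rw [mul_assoc, ← zpow_add₀ s.coe_ne_zero, neg_add_eq_sub]
  simp_rw [e]
  have hi : ∀ k, ∫ s : Circle, r k * (s : ℂ) ^ (n - k) ∂haar = if k = n then r n else 0 :=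
    fun k => by
    rw [integral_const_mul, integral_zpow]
    rcases eq_or_ne k n with rfl | hk
    · simp
    · rw [if_neg (sub_ne_zero.2 hk.symm), if_neg hk, mul_zero]
  rw [← integral_tsum_of_summable_integral_norm (F := fun k (s : Circle) => r k * (s : ℂ) ^ (n - k))
    (fun k => integrable_of_continuous (continuous_const.mul (continuous_zpow_coe _)))]
  · simp_rw [hi]
    rw [tsum_ite_eq]
  · refine hr.congr fun k => ?_
    have : ∀ s : Circle, ‖r k * (s : ℂ) ^ (n - k)‖ = ‖r k‖ := fun s => by
      rw [norm_mul, norm_zpow_coe, mul_one]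
    simp_rw [this]
    simp

/-- Convolution with the Riesz kernel. -/
lemma isMultiplier_moment {γ : ℝ} (hγ : 0 < γ) (hα0 : 0 < α) (hα1 : α < 1) :
    IsMultiplier γ fun n => (moment α n : ℂ) := by
  have h := IsMultiplier.of_integrable hγ (integrable_rpow hα0 hα1).ofReal
  refine (congrArg (IsMultiplier γ) (funext fun n => ?_)).mp h
  exact momentC_eq α n

/-! ### The conjugation operator on Hölder spaces -/

/-- The conjugation kernel `(τ + w) / (τ - w)`. -/
def hilbKer (w τ : Circle) : ℂ := ((τ : ℂ) + w) / ((τ : ℂ) - w)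

lemma norm_hilbKer_le (w τ : Circle) : ‖hilbKer w τ‖ ≤ 2 / ‖(w : ℂ) - τ‖ := by
  rw [hilbKer, norm_div, norm_sub_rev (τ : ℂ)]
  gcongr
  refine (norm_add_le _ _).trans ?_
  rw [Circle.norm_coe, Circle.norm_coe]
  norm_num

lemma hilbKer_mul (w s : Circle) : hilbKer w (w * s) = hilbKer 1 s := by
  have hw := w.coe_ne_zero
  have e1 : (w : ℂ) * s + w = w * (s + 1) := by ring
  have e2 : (w : ℂ) * s - w = w * (s - 1) := by ring
  rw [hilbKer, hilbKer, Circle.coe_mul, Circle.coe_one, e1, e2, mul_div_mul_left _ _ hw]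

lemma hilbKer_one_inv (s : Circle) : hilbKer 1 s⁻¹ = -hilbKer 1 s := by
  rw [hilbKer, hilbKer, Circle.coe_one, Circle.coe_inv]
  have hs := s.coe_ne_zero
  have e1 : (s : ℂ)⁻¹ + 1 = (s : ℂ)⁻¹ * (s + 1) := by field_simp; ring
  have e2 : (s : ℂ)⁻¹ - 1 = (s : ℂ)⁻¹ * (-(s - 1)) := by field_simp; ring
  rw [e1, e2, mul_div_mul_left _ _ (inv_ne_zero hs), div_neg]

lemma measurable_hilbKer (w : Circle) : Measurable (hilbKer w) := by
  have := continuous_coe.measurable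
  exact (this.add_const _).div (this.sub_const _)

/-- The conjugation operator `g ↦ ∫ (g(τ) - g(w)) (τ + w) / (τ - w) dτ`. -/
def hilb (g : Circle → ℂ) (w : Circle) : ℂ := ∫ τ, (g τ - g w) * hilbKer w τ ∂haar

section hilb

variable {g : Circle → ℂ} {A : ℝ}

lemma norm_hilb_integrand_le (hα0 : 0 < α) (hg : HB (1 - α) g A) (w τ : Circle) :
    ‖(g τ - g w) * hilbKer w τ‖ ≤ 2 * A * ‖(w : ℂ) - τ‖ ^ (-α) := by
  have hA := hg.nonneg
  rcases eq_or_ne w τ with rfl | h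
  · simp [Real.zero_rpow (neg_ne_zero.2 hα0.ne')]
  · have hpos : 0 < ‖(w : ℂ) - τ‖ :=
      norm_pos_iff.2 (sub_ne_zero.2 fun h' => h (Circle.ext h'))
    have h1 := hg.diff τ w
    rw [norm_sub_rev (τ : ℂ)] at h1
    rw [norm_mul]
    calc _ ≤ A * ‖(w : ℂ) - τ‖ ^ (1 - α) * (2 / ‖(w : ℂ) - τ‖) := by
          gcongr
          exact norm_hilbKer_le w τ
      _ = _ := by
          rw [sub_eq_add_neg 1 α, Real.rpow_add hpos, Real.rpow_one]
          field_simp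

lemma integrable_hilb (hα0 : 0 < α) (hα1 : α < 1) (hg : HB (1 - α) g A) (w : Circle) :
    Integrable (fun τ => (g τ - g w) * hilbKer w τ) haar := by
  have hgc := hg.continuous (by linarith)
  refine Integrable.mono' ((integrable_comp_dist (k := fun r => r ^ (-α))
    (integrable_rpow hα0 hα1) w).const_mul (2 * A))
    ((hgc.measurable.sub_const _).mul (measurable_hilbKer w)).aestronglyMeasurable
    (.of_forall fun τ => norm_hilb_integrand_le hα0 hg w τ)

/-- The kernel is odd, so its truncations have mean zero. -/
lemma integral_indicator_hilbKer (w : Circle) (δ : ℝ) :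
    ∫ τ, (if δ < ‖(w : ℂ) - τ‖ then hilbKer w τ else 0) ∂haar = 0 := by
  have h1 : ∫ τ, (if δ < ‖(w : ℂ) - τ‖ then hilbKer w τ else 0) ∂haar =
      ∫ s, (if δ < ‖(s : ℂ) - 1‖ then hilbKer 1 s else 0) ∂haar := by
    rw [← integral_mul_left_eq_self _ w]
    congr 1
    funext s
    rw [hilbKer_mul, norm_coe_sub_coe, inv_mul_cancel_left]
  have h2 := integral_inv_eq_self
    (fun s : Circle => if δ < ‖(s : ℂ) - 1‖ then hilbKer 1 s else 0) haar
  have h3 : ∀ s : Circle, (if δ < ‖((s⁻¹ : Circle) : ℂ) - 1‖ then hilbKer 1 s⁻¹ else 0) =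
      -(if δ < ‖(s : ℂ) - 1‖ then hilbKer 1 s else 0) := fun s => by
    rw [norm_inv_sub_one, hilbKer_one_inv]
    split_ifs <;> simp
  simp_rw [h3] at h2
  rw [integral_neg] at h2
  rw [h1]
  linear_combination -h2 / 2

lemma hilbKer_sub {w₁ w₂ τ : Circle} (h₁ : w₁ ≠ τ) (h₂ : w₂ ≠ τ) :
    ‖hilbKer w₁ τ - hilbKer w₂ τ‖ =
      2 * ‖(w₁ : ℂ) - w₂‖ / (‖(w₁ : ℂ) - τ‖ * ‖(w₂ : ℂ) - τ‖) := by
  have n1 : (τ : ℂ) - w₁ ≠ 0 := sub_ne_zero.2 fun h => h₁ (Circle.ext h.symm)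
  have n2 : (τ : ℂ) - w₂ ≠ 0 := sub_ne_zero.2 fun h => h₂ (Circle.ext h.symm)
  have e : hilbKer w₁ τ - hilbKer w₂ τ =
      2 * τ * ((w₁ : ℂ) - w₂) / (((τ : ℂ) - w₁) * ((τ : ℂ) - w₂)) := by
    rw [hilbKer, hilbKer]
    field_simp
    ring
  rw [e, norm_div, norm_mul, norm_mul, norm_mul, Circle.norm_coe, norm_sub_rev (τ : ℂ) w₁,
    norm_sub_rev (τ : ℂ) w₂]
  simp

/-- After removal of the truncated kernel the increment of the integrand is dominated by `kern`. -/
lemma norm_hilb_diff_le (hα0 : 0 < α) (hg : HB (1 - α) g A) {w₁ w₂ : Circle} (hw : w₁ ≠ w₂)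
    (τ : Circle) :
    ‖(g τ - g w₁) * hilbKer w₁ τ - (g τ - g w₂) * hilbKer w₂ τ -
      (g w₂ - g w₁) * (if 2 * ‖(w₁ : ℂ) - w₂‖ < ‖(w₂ : ℂ) - τ‖ then hilbKer w₂ τ else 0)‖ ≤
    6 * A * (kern α ‖(w₁ : ℂ) - w₂‖ ‖(w₁ : ℂ) - τ‖ +
        kern α ‖(w₁ : ℂ) - w₂‖ ‖(w₂ : ℂ) - τ‖) := by
  have hA := hg.nonneg
  have hd : 0 < ‖(w₁ : ℂ) - w₂‖ := norm_pos_iff.2 (sub_ne_zero.2 fun h => hw (Circle.ext h))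
  have hab : ‖(w₁ : ℂ) - τ‖ ≤ ‖(w₁ : ℂ) - w₂‖ + ‖(w₂ : ℂ) - τ‖ :=
    norm_sub_le_norm_sub_add_norm_sub ..
  have hba : ‖(w₂ : ℂ) - τ‖ ≤ ‖(w₁ : ℂ) - w₂‖ + ‖(w₁ : ℂ) - τ‖ := by
    rw [norm_sub_rev (w₁ : ℂ) w₂]
    exact norm_sub_le_norm_sub_add_norm_sub ..
  have hF1 := norm_hilb_integrand_le hα0 hg w₁ τ
  have hF2 := norm_hilb_integrand_le hα0 hg w₂ τ
  have hk1 := kern_nonneg (α := α) hd.le (norm_nonneg ((w₁ : ℂ) - τ))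
  have hk2 := kern_nonneg (α := α) hd.le (norm_nonneg ((w₂ : ℂ) - τ))
  -- a point within distance `3 d` of the singularity does not feel the cut-off in `kern`
  have hnear : ∀ r : ℝ, 0 ≤ r → r ≤ 3 * ‖(w₁ : ℂ) - w₂‖ →
      r ^ (-α) ≤ 3 * kern α ‖(w₁ : ℂ) - w₂‖ r := fun r hr0 hr => by
    rcases hr0.eq_or_lt with rfl | h
    · rw [Real.zero_rpow (neg_ne_zero.2 hα0.ne')]
      exact mul_nonneg (by norm_num) (kern_nonneg hd.le le_rfl)
    · have h1 : 1 / 3 ≤ min 1 (‖(w₁ : ℂ) - w₂‖ / r) :=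
        le_min (by norm_num) (by rw [div_le_div_iff₀ (by norm_num) h]; linarith)
      have h2 : 0 < r ^ (-α) := by positivity
      unfold kern
      nlinarith
  split_ifs with hfar
  · have hb : 0 < ‖(w₂ : ℂ) - τ‖ := by linarith
    have ha : 0 < ‖(w₁ : ℂ) - τ‖ := by linarith
    have n1 : w₁ ≠ τ := fun h => by rw [h, sub_self, norm_zero] at ha; exact lt_irrefl _ ha
    have n2 : w₂ ≠ τ := fun h => by rw [h, sub_self, norm_zero] at hb; exact lt_irrefl _ hb
    have e : (g τ - g w₁) * hilbKer w₁ τ - (g τ - g w₂) * hilbKer w₂ τ -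
        (g w₂ - g w₁) * hilbKer w₂ τ = (g τ - g w₁) * (hilbKer w₁ τ - hilbKer w₂ τ) := by ring
    have h1 := hg.diff τ w₁
    rw [norm_sub_rev (τ : ℂ)] at h1
    rw [e, norm_mul, hilbKer_sub n1 n2]
    set a := ‖(w₁ : ℂ) - τ‖
    set b := ‖(w₂ : ℂ) - τ‖
    set d := ‖(w₁ : ℂ) - w₂‖
    have h2 : d / b ≤ 3 / 2 * (d / a) := by
      rw [div_le_iff₀ hb]
      have : 3 / 2 * (d / a) * b = d * (3 / 2 * b / a) := by ring
      rw [this]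
      refine le_mul_of_one_le_right hd.le ?_
      rw [one_le_div ha]
      linarith
    have h3 : kern α d a = a ^ (-α) * (d / a) := by
      unfold kern
      rw [min_eq_right ((div_le_one ha).2 (by linarith))]
    have h4 : 0 ≤ a ^ (-α) := by positivity
    calc _ ≤ A * a ^ (1 - α) * (2 * d / (a * b)) := by gcongr
      _ = 2 * A * a ^ (-α) * (d / b) := by
          rw [sub_eq_add_neg 1 α, Real.rpow_add ha, Real.rpow_one]
          field_simp
      _ ≤ 2 * A * a ^ (-α) * (3 / 2 * (d / a)) := by gcongr
      _ = 3 * A * kern α d a := by rw [h3]; ring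
      _ ≤ _ := by nlinarith [mul_nonneg hA hk1, mul_nonneg hA hk2]
  · rw [mul_zero, sub_zero]
    have hfar' := not_lt.1 hfar
    have h1 := hnear _ (norm_nonneg ((w₁ : ℂ) - τ)) (by linarith)
    have h2 := hnear _ (norm_nonneg ((w₂ : ℂ) - τ)) (by linarith)
    refine (norm_sub_le _ _).trans ?_
    nlinarith [mul_le_mul_of_nonneg_left h1 hA, mul_le_mul_of_nonneg_left h2 hA]

/-- Privalov's theorem: the conjugation operator preserves Hölder classes. -/
lemma hb_hilb (hα0 : 0 < α) (hα1 : α < 1) (hg : HB (1 - α) g A) :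
    HB (1 - α) (hilb g) (12 * A * singConst α) := by
  have hA := hg.nonneg
  have hr := riesz_nonneg α
  have hk := kernConst_nonneg α
  refine ⟨fun w => ?_, fun w₁ w₂ => ?_⟩
  · have h1 := norm_integral_le_of_norm_le ((integrable_comp_dist (k := fun r => r ^ (-α))
      (integrable_rpow hα0 hα1) w).const_mul (2 * A))
      (.of_forall fun τ => norm_hilb_integrand_le hα0 hg w τ)
    rw [integral_const_mul, integral_comp_dist (fun r => r ^ (-α))] at h1
    refine h1.trans ?_
    change 2 * A * riesz α ≤ _
    unfold singConst
    nlinarith [mul_nonneg hA hr, mul_nonneg hA hk]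
  · rcases eq_or_ne w₁ w₂ with rfl | hw
    · rw [sub_self, norm_zero]
      have := singConst_nonneg α
      positivity
    · have hd : 0 < ‖(w₁ : ℂ) - w₂‖ :=
        norm_pos_iff.2 (sub_ne_zero.2 fun h => hw (Circle.ext h))
      have h1 := norm_integral_le_of_le_kern hα0 hα1 (by positivity) hw
        (norm_hilb_diff_le hα0 hg hw)
      have hi := integrable_hilb hα0 hα1 hg
      have hi3 : Integrable (fun τ : Circle =>
          if 2 * ‖(w₁ : ℂ) - w₂‖ < ‖(w₂ : ℂ) - τ‖ then hilbKer w₂ τ else 0) haar := by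
        have hm : Measurable fun τ : Circle => ‖(w₂ : ℂ) - τ‖ :=
          (continuous_const.sub continuous_coe).norm.measurable
        refine Integrable.of_bound (Measurable.ite (measurableSet_lt measurable_const hm)
          (measurable_hilbKer w₂) measurable_const).aestronglyMeasurable
          (2 / (2 * ‖(w₁ : ℂ) - w₂‖)) (.of_forall fun τ => ?_)
        split_ifs with h
        · refine (norm_hilbKer_le w₂ τ).trans ?_
          gcongr
        · rw [norm_zero]; positivity
      have i12 : Integrable (fun τ => (g τ - g w₁) * hilbKer w₁ τ - (g τ - g w₂) * hilbKer w₂ τ)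
        haar := (hi w₁).sub (hi w₂)
      rw [integral_sub i12 (hi3.const_mul _), integral_sub (hi w₁) (hi w₂), integral_const_mul,
        integral_indicator_hilbKer, mul_zero, sub_zero] at h1
      refine h1.trans (mul_le_mul_of_nonneg_right ?_ (by positivity))
      unfold singConst
      nlinarith [mul_nonneg hA hr, mul_nonneg hA hk]

/-- The symbol of the conjugation operator. -/
def hilbSymbol (n : ℤ) : ℂ := ∫ s : Circle, ((s : ℂ) ^ n - 1) * hilbKer 1 s ∂haar

lemma hilbSymbol_neg (n : ℤ) : hilbSymbol (-n) = -hilbSymbol n := by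
  have h := integral_inv_eq_self
    (fun s : Circle => ((s : ℂ) ^ n - 1) * hilbKer 1 s) haar
  rw [hilbSymbol, hilbSymbol, ← h, ← integral_neg]
  congr 1
  funext s
  rw [hilbKer_one_inv, Circle.coe_inv, inv_zpow, zpow_neg]
  ring

/-- `(s^{n+1} - 1)(s + 1) / (s - 1)` is a trigonometric polynomial with constant term `1`. -/
lemma hilbSymbol_succ (n : ℕ) : hilbSymbol (n + 1) = 1 := by
  have h1 : ∀ s : Circle, s ≠ 1 → ((s : ℂ) ^ ((n : ℤ) + 1) - 1) * hilbKer 1 s =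
      ∑ j ∈ Finset.range (n + 1), ((s : ℂ) ^ ((j : ℤ) + 1) + (s : ℂ) ^ (j : ℤ)) := fun s hs => by
    have hs1 : (s : ℂ) - 1 ≠ 0 := sub_ne_zero.2 fun h => hs (Circle.coe_eq_one.1 h)
    have h2 := mul_geom_sum (s : ℂ) (n + 1)
    have e : ((s : ℂ) ^ ((n : ℤ) + 1)) = (s : ℂ) ^ (n + 1) := by norm_cast
    rw [hilbKer, Circle.coe_one, e, ← h2]
    simp_rw [zpow_add_one₀ s.coe_ne_zero, zpow_natCast, ← mul_add_one]
    rw [← Finset.sum_mul]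
    field_simp
  have h2 : hilbSymbol (n + 1) = ∫ s : Circle,
      ∑ j ∈ Finset.range (n + 1), ((s : ℂ) ^ ((j : ℤ) + 1) + (s : ℂ) ^ (j : ℤ)) ∂haar := by
    refine integral_congr_ae ?_
    filter_upwards [Measure.ae_ne haar (1 : Circle)] with s hs using h1 s hs
  have hi : ∀ k : ℤ, Integrable (fun s : Circle => (s : ℂ) ^ k) haar :=
    fun k => integrable_of_continuous (continuous_zpow_coe k)
  have hij : ∀ j : ℕ, Integrable (fun s : Circle => (s : ℂ) ^ ((j : ℤ) + 1) + (s : ℂ) ^ (j : ℤ))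
      haar := fun j => (hi _).add (hi _)
  rw [h2, integral_finsetSum _ fun j _ => hij j]
  have h3 : ∀ j : ℕ, ∫ s : Circle, ((s : ℂ) ^ ((j : ℤ) + 1) + (s : ℂ) ^ (j : ℤ)) ∂haar =
      if j = 0 then 1 else 0 := fun j => by
    rw [integral_add (hi _) (hi _), integral_zpow, integral_zpow, if_neg (by omega), zero_add]
    simp
  simp_rw [h3]
  simp

/-- The integrand of `hilb` is written as the weight `|s - 1|^{-α}` times a bounded function, so
that `coeff_integral` applies. -/
lemma coeff_hilb (hα0 : 0 < α) (hα1 : α < 1) (hg : HB (1 - α) g A) (n : ℤ) :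
    coeff (hilb g) n = hilbSymbol n * coeff g n := by
  have hgc := hg.continuous (by linarith)
  set Ψ : Circle → Circle → ℂ := fun w s =>
    ((‖(s : ℂ) - 1‖ ^ α : ℝ) : ℂ) * ((g (w * s) - g w) * hilbKer 1 s) with hΨ
  have hκ := (integrable_rpow hα0 hα1).ofReal (𝕜 := ℂ)
  have h0 : ∀ s : Circle, s ≠ 1 →
      ((‖(s : ℂ) - 1‖ ^ (-α) : ℝ) : ℂ) * ((‖(s : ℂ) - 1‖ ^ α : ℝ) : ℂ) = 1 := fun s hs => by
    have : 0 < ‖(s : ℂ) - 1‖ := norm_pos_iff.2 (sub_ne_zero.2 fun h => hs (Circle.coe_eq_one.1 h))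
    rw [← Complex.ofReal_mul, ← Real.rpow_add this]
    simp
  have hbound : ∀ w s, ‖Ψ w s‖ ≤ 2 * A := fun w s => by
    have h := norm_hilb_integrand_le hα0 hg w (w * s)
    rw [hilbKer_mul, norm_coe_sub_coe, inv_mul_cancel_left] at h
    rw [hΨ, norm_mul, Complex.norm_real, Real.norm_of_nonneg (by positivity)]
    rcases eq_or_ne s 1 with rfl | hs
    · simpa using hg.nonneg
    · have hp : 0 < ‖(s : ℂ) - 1‖ :=
        norm_pos_iff.2 (sub_ne_zero.2 fun h => hs (Circle.coe_eq_one.1 h))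
      calc _ ≤ ‖(s : ℂ) - 1‖ ^ α * (2 * A * ‖(s : ℂ) - 1‖ ^ (-α)) := by gcongr
        _ = 2 * A * (‖(s : ℂ) - 1‖ ^ α * ‖(s : ℂ) - 1‖ ^ (-α)) := by ring
        _ = 2 * A := by rw [← Real.rpow_add hp]; simp
  have hm : Measurable (Function.uncurry Ψ) := by
    have h1 : Measurable fun s : Circle => ((‖(s : ℂ) - 1‖ ^ α : ℝ) : ℂ) :=
      Complex.measurable_ofReal.comp (measurable_norm_coe_sub_one.pow_const _)
    exact (h1.comp measurable_snd).mul (((hgc.measurable.comp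
      (measurable_fst.mul measurable_snd)).sub (hgc.measurable.comp measurable_fst)).mul
      ((measurable_hilbKer 1).comp measurable_snd))
  have e1 : hilb g = fun w => ∫ s : Circle, ((‖(s : ℂ) - 1‖ ^ (-α) : ℝ) : ℂ) * Ψ w s ∂haar := by
    funext w
    rw [hilb, ← integral_mul_left_eq_self _ w]
    congr 1
    funext s
    rw [hilbKer_mul]
    rcases eq_or_ne s 1 with rfl | hs
    · simp [hΨ]
    · rw [hΨ, ← mul_assoc, h0 s hs, one_mul]
  rw [e1]
  refine (coeff_integral (κ := fun s : Circle => ((‖(s : ℂ) - 1‖ ^ (-α) : ℝ) : ℂ)) hκ hm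
    hbound n).trans ?_
  rw [hilbSymbol, ← integral_mul_const]
  congr 1
  funext s
  have e2 : (fun w => Ψ w s) = fun w => (((‖(s : ℂ) - 1‖ ^ α : ℝ) : ℂ) * hilbKer 1 s) *
      (g (w * s) - g w) := by
    funext w
    rw [hΨ]
    ring
  rw [e2, coeff_const_mul, coeff_sub' (continuous_comp_mul hgc s) hgc, coeff_comp_mul_right]
  rcases eq_or_ne s 1 with rfl | hs
  · simp
  · linear_combination (hilbKer 1 s * ((s : ℂ) ^ n * coeff g n - coeff g n)) * h0 s hs

end hilb

/-- The projection onto the negative frequencies is a multiplier of `C^{1-α}`. -/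
lemma isMultiplier_neg (hα0 : 0 < α) (hα1 : α < 1) :
    IsMultiplier (1 - α) fun n => if n < 0 then 1 else 0 := by
  have hγ : 0 < 1 - α := by linarith
  have h1 : IsMultiplier (1 - α) hilbSymbol := fun g A hg =>
    ⟨_, _, hb_hilb hα0 hα1 hg, coeff_hilb hα0 hα1 hg⟩
  have h2 : IsMultiplier (1 - α) fun n => if n = 0 then (-1 / 2 : ℂ) else 0 := by
    refine IsMultiplier.of_summable hγ (summable_of_ne_finset_zero (s := {0}) fun n hn => ?_)
    rw [Finset.mem_singleton] at hn
    simp [hn]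
  -- the indicator is `1/2 - 1/2 sign(n)`, corrected at `n = 0`
  have h3 := ((IsMultiplier.const (γ := 1 - α) (1 / 2)).add hγ
    ((IsMultiplier.const (-1 / 2)).mul h1)).add hγ h2
  refine (congrArg (IsMultiplier (1 - α)) (funext fun n => ?_)).mp h3
  rcases lt_trichotomy n 0 with h | rfl | h
  · obtain ⟨k, hk⟩ : ∃ k : ℕ, n = -((k : ℤ) + 1) := ⟨(-n - 1).toNat, by omega⟩
    rw [if_pos h, if_neg h.ne, hk, hilbSymbol_neg, hilbSymbol_succ]
    norm_num
  · have : hilbSymbol 0 = 0 := by simp [hilbSymbol]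
    rw [this]
    norm_num
  · obtain ⟨k, hk⟩ : ∃ k : ℕ, n = (k : ℤ) + 1 := ⟨(n - 1).toNat, by omega⟩
    rw [if_neg h.ne', if_neg (not_lt.2 h.le), hk, hilbSymbol_succ]
    norm_num

/-- The resolvent of convolution with the Riesz kernel at one of its eigenvalues `moment α m`, off
the corresponding eigenspace (where the junk value `0⁻¹ = 0` is used). A geometric expansion in
powers of the moments leaves an absolutely summable remainder. -/
lemma isMultiplier_resolvent (hα0 : 0 < α) (hα1 : α < 1) (m : ℕ) :
    IsMultiplier (1 - α) fun n => (((moment α n - moment α m)⁻¹ : ℝ) : ℂ) := by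
  have hγ : 0 < 1 - α := by linarith
  set a := moment α m with ha
  have ha0 : 0 < a := moment_pos hα0 hα1 m
  -- the moments decay like `n^{-(1-α)}`, so their `J`-th powers decay like `n^{-2}`
  obtain ⟨J, hJ⟩ := exists_nat_ge (2 / (1 - α))
  rw [div_le_iff₀ hγ] at hJ
  set r : ℤ → ℝ := fun n => (moment α n - a)⁻¹ +
    ∑ j ∈ Finset.range J, moment α n ^ j * (a⁻¹) ^ (j + 1) with hr
  have hrn : Summable fun n : ℕ => r n := by
    have hs : Summable fun n : ℕ => ((a - moment α (m + 1 : ℕ))⁻¹ * (a⁻¹ * moment α 0) ^ J) *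
        (1 / ((n : ℝ) + 1) ^ 2) := by
      refine Summable.mul_left _ ?_
      exact_mod_cast (summable_nat_add_iff 1).2 (Real.summable_one_div_nat_pow.2 one_lt_two)
    refine Summable.of_norm_bounded_eventually_nat hs ?_
    filter_upwards [Filter.eventually_ge_atTop (m + 1)] with n hn
    have hy0 := moment_pos hα0 hα1 n
    have hy1 : moment α n ≤ moment α (m + 1 : ℕ) := (strictAnti_moment hα0 hα1).antitone hn
    have hy2 : moment α (m + 1 : ℕ) < a := strictAnti_moment hα0 hα1 (Nat.lt_succ_self m)
    have hM0 : 0 < moment α 0 := by exact_mod_cast moment_pos hα0 hα1 0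
    have hn0 : (0 : ℝ) ≤ n := n.cast_nonneg
    have e : r n = -((a - moment α n)⁻¹ * (a⁻¹ * moment α n) ^ J) := by
      have hne : a - moment α n ≠ 0 := by linarith
      have hne2 : moment α n - a ≠ 0 := by linarith
      have hg := mul_geom_sum (a⁻¹ * moment α n) J
      have hsum : ∑ j ∈ Finset.range J, moment α n ^ j * (a⁻¹) ^ (j + 1) =
          a⁻¹ * ∑ j ∈ Finset.range J, (a⁻¹ * moment α n) ^ j := by
        rw [Finset.mul_sum]
        refine Finset.sum_congr rfl fun j _ => ?_
        rw [mul_pow, pow_succ]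
        ring
      rw [hr]
      simp only
      rw [hsum]
      set S := ∑ j ∈ Finset.range J, (a⁻¹ * moment α n) ^ j
      have hg' : (moment α n - a) * S = a * ((a⁻¹ * moment α n) ^ J - 1) := by
        rw [← hg]
        field_simp
      have : a⁻¹ * S = (moment α n - a)⁻¹ * ((a⁻¹ * moment α n) ^ J - 1) := by
        field_simp
        linear_combination hg'
      rw [this, ← neg_sub (moment α n) a, inv_neg]
      ring
    rw [e, norm_neg, Real.norm_of_nonneg
      (mul_nonneg (inv_nonneg.2 (by linarith)) (by positivity)), mul_assoc]
    have h1 : (a - moment α n)⁻¹ ≤ (a - moment α (m + 1 : ℕ))⁻¹ :=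
      inv_anti₀ (by linarith) (by linarith)
    have h2 : moment α n ^ J ≤ moment α 0 ^ J * (1 / ((n : ℝ) + 1) ^ 2) := by
      calc moment α n ^ J ≤ (moment α 0 * ((n : ℝ) + 1) ^ (-(1 - α))) ^ J := by
            gcongr
            exact moment_le hα0 hα1 n
        _ = moment α 0 ^ J * ((n : ℝ) + 1) ^ (-(1 - α) * J) := by
            rw [mul_pow, ← Real.rpow_mul_natCast (by positivity)]
        _ ≤ moment α 0 ^ J * ((n : ℝ) + 1) ^ (-2 : ℝ) := by
            gcongr
            · linarith
            · linarith
        _ = _ := by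
            rw [Real.rpow_neg (by positivity), one_div]
            norm_num
    calc _ ≤ (a - moment α (m + 1 : ℕ))⁻¹ *
          (a⁻¹ ^ J * (moment α 0 ^ J * (1 / ((n : ℝ) + 1) ^ 2))) := by
          rw [mul_pow]
          have : 0 < a - moment α (m + 1 : ℕ) := by linarith
          gcongr
      _ = _ := by rw [mul_pow]; ring
  have hrs : Summable r := by
    refine Summable.of_nat_of_neg hrn (hrn.congr fun n => ?_)
    rw [hr]
    simp only [moment_neg]
  have h1 : IsMultiplier (1 - α) fun n => (r n : ℂ) := by
    refine IsMultiplier.of_summable hγ ?_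
    simp only [Complex.norm_real]
    exact hrs.norm
  have h2 : IsMultiplier (1 - α) fun n =>
      ∑ j ∈ Finset.range J, (moment α n : ℂ) ^ j * ((a : ℂ)⁻¹) ^ (j + 1) :=
    IsMultiplier.sum hγ (fun j => ((isMultiplier_moment hγ hα0 hα1).pow j).mul (.const _)) J
  have h3 := h1.add hγ ((IsMultiplier.const (-1)).mul h2)
  refine (congrArg (IsMultiplier (1 - α)) (funext fun n => ?_)).mp h3
  rw [hr]
  push_cast
  ring

/-! ### The linearized operator in Fourier coefficients -/

lemma coeff_linearized (hα0 : 0 < α) (hα1 : α < 1) (Ω : ℝ) (h : SpaceX α) (n : ℕ) :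
    coeff (linearized α Ω h).toFun (n + 1) =
      Complex.I * (((n + 1) * (Ω - Omega α (n + 1)) / 2 : ℝ) : ℂ) * coeff h.toFun (-n) := by
  rw [linearized_eq hα0 hα1]
  exact coeff_im_linE hα0 hα1 h.isX (h.controlled hα0 hα1) Ω n

lemma SpaceY.coeff_neg (g : SpaceY α) (n : ℤ) : coeff g.toFun (-n) = -coeff g.toFun n :=
  g.isY.2.2 n

lemma SpaceY.coeff_zero (g : SpaceY α) : coeff g.toFun 0 = 0 := by
  have h := g.coeff_neg 0
  rw [neg_zero] at h
  exact self_eq_neg.1 h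

lemma SpaceY.ext_coeff {g₁ g₂ : SpaceY α}
    (h : ∀ n : ℕ, coeff g₁.toFun (n + 1) = coeff g₂.toFun (n + 1)) : g₁ = g₂ := by
  refine SpaceY.ext fun w => congrFun (eq_of_coeff_eq g₁.isY.1.1 g₂.isY.1.1 fun n => ?_) w
  rcases lt_trichotomy n 0 with hn | rfl | hn
  · obtain ⟨k, rfl⟩ : ∃ k : ℕ, n = -((k : ℤ) + 1) := ⟨(-n - 1).toNat, by omega⟩
    rw [g₁.coeff_neg, g₂.coeff_neg, h]
  · rw [g₁.coeff_zero, g₂.coeff_zero]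
  · obtain ⟨k, rfl⟩ : ∃ k : ℕ, n = (k : ℤ) + 1 := ⟨(n - 1).toNat, by omega⟩
    exact h k

lemma SpaceX.ext_coeff {f₁ f₂ : SpaceX α}
    (h : ∀ n : ℕ, coeff f₁.toFun (-n) = coeff f₂.toFun (-n)) : f₁ = f₂ := by
  refine SpaceX.ext fun w => congrFun
    (eq_of_coeff_eq f₁.isX.1.continuous f₂.isX.1.continuous fun n => ?_) w
  rcases le_or_gt n 0 with hn | hn
  · obtain ⟨k, rfl⟩ : ∃ k : ℕ, n = -(k : ℤ) := ⟨(-n).toNat, by omega⟩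
    exact h k
  · rw [f₁.isX.2.2 n hn, f₂.isX.2.2 n hn]

lemma SpaceX.coeff_smul (c : ℝ) (f : SpaceX α) (n : ℤ) :
    coeff (c • f).toFun n = c * coeff f.toFun n := VState.coeff_smul c f.toFun n

lemma SpaceY.coeff_smul (c : ℝ) (g : SpaceY α) (n : ℤ) :
    coeff (c • g).toFun n = c * coeff g.toFun n := VState.coeff_smul c g.toFun n

lemma SpaceY.coeff_add (g₁ g₂ : SpaceY α) (n : ℤ) :
    coeff (g₁ + g₂).toFun n = coeff g₁.toFun n + coeff g₂.toFun n :=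
  VState.coeff_add g₁.isY.1.1 g₂.isY.1.1 n

lemma SpaceX.coeff_zero_apply (n : ℤ) : coeff (0 : SpaceX α).toFun n = 0 := by
  have h := SpaceX.coeff_smul 0 (0 : SpaceX α) n
  rwa [zero_smul, Complex.ofReal_zero, zero_mul] at h

lemma SpaceY.coeff_zero_apply (n : ℤ) : coeff (0 : SpaceY α).toFun n = 0 := by
  have h := SpaceY.coeff_smul 0 (0 : SpaceY α) n
  rwa [zero_smul, Complex.ofReal_zero, zero_mul] at h

lemma conj_pow_eq_zpow (w : Circle) (k : ℕ) : conj (w : ℂ) ^ k = (w : ℂ) ^ (-(k : ℤ)) := by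
  rw [conj_coe_eq_zpow, ← zpow_natCast, ← zpow_mul, neg_one_mul]

/-- The function `w ↦ w̄ ^ k` as an element of `X`. -/
def conjPow (hα0 : 0 < α) (hα1 : α < 1) (k : ℕ) : SpaceX α :=
  ⟨fun w => conj (w : ℂ) ^ k, by
    have hc : ∀ n, coeff (fun w : Circle => conj (w : ℂ) ^ k) n = if n = -(k : ℤ) then 1 else 0 :=
      fun n => by simp_rw [conj_pow_eq_zpow, coeff_zpow]
    have hp : ∀ n : ℕ, ∃ A, HB (1 - α) (fun w : Circle => conj (w : ℂ) ^ n) A := fun n => by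
      induction n with
      | zero => exact ⟨_, by simpa using HB.const (γ := 1 - α) 1⟩
      | succ n ih =>
        obtain ⟨A, hA⟩ := ih
        exact ⟨_, hA.mul (HB.coe (by linarith) (by linarith)).star⟩
    obtain ⟨A, hA⟩ := hp (k + 1)
    refine ⟨isHolderOne_of_hasDerivAt
      ((hA.const_mul (-k : ℂ)).isHolder (by linarith)) fun η => ?_, fun n => ?_, fun n hn => ?_⟩
    · have h := hasDerivAt_exp_zpow (-(k : ℤ)) η
      have e : lift (fun w : Circle => conj (w : ℂ) ^ k) =
          fun η : ℝ => (Circle.exp η : ℂ) ^ (-(k : ℤ)) :=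
        funext fun η => conj_pow_eq_zpow _ _
      rw [e]
      refine h.congr_deriv ?_
      have h1 : (Circle.exp η : ℂ) * conj (Circle.exp η : ℂ) = 1 := by
        rw [mul_comm, conj_mul_coe]
      rw [← conj_pow_eq_zpow, pow_succ]
      generalize (Circle.exp η : ℂ) = z at h1 ⊢
      push_cast
      linear_combination (Complex.I * k * conj z ^ k) * h1
    · rw [hc]
      split_ifs <;> simp
    · rw [hc, if_neg (by omega)]⟩

lemma conjPow_apply (hα0 : 0 < α) (hα1 : α < 1) (k : ℕ) (w : Circle) :
    (conjPow hα0 hα1 k).toFun w = conj (w : ℂ) ^ k := rfl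

lemma coeff_conjPow (hα0 : 0 < α) (hα1 : α < 1) (k n : ℕ) :
    coeff (conjPow hα0 hα1 k).toFun (-n) = if n = k then 1 else 0 := by
  have h : (conjPow hα0 hα1 k).toFun = fun w : Circle => (w : ℂ) ^ (-(k : ℤ)) :=
    funext fun w => conj_pow_eq_zpow w k
  rw [h, coeff_zpow]
  simp only [neg_inj, Nat.cast_inj]

/-! ### The kernel -/

lemma Omega_sub_Omega (hα0 : 0 < α) (hα1 : α < 1) (m k : ℕ) :
    Omega α m - Omega α k = Cconst α * (moment α k - moment α m) := by
  rw [Omega_eq hα0 hα1, Omega_eq hα0 hα1]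
  ring

lemma strictMono_Omega (hα0 : 0 < α) (hα1 : α < 1) : StrictMono (Omega α) := fun m k hmk => by
  have h := mul_pos (Cconst_pos hα0 hα1) (sub_pos.2 (strictAnti_moment hα0 hα1 hmk))
  rw [← Omega_sub_Omega hα0 hα1] at h
  linarith

lemma Omega_one (hα0 : 0 < α) (hα1 : α < 1) : Omega α 1 = 0 := by
  rw [Omega_eq hα0 hα1, Nat.cast_one, sub_self, mul_zero]

lemma linearized_eq_zero_iff (hα0 : 0 < α) (hα1 : α < 1) (Ω : ℝ) (h : SpaceX α) :
    linearized α Ω h = 0 ↔ ∀ n : ℕ, Ω = Omega α (n + 1) ∨ coeff h.toFun (-n) = 0 := by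
  have key : ∀ n : ℕ, coeff (linearized α Ω h).toFun (n + 1) = 0 ↔
      Ω = Omega α (n + 1) ∨ coeff h.toFun (-n) = 0 := fun n => by
    have hn : (n : ℝ) + 1 ≠ 0 := by positivity
    rw [coeff_linearized hα0 hα1, mul_eq_zero, mul_eq_zero, Complex.ofReal_eq_zero, div_eq_zero_iff,
      mul_eq_zero, sub_eq_zero]
    simp [hn]
  rw [← forall_congr' key]
  refine ⟨fun h0 n => ?_, fun h0 => SpaceY.ext_coeff fun n => ?_⟩
  · rw [h0, SpaceY.coeff_zero_apply]
  · rw [h0, SpaceY.coeff_zero_apply]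

lemma ker_linearized (hα0 : 0 < α) (hα1 : α < 1) (k : ℕ) :
    (linearized α (Omega α (k + 1))).ker = Submodule.span ℝ {conjPow hα0 hα1 k} := by
  ext h
  rw [Submodule.mem_span_singleton, LinearMap.mem_ker]
  change linearized α (Omega α (k + 1)) h = 0 ↔ _
  rw [linearized_eq_zero_iff hα0 hα1]
  constructor
  · intro h0
    refine ⟨(coeff h.toFun (-k)).re, SpaceX.ext_coeff fun n => ?_⟩
    rw [SpaceX.coeff_smul, coeff_conjPow]
    split_ifs with hn
    · rw [hn, mul_one]
      exact Complex.ext rfl (h.isX.2.1 _).symm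
    · rcases h0 n with h1 | h1
      · have := (strictMono_Omega hα0 hα1).injective h1
        omega
      · rw [h1, mul_zero]
  · rintro ⟨c, rfl⟩ n
    by_cases hn : n = k
    · exact .inl (by rw [hn])
    · refine .inr ?_
      rw [SpaceX.coeff_smul, coeff_conjPow, if_neg hn, mul_zero]

lemma conjPow_ne_zero (hα0 : 0 < α) (hα1 : α < 1) (k : ℕ) : conjPow hα0 hα1 k ≠ 0 := fun h => by
  have h1 := coeff_conjPow hα0 hα1 k k
  rw [h, SpaceX.coeff_zero_apply, if_pos rfl] at h1
  exact zero_ne_one h1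

lemma ker_linearized_ne_bot_iff (hα0 : 0 < α) (hα1 : α < 1) (Ω : ℝ) :
    (linearized α Ω).ker ≠ ⊥ ↔ ∃ k : ℕ, Ω = Omega α (k + 1) := by
  constructor
  · intro h
    by_contra! hΩ
    refine h ((Submodule.eq_bot_iff _).2 fun f hf => SpaceX.ext_coeff fun n => ?_)
    rw [SpaceX.coeff_zero_apply]
    exact ((linearized_eq_zero_iff hα0 hα1 Ω f).1 hf n).resolve_left (hΩ n)
  · rintro ⟨k, rfl⟩
    rw [ker_linearized hα0 hα1, Ne, Submodule.span_singleton_eq_bot]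
    exact conjPow_ne_zero hα0 hα1 k

/-! ### The range -/

/-- The coefficient `g_n` of `g = i ∑ g_n (w^n - w̄^n)`, as a continuous functional on `Y`. -/
def coeffY (n : ℤ) : SpaceY α →L[ℝ] ℝ :=
  LinearMap.mkContinuous
    { toFun := fun g => (coeff g.toFun n).im
      map_add' := fun g₁ g₂ => by rw [SpaceY.coeff_add, Complex.add_im]
      map_smul' := fun c g => by
        rw [SpaceY.coeff_smul, Complex.im_ofReal_mul, RingHom.id_apply, smul_eq_mul] } 1
    fun g => by
      rw [one_mul]
      refine (Complex.abs_im_le_norm _).trans (norm_coeff_le (fun w => ?_) n)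
      exact (norm_le_supNorm g.isY.1.1 w).trans
        (le_add_of_nonneg_right (NNReal.coe_nonneg _))

lemma coeffY_apply (n : ℤ) (g : SpaceY α) : coeffY n g = (coeff g.toFun n).im := rfl

lemma coeffY_eq_zero_iff (n : ℤ) (g : SpaceY α) : coeffY n g = 0 ↔ coeff g.toFun n = 0 := by
  rw [coeffY_apply]
  exact ⟨fun h => Complex.ext (g.isY.2.1 n) h, fun h => by rw [h, Complex.zero_im]⟩

/-- Solvability of the linearized equation. The multiplier formula dictates the coefficients of `h`:
up to the factor `1 / (n + 1)`, which one integration along the circle produces, they arise from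
those of `g` by the resolvent of the Riesz convolution and the projection onto negative frequencies,
and both preserve `C^{1-α}`. -/
lemma exists_linearized_eq (hα0 : 0 < α) (hα1 : α < 1) (k : ℕ) (g : SpaceY α)
    (hg : coeff g.toFun (k + 1) = 0) : ∃ h, linearized α (Omega α (k + 1)) h = g := by
  have hγ : 0 < 1 - α := by linarith
  have hC := (Cconst_pos hα0 hα1).ne'
  have hCc : (Cconst α : ℂ) ≠ 0 := Complex.ofReal_ne_zero.2 hC
  obtain ⟨p, B, hp, hpc⟩ := ((IsMultiplier.const (γ := 1 - α) (2 * Complex.I / Cconst α)).mul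
    ((isMultiplier_neg hα0 hα1).mul (isMultiplier_resolvent hα0 hα1 (k + 1))))
    g.toFun _ (g.isY.1.hb hγ.le)
  beta_reduce at hpc
  have hp0 : ∀ n : ℤ, 0 ≤ n → coeff p n = 0 := fun n hn => by
    rw [hpc, if_neg (by omega), zero_mul, mul_zero, zero_mul]
  have hpim : ∀ n : ℤ, (coeff p n).im = 0 := fun n => by
    have h1 : coeff g.toFun n = Complex.I * ((coeff g.toFun n).im : ℂ) := by
      apply Complex.ext <;> simp [g.isY.2.1 n]
    rw [hpc, h1]
    generalize (coeff g.toFun n).im = t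
    split_ifs
    · rw [← Complex.conj_eq_iff_im]
      simp [Complex.conj_ofNat, neg_div]
    · simp
  -- `w̄ h` is a primitive of `-w̄ p`
  obtain ⟨H, hH, hHd, hH0⟩ := exists_primitive (p := fun w => -1 * (p w * conj (w : ℂ)))
    (((hp.mul (HB.coe hγ (by linarith)).star).const_mul (-1)).isHolder hγ) (by
      rw [coeff_const_mul, coeff_mul_conj, neg_add_cancel, hp0 0 le_rfl, mul_zero]) 0
  -- `coeff H n = -coeff p n / n`
  have hHc : ∀ n : ℤ, n * coeff H n = -coeff p n := fun n => by
    have h1 := coeff_dw hH (n - 1)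
    rw [hHd, coeff_const_mul, coeff_mul_conj, sub_add_cancel] at h1
    push_cast at h1
    linear_combination -h1
  set h : Circle → ℂ := fun w => (w : ℂ) * H w with hh
  have hhol : IsHolderOne (1 - α).toNNReal h := by
    refine isHolderOne_of_hasDerivAt (p := fun w => H w - p w)
      (((controlled hα0 hα1 hH).hb.sub hp).isHolder hγ) fun η => ?_
    refine ((hasDerivAt_exp η).mul (hH.hasDerivAt η)).congr_deriv ?_
    rw [hHd]
    have h1 := conj_mul_coe (Circle.exp η)
    simp only [lift]
    generalize (Circle.exp η : ℂ) = z at h1 ⊢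
    linear_combination (-Complex.I * z * p (Circle.exp η)) * h1
  have hc : ∀ n : ℤ, coeff h n = coeff H (n - 1) := fun n => by
    rw [← coeff_zpow_mul 1 H n]
    simp only [zpow_one, hh]
  have hHval : ∀ n : ℤ, n ≠ 0 → coeff H n = ((-(n : ℝ)⁻¹ : ℝ) : ℂ) * coeff p n := fun n hn => by
    have hn' : (n : ℂ) ≠ 0 := Int.cast_ne_zero.2 hn
    have := hHc n
    push_cast
    field_simp
    linear_combination this
  have hX : IsX α h := by
    refine ⟨hhol, fun n => ?_, fun n hn => ?_⟩
    · rw [hc]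
      rcases eq_or_ne (n - 1) 0 with h1 | h1
      · rw [h1, hH0, Complex.zero_im]
      · rw [hHval _ h1, Complex.im_ofReal_mul, hpim, mul_zero]
    · rw [hc]
      rcases eq_or_ne (n - 1) 0 with h1 | h1
      · rw [h1, hH0]
      · rw [hHval _ h1, hp0 _ (by omega), mul_zero]
  obtain ⟨f, hf⟩ : ∃ f : SpaceX α, f.toFun = h := ⟨⟨h, hX⟩, rfl⟩
  refine ⟨f, SpaceY.ext_coeff fun n => ?_⟩
  rcases eq_or_ne n k with rfl | hnk
  · rw [coeff_linearized hα0 hα1, hg, sub_self]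
    simp
  rw [coeff_linearized hα0 hα1, hf]
  have e : (-(n : ℤ) - 1) = -((n : ℤ) + 1) := by ring
  have hne : ((moment α ((n : ℤ) + 1) - moment α ((k + 1 : ℕ) : ℤ) : ℝ) : ℂ) ≠ 0 := by
    rw [Complex.ofReal_ne_zero, sub_ne_zero]
    intro h1
    have := (strictAnti_moment hα0 hα1).injective (a₁ := n + 1) (a₂ := k + 1)
      (by push_cast at h1 ⊢; exact h1)
    omega
  have hn1 : (n : ℂ) + 1 ≠ 0 := by exact_mod_cast n.succ_ne_zero
  rw [hc, e, hHval _ (by omega), hpc, if_pos (by omega), g.coeff_neg, moment_neg,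
    Omega_sub_Omega hα0 hα1]
  push_cast at hne ⊢
  field_simp
  linear_combination (-(coeff g.toFun (n + 1))) * Complex.I_sq

lemma range_linearized (hα0 : 0 < α) (hα1 : α < 1) (k : ℕ) :
    (linearized α (Omega α (k + 1))).range =
      LinearMap.ker (coeffY (α := α) (k + 1)).toLinearMap := by
  ext g
  rw [LinearMap.mem_ker, LinearMap.mem_range]
  change (∃ h, linearized α (Omega α (k + 1)) h = g) ↔ coeffY (k + 1) g = 0
  rw [coeffY_eq_zero_iff]
  refine ⟨?_, exists_linearized_eq hα0 hα1 k g⟩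
  rintro ⟨h, rfl⟩
  rw [coeff_linearized hα0 hα1, sub_self]
  simp

lemma coeffY_surjective (hα0 : 0 < α) (hα1 : α < 1) (k : ℕ) :
    Function.Surjective (coeffY (α := α) (k + 1)).toLinearMap := by
  refine LinearMap.surjective fun h => ?_
  have h1 : coeffY (k + 1) (linearized α (Omega α (k + 1) + 1) (conjPow hα0 hα1 k)) = 0 :=
    LinearMap.congr_fun h _
  rw [coeffY_eq_zero_iff, coeff_linearized hα0 hα1, coeff_conjPow, if_pos rfl,
    add_sub_cancel_left, mul_one, mul_one] at h1
  have h2 : (((k : ℝ) + 1) / 2 : ℝ) ≠ 0 := by positivity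
  exact mul_ne_zero Complex.I_ne_zero (Complex.ofReal_ne_zero.2 h2) h1

/-! ### Transversality -/

lemma linearized_eq_affine (hα0 : 0 < α) (hα1 : α < 1) (Ω : ℝ) :
    linearized α Ω = linearized α 0 + Ω • (linearized α 1 - linearized α 0) := by
  refine ContinuousLinearMap.ext fun h => SpaceY.ext_coeff fun n => ?_
  change _ = coeff (linearized α 0 h + Ω • (linearized α 1 h - linearized α 0 h)).toFun _
  have e : linearized α 1 h - linearized α 0 h =
      linearized α 1 h + (-1 : ℝ) • linearized α 0 h := by
    rw [neg_one_smul, sub_eq_add_neg]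
  rw [e]
  simp only [SpaceY.coeff_add, SpaceY.coeff_smul, coeff_linearized hα0 hα1]
  push_cast
  ring

lemma hasDerivAt_linearized (hα0 : 0 < α) (hα1 : α < 1) (Ω : ℝ) :
    HasDerivAt (fun Ω => linearized α Ω) (linearized α 1 - linearized α 0) Ω := by
  have e := funext (linearized_eq_affine hα0 hα1)
  generalize linearized α 1 - linearized α 0 = B at e ⊢
  generalize linearized α 0 = A at e
  rw [e]
  exact (((hasDerivAt_id Ω).smul_const B).const_add A).congr_deriv (one_smul _ _)

lemma deriv_linearized_conjPow_notMem (hα0 : 0 < α) (hα1 : α < 1) (k : ℕ) :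
    deriv (fun Ω => linearized α Ω) (Omega α (k + 1)) (conjPow hα0 hα1 k) ∉
      (linearized α (Omega α (k + 1))).range := by
  rw [(hasDerivAt_linearized hα0 hα1 _).deriv, range_linearized hα0 hα1, LinearMap.mem_ker]
  change coeffY (k + 1)
    (linearized α 1 (conjPow hα0 hα1 k) - linearized α 0 (conjPow hα0 hα1 k)) ≠ 0
  rw [map_sub]
  simp only [coeffY_apply, coeff_linearized hα0 hα1, coeff_conjPow, if_true, mul_one,
    Complex.I_mul_im, Complex.ofReal_re]
  have : (0 : ℝ) < k + 1 := by positivity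
  intro h
  linarith

end VState

end

open VState in
theorem proposition8p1 (α : ℝ) (hα0 : 0 < α) (hα1 : α < 1) :
    -- `F(Ω, ·)` maps a neighbourhood of `0` in `X` to `Y`, is differentiable at `0`,
    (∀ᶠ f : SpaceX α in 𝓝 0, ∀ Ω : ℝ, IsY α (patchF α Ω f.toFun)) ∧
    (∀ Ω : ℝ, DifferentiableAt ℝ (mapF α Ω) 0) ∧
    -- and its derivative there is the Fourier multiplier
    -- `∑ b_n w̄^n ↦ (i/2) ∑ (n+1) (Ω - Ω_{n+1}) b_n (w^{n+1} - w̄^{n+1})`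
    (Omega α 1 = 0 ∧ ∀ (Ω : ℝ) (h : SpaceX α) (n : ℕ),
      coeff (linearized α Ω h).toFun (n + 1) =
        Complex.I * (((n + 1) * (Ω - Omega α (n + 1)) / 2 : ℝ) : ℂ) * coeff h.toFun (-n) ∧
      coeff (linearized α Ω h).toFun (-(n + 1)) =
        -(Complex.I * (((n + 1) * (Ω - Omega α (n + 1)) / 2 : ℝ) : ℂ) * coeff h.toFun (-n))) ∧
    -- (1) the kernel
    (∀ Ω : ℝ, (linearized α Ω).ker ≠ ⊥ ↔ Ω = 0 ∨ ∃ m : ℕ, 2 ≤ m ∧ Ω = Omega α m) ∧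
    (∃ v : SpaceX α, (∀ w, v.toFun w = 1) ∧ (linearized α 0).ker = Submodule.span ℝ {v}) ∧
    ∀ m : ℕ, 2 ≤ m →
      ∃ v : SpaceX α, (∀ w : Circle, v.toFun w = (starRingEnd ℂ (w : ℂ)) ^ (m - 1)) ∧
        (linearized α (Omega α m)).ker = Submodule.span ℝ {v} ∧
        Module.finrank ℝ (linearized α (Omega α m)).ker = 1 ∧
        -- (2) the range
        IsClosed ((linearized α (Omega α m)).range : Set (SpaceY α)) ∧
        Module.finrank ℝ (SpaceY α ⧸ (linearized α (Omega α m)).range) = 1 ∧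
        (∀ g : SpaceY α, g ∈ (linearized α (Omega α m)).range ↔ coeff g.toFun m = 0) ∧
        -- (3) transversality
        DifferentiableAt ℝ (fun Ω => linearized α Ω) (Omega α m) ∧
        deriv (fun Ω => linearized α Ω) (Omega α m) v ∉ (linearized α (Omega α m)).range := by
  refine ⟨eventually_isY hα0 hα1, fun Ω => (hasFDerivAt_mapF hα0 hα1 Ω).differentiableAt,
    ⟨Omega_one hα0 hα1, fun Ω h n => ⟨coeff_linearized hα0 hα1 Ω h n, ?_⟩⟩, fun Ω => ?_,
    ⟨conjPow hα0 hα1 0, fun w => by rw [conjPow_apply, pow_zero], ?_⟩, fun m hm => ?_⟩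
  · rw [SpaceY.coeff_neg, coeff_linearized hα0 hα1]
  · rw [ker_linearized_ne_bot_iff hα0 hα1]
    constructor
    · rintro ⟨k, rfl⟩
      rcases Nat.eq_zero_or_pos k with rfl | hk
      · exact .inl (Omega_one hα0 hα1)
      · exact .inr ⟨k + 1, by omega, rfl⟩
    · rintro (rfl | ⟨m, hm, rfl⟩)
      · exact ⟨0, (Omega_one hα0 hα1).symm⟩
      · exact ⟨m - 1, by rw [Nat.sub_add_cancel (by omega)]⟩
  · rw [← ker_linearized hα0 hα1 0, zero_add, Omega_one hα0 hα1]
  · obtain ⟨k, rfl⟩ : ∃ k, m = k + 1 := ⟨m - 1, by omega⟩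
    have hrange := range_linearized hα0 hα1 k
    have hker := ker_linearized hα0 hα1 k
    refine ⟨conjPow hα0 hα1 k, conjPow_apply hα0 hα1 k, hker, ?_, ?_, ?_, fun g => ?_,
      (hasDerivAt_linearized hα0 hα1 _).differentiableAt, deriv_linearized_conjPow_notMem hα0 hα1 k⟩
    · rw [hker, finrank_span_singleton (conjPow_ne_zero hα0 hα1 k)]
    · rw [hrange]
      exact (coeffY (α := α) (k + 1)).isClosed_ker
    · rw [hrange, ((coeffY (α := α) (k + 1)).toLinearMap.quotKerEquivOfSurjective
        (coeffY_surjective hα0 hα1 k)).finrank_eq, Module.finrank_self]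
    · rw [hrange, LinearMap.mem_ker, Nat.cast_add, Nat.cast_one]
      exact coeffY_eq_zero_iff _ g
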